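/- Let $M$ be a smooth manifold. A quaternionic vector bundle $E$ over $M$ is a smooth real vector bundle with structural group $\mathrm{Sp}(1)\cdot\mathrm{GL}(k,\mathbb{H})$; equivalently, it is endowed with a rank three subbundle $Q\subseteq\mathrm{End}(E)$ locally generated by smooth sections $I,J,K$ with $I^2=J^2=-1$ and $K=IJ=-JI$. The bundle $Q$ is oriented and Riemannian, such frames $(I,J,K)$ being positive and orthonormal, and its sphere bundle $\pi:Z\to M$, $Z=\{J\in Q\,|\,J^2=-1\}$, is the bundle of admissible linear complex structures of $E$. Let $(E,V)$ be an almost $f$-quaternionic structure on $M$: $E$ is a quaternionic vector bundle over $M$ and $V,TM\subseteq E$ are vector subbundles such that $E=V\oplus TM$ and $JV\subseteq TM$ for every $J\in Z$. Let $\rho:E\to TM$ be the corresponding projection; then $(E,\rho)$ is an almost co-CR quaternionic structure, that is, $\rho$ is a surjective morphism of vector bundles whose kernel contains no nonzero subspace preserved by some $J\in Z$. Let $D$ be a torsion-free connection on $M$, compatible with $(E,V)$, and let $\nabla$ be the connection induced by $D$ on $E$: $\nabla$ is a (smooth) connection on $E$ which preserves $Q$, $V$ and $TM$, and whose restriction to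 $TM$ is $D$ (thus $\nabla=D^V\oplus D$, with $D^V$ the connection induced on $V$). For $J\in Z$ let $E^J=\ker(J+\mathrm{i})\subseteq E^{\mathbb{C}}_{\pi(J)}$, and let $\mathcal{B}_J\subseteq T^{\mathbb{C}}_JZ$ be the horizontal lift of $\rho(E^J)$ with respect to the connection induced by $\nabla$ on $Z$. Let $\mathcal{C}=(\ker\mathrm{d}\pi)^{0,1}\oplus\mathcal{B}$, a complex distribution on $Z$, where the complex structure on the tangent space at $J$ of a fibre of $Z$, identified with $\{A\in Q_{\pi(J)}\,|\,AJ+JA=0\}$, is $A\mapsto JA$. If $\operatorname{rank}E=4\operatorname{rank}V\geq12$ then $(E,\rho,\nabla)$ is integrable; that is, the space of (local) sections of $\mathcal{C}$ is closed under the Lie bracket. -/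

import Mathlib

open Bundle Filter Module VectorField
open scoped Manifold ContDiff Topology TensorProduct

noncomputable section

namespace CoCR

section Bundles

variable {EM : Type*} [NormedAddCommGroup EM] [NormedSpace ℝ EM]
  {M : Type*} [TopologicalSpace M] [ChartedSpace EM M]
  (F : Type*) [NormedAddCommGroup F] [NormedSpace ℝ F]
  (E : M → Type*) [TopologicalSpace (TotalSpace F E)]
  [∀ x, AddCommGroup (E x)] [∀ x, Module ℝ (E x)] [∀ x, TopologicalSpace (E x)]
  [∀ x, IsTopologicalAddGroup (E x)] [∀ x, ContinuousSMul ℝ (E x)]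
  [FiberBundle F E] [VectorBundle ℝ F E]

/-- The total space of the vector bundle `End(E)`. -/
abbrev EndTotal : Type _ := TotalSpace (F →L[ℝ] F) (fun x : M ↦ E x →L[ℝ] E x)

/-- The model with corners of the total space of `End(E)`. -/
abbrev endModel (EM : Type*) [NormedAddCommGroup EM] [NormedSpace ℝ EM]
    (F : Type*) [NormedAddCommGroup F] [NormedSpace ℝ F] :
    ModelWithCorners ℝ (EM × (F →L[ℝ] F)) (ModelProd EM (F →L[ℝ] F)) :=
  𝓘(ℝ, EM).prod 𝓘(ℝ, F →L[ℝ] F)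

/-- A section of `End(E)`, as a map into the total space. -/
abbrev endSection (A : ∀ x : M, E x →L[ℝ] E x) : M → EndTotal F E := fun x ↦ ⟨x, A x⟩

/-- A section of `E`, as a map into the total space. -/
abbrev bundleSection (σ : ∀ x : M, E x) : M → TotalSpace F E := fun x ↦ ⟨x, σ x⟩

/-- A quaternionic vector bundle structure on `E`, that is, a reduction of the structural group
of `E` to `Sp(1)·GL(k, ℍ)`.  Since this group is the normaliser of `Im ℍ` (acting on `ℍ^k` by
left multiplications) in the real general linear group of `ℍ^k`, such a reduction is given by a
rank three subbundle `Q` of `End(E)` which is locally generated by smooth sections `I, J, K`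
satisfying the quaternionic relations.  The oriented Riemannian structure on `Q` is the one for
which all these `(I, J, K)` are positive orthonormal frames. -/
structure QuaternionicStructure where
  /-- The bundle of imaginary quaternions. -/
  Q : ∀ x : M, Submodule ℝ (E x →L[ℝ] E x)
  exists_local_frame : ∀ x₀ : M, ∃ U : Set M, IsOpen U ∧ x₀ ∈ U ∧
    ∃ I J K : ∀ x : M, E x →L[ℝ] E x,
      ContMDiffOn 𝓘(ℝ, EM) (endModel EM F) ∞ (endSection F E I) U ∧
      ContMDiffOn 𝓘(ℝ, EM) (endModel EM F) ∞ (endSection F E J) U ∧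
      ContMDiffOn 𝓘(ℝ, EM) (endModel EM F) ∞ (endSection F E K) U ∧
      ∀ x ∈ U, I x ∘L I x = -ContinuousLinearMap.id ℝ (E x) ∧
        J x ∘L J x = -ContinuousLinearMap.id ℝ (E x) ∧
        I x ∘L J x = K x ∧ J x ∘L I x = -K x ∧
        Q x = Submodule.span ℝ {I x, J x, K x}

variable {F E}

namespace QuaternionicStructure

variable (𝒬 : QuaternionicStructure (EM := EM) F E)

/-- `J` is an admissible linear complex structure on `E x`: an element of the unit sphere of
`Q x`, equivalently, an element of `Q x` whose square is `-1`. -/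
def IsAdmissible {x : M} (J : E x →L[ℝ] E x) : Prop :=
  J ∈ 𝒬.Q x ∧ J ∘L J = -ContinuousLinearMap.id ℝ (E x)

/-- The bundle `Z` of admissible linear complex structures, as an (embedded) submanifold of the
total space of `End(E)`. -/
def Z : Set (EndTotal F E) := {p | 𝒬.IsAdmissible p.2}

/-- A connection on `E` is compatible with the structural group `Sp(1)·GL(k, ℍ)` if the connection
induced on `End(E)`, `(∇_v A) σ = ∇_v (A σ) - A (∇_v σ)`, preserves `Q`. -/
def IsCompatible (nabla : CovariantDerivative 𝓘(ℝ, EM) F E) : Prop :=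
  ∀ (x : M) (A : ∀ y : M, E y →L[ℝ] E y),
    MDifferentiableAt 𝓘(ℝ, EM) (endModel EM F) (endSection F E A) x →
    (∀ᶠ y in 𝓝 x, A y ∈ 𝒬.Q y) →
    ∀ v : TangentSpace 𝓘(ℝ, EM) x, ∃ B ∈ 𝒬.Q x, ∀ σ : ∀ y : M, E y,
      MDifferentiableAt 𝓘(ℝ, EM) (𝓘(ℝ, EM).prod 𝓘(ℝ, F)) (bundleSection F E σ) x →
      nabla (fun y ↦ A y (σ y)) x v - A x (nabla σ x v) = B (σ x)

end QuaternionicStructure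

/-- The section `A` of `End(E)` satisfies `(∇_v A)(x) = 0`, with respect to the connection induced
on `End(E)` by `nabla`. -/
def IsParallelAt (nabla : CovariantDerivative 𝓘(ℝ, EM) F E) (A : ∀ y : M, E y →L[ℝ] E y)
    (x : M) (v : TangentSpace 𝓘(ℝ, EM) x) : Prop :=
  ∀ σ : ∀ y : M, E y,
    MDifferentiableAt 𝓘(ℝ, EM) (𝓘(ℝ, EM).prod 𝓘(ℝ, F)) (bundleSection F E σ) x →
    nabla (fun y ↦ A y (σ y)) x v = A x (nabla σ x v)

/-- The horizontal subspace at `p` of the connection induced on `End(E)` by `nabla`: it is formed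
of the vectors `dA(v)`, with `A` a section through `p` such that `∇_v A = 0`.  (These vectors
already form a linear space.)  If `nabla` is compatible with a quaternionic structure and `p ∈ Z`,
this is the horizontal subspace at `p` of the connection induced on `Z`. -/
def horizontal (nabla : CovariantDerivative 𝓘(ℝ, EM) F E) (p : EndTotal F E) :
    Submodule ℝ (TangentSpace (endModel EM F) p) :=
  Submodule.span ℝ {ξ | ∃ (A : ∀ y : M, E y →L[ℝ] E y) (v : TangentSpace 𝓘(ℝ, EM) p.1),
    A p.1 = p.2 ∧
    MDifferentiableAt 𝓘(ℝ, EM) (endModel EM F) (endSection F E A) p.1 ∧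
    IsParallelAt nabla A p.1 v ∧
    ξ = mfderiv 𝓘(ℝ, EM) (endModel EM F) (endSection F E A) p.1 v}

/-- The vertical vector at `p` determined by `A ∈ End(E)`: the velocity at `0` of the curve
`t ↦ p + t A` in the fibre. -/
def verticalLift (p : EndTotal F E) (A : E p.1 →L[ℝ] E p.1) :
    TangentSpace (endModel EM F) p :=
  mfderiv 𝓘(ℝ, ℝ) (endModel EM F) (fun t : ℝ ↦ (⟨p.1, p.2 + t • A⟩ : EndTotal F E)) 0 (1 : ℝ)

/-- The element `a + i b` of the complexification of a real vector space. -/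
def cpx {W : Type*} [AddCommGroup W] [Module ℝ W] (a b : W) : ℂ ⊗[ℝ] W :=
  (1 : ℂ) ⊗ₜ[ℝ] a + Complex.I ⊗ₜ[ℝ] b

/-- `E^J = ker(J + i)`, a complex subspace of the complexification of the fibre. -/
def EJ {x : M} (J : E x →L[ℝ] E x) : Submodule ℂ (ℂ ⊗[ℝ] E x) :=
  LinearMap.ker ((J : E x →ₗ[ℝ] E x).baseChange ℂ + Complex.I • LinearMap.id)

/-- `ρ(E^J)`, a complex subspace of the complexified tangent space of `M`. -/
def rhoEJ {x : M} (ρ : E x →L[ℝ] TangentSpace 𝓘(ℝ, EM) x) (J : E x →L[ℝ] E x) :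
    Submodule ℂ (ℂ ⊗[ℝ] TangentSpace 𝓘(ℝ, EM) x) :=
  (EJ J).map ((ρ : E x →ₗ[ℝ] TangentSpace 𝓘(ℝ, EM) x).baseChange ℂ)

/-- The differential of the projection `End(E) → M`. -/
def dproj (p : EndTotal F E) :
    TangentSpace (endModel EM F) p →ₗ[ℝ] TangentSpace 𝓘(ℝ, EM) p.1 :=
  (mfderiv (endModel EM F) 𝓘(ℝ, EM) (TotalSpace.proj : EndTotal F E → M) p).toLinearMap

/-- The horizontal lift at `p = J` of `ρ(E^J)`, with respect to `nabla`. -/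
def distB (ρ : ∀ x : M, E x →L[ℝ] TangentSpace 𝓘(ℝ, EM) x)
    (nabla : CovariantDerivative 𝓘(ℝ, EM) F E) (p : EndTotal F E) :
    Submodule ℂ (ℂ ⊗[ℝ] TangentSpace (endModel EM F) p) :=
  (horizontal nabla p).baseChange ℂ ⊓ (rhoEJ (ρ p.1) p.2).comap ((dproj p).baseChange ℂ)

namespace QuaternionicStructure

variable (𝒬 : QuaternionicStructure (EM := EM) F E)

/-- The space `(ker dπ)^{0,1}` at `p = J ∈ Z`, where `π : Z → M`.  The tangent space at `J` of the
sphere `Z_x` is the orthogonal complement of `J` in `Q x`, that is, the space of all `A ∈ Q x`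
which anticommute with `J`; its complex structure is `A ↦ J A = J × A`, so that its
`(0,1)`-vectors are `A + i J A`. -/
def vertical01 (p : EndTotal F E) : Submodule ℂ (ℂ ⊗[ℝ] TangentSpace (endModel EM F) p) :=
  Submodule.span ℂ {ζ | ∃ A ∈ 𝒬.Q p.1, p.2 ∘L A + A ∘L p.2 = 0 ∧
    ζ = cpx (verticalLift (EM := EM) p A) (verticalLift (EM := EM) p (p.2 ∘L A))}

/-- The complex distribution `𝒞 = (ker dπ)^{0,1} ⊕ ℬ` on `Z`. -/
def distC (ρ : ∀ x : M, E x →L[ℝ] TangentSpace 𝓘(ℝ, EM) x)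
    (nabla : CovariantDerivative 𝓘(ℝ, EM) F E) (p : EndTotal F E) :
    Submodule ℂ (ℂ ⊗[ℝ] TangentSpace (endModel EM F) p) :=
  𝒬.vertical01 p ⊔ distB ρ nabla p

end QuaternionicStructure

/-- A vector field on the total space of `End(E)`, as a map into the tangent bundle. -/
abbrev fieldSection (X : ∀ p : EndTotal F E, TangentSpace (endModel EM F) p) :
    EndTotal F E → TangentBundle (endModel EM F) (EndTotal F E) := fun p ↦ ⟨p, X p⟩

variable (EM F E) in
/-- An almost co-CR quaternionic structure `(E, ρ)` on `M`: a quaternionic vector bundle `E` and a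
surjective morphism of vector bundles `ρ : E → TM` whose kernel contains no nonzero subspace
preserved by some admissible linear complex structure. -/
structure AlmostCoCRQuaternionicStructure [IsManifold 𝓘(ℝ, EM) ∞ M] extends
    QuaternionicStructure (EM := EM) F E where
  /-- The morphism `E → TM`. -/
  ρ : ∀ x : M, E x →L[ℝ] TangentSpace 𝓘(ℝ, EM) x
  contMDiff_ρ : ContMDiff 𝓘(ℝ, EM) (𝓘(ℝ, EM).prod 𝓘(ℝ, F →L[ℝ] EM)) ∞
    (fun x ↦ (⟨x, ρ x⟩ :
      TotalSpace (F →L[ℝ] EM) (fun x : M ↦ E x →L[ℝ] TangentSpace 𝓘(ℝ, EM) x)))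
  surjective_ρ : ∀ x, Function.Surjective (ρ x)
  eq_bot_of_invariant : ∀ (x : M) (J : E x →L[ℝ] E x),
    toQuaternionicStructure.IsAdmissible J → ∀ W : Submodule ℝ (E x),
    (∀ w ∈ W, ρ x w = 0) → (∀ w ∈ W, J w ∈ W) → W = ⊥

/-- Integrability of `(E, ρ, ∇)`: the complex distribution `𝒞` on `Z` is involutive.
Complex vector fields on open subsets of the submanifold `Z` are represented by their local
extensions `X = X₁ + i X₂` to open subsets `O` of the total space of `End(E)`; those extending
sections of `𝒞` are tangent to `Z` along `Z`, so that, along `Z`, their brackets are the brackets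
on `Z`. -/
def AlmostCoCRQuaternionicStructure.IsIntegrable [IsManifold 𝓘(ℝ, EM) ∞ M]
    [ContMDiffVectorBundle ∞ F E 𝓘(ℝ, EM)]
    (S : AlmostCoCRQuaternionicStructure EM F E)
    (nabla : CovariantDerivative 𝓘(ℝ, EM) F E) : Prop :=
  ∀ (O : Set (EndTotal F E)), IsOpen O →
  ∀ X₁ X₂ Y₁ Y₂ : ∀ p : EndTotal F E, TangentSpace (endModel EM F) p,
    ContMDiffOn (endModel EM F) (endModel EM F).tangent ∞ (fieldSection X₁) O →
    ContMDiffOn (endModel EM F) (endModel EM F).tangent ∞ (fieldSection X₂) O →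
    ContMDiffOn (endModel EM F) (endModel EM F).tangent ∞ (fieldSection Y₁) O →
    ContMDiffOn (endModel EM F) (endModel EM F).tangent ∞ (fieldSection Y₂) O →
    (∀ p ∈ O ∩ S.Z, cpx (X₁ p) (X₂ p) ∈ S.distC S.ρ nabla p) →
    (∀ p ∈ O ∩ S.Z, cpx (Y₁ p) (Y₂ p) ∈ S.distC S.ρ nabla p) →
    ∀ p ∈ O ∩ S.Z,
      cpx (mlieBracket (endModel EM F) X₁ Y₁ p - mlieBracket (endModel EM F) X₂ Y₂ p)
        (mlieBracket (endModel EM F) X₁ Y₂ p + mlieBracket (endModel EM F) X₂ Y₁ p)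
        ∈ S.distC S.ρ nabla p

variable (EM F E) in
/-- An almost `f`-quaternionic structure `(E, V)` on `M`: a quaternionic vector bundle
`E = V ⊕ TM` such that `J V ⊆ TM` for every admissible linear complex structure `J`.
The decomposition is given by the inclusion `ι : TM → E` and the projection `ρ : E → TM`, with
`V = ker ρ`. -/
structure AlmostFQuaternionicStructure [IsManifold 𝓘(ℝ, EM) ∞ M] extends
    QuaternionicStructure (EM := EM) F E where
  /-- The inclusion `TM → E`. -/
  ι : ∀ x : M, TangentSpace 𝓘(ℝ, EM) x →L[ℝ] E x
  /-- The projection `E → TM`. -/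
  ρ : ∀ x : M, E x →L[ℝ] TangentSpace 𝓘(ℝ, EM) x
  contMDiff_ι : ContMDiff 𝓘(ℝ, EM) (𝓘(ℝ, EM).prod 𝓘(ℝ, EM →L[ℝ] F)) ∞
    (fun x ↦ (⟨x, ι x⟩ :
      TotalSpace (EM →L[ℝ] F) (fun x : M ↦ TangentSpace 𝓘(ℝ, EM) x →L[ℝ] E x)))
  contMDiff_ρ : ContMDiff 𝓘(ℝ, EM) (𝓘(ℝ, EM).prod 𝓘(ℝ, F →L[ℝ] EM)) ∞
    (fun x ↦ (⟨x, ρ x⟩ :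
      TotalSpace (F →L[ℝ] EM) (fun x : M ↦ E x →L[ℝ] TangentSpace 𝓘(ℝ, EM) x)))
  ρ_ι : ∀ (x : M) (v : TangentSpace 𝓘(ℝ, EM) x), ρ x (ι x v) = v
  map_V_le : ∀ (x : M) (J : E x →L[ℝ] E x), toQuaternionicStructure.IsAdmissible J →
    ∀ u : E x, ρ x u = 0 → ∃ v : TangentSpace 𝓘(ℝ, EM) x, J u = ι x v

namespace AlmostFQuaternionicStructure

variable [IsManifold 𝓘(ℝ, EM) ∞ M] (S : AlmostFQuaternionicStructure EM F E)

/-- The subbundle `V` of `E`. -/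
def V (x : M) : Submodule ℝ (E x) := LinearMap.ker (S.ρ x).toLinearMap

/-- The underlying almost co-CR quaternionic structure `(E, ρ)`. -/
def toAlmostCoCR : AlmostCoCRQuaternionicStructure EM F E where
  toQuaternionicStructure := S.toQuaternionicStructure
  ρ := S.ρ
  contMDiff_ρ := S.contMDiff_ρ
  surjective_ρ x v := ⟨S.ι x v, S.ρ_ι x v⟩
  eq_bot_of_invariant x J hJ W hW hJW := by
    refine (Submodule.eq_bot_iff W).2 fun w hw ↦ ?_
    obtain ⟨v, hv⟩ := S.map_V_le x J hJ w (hW w hw)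
    have h0 : J w = 0 := by
      have h1 := hW _ (hJW w hw)
      rw [hv, S.ρ_ι] at h1
      rw [hv, h1, map_zero]
    have h2 : J (J w) = -w := by simpa using DFunLike.congr_fun hJ.2 w
    rw [h0, map_zero] at h2
    exact neg_eq_zero.1 h2.symm

/-- A connection on `E` is compatible with the group of `f`-quaternionic linear isomorphisms, that
is, the group of quaternionic linear isomorphisms preserving both `V` and `TM`. -/
structure IsCompatible (nabla : CovariantDerivative 𝓘(ℝ, EM) F E) : Prop where
  quaternionic : S.toQuaternionicStructure.IsCompatible nabla
  preserves_V : ∀ (x : M) (σ : ∀ y : M, E y),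
    MDifferentiableAt 𝓘(ℝ, EM) (𝓘(ℝ, EM).prod 𝓘(ℝ, F)) (bundleSection F E σ) x →
    (∀ᶠ y in 𝓝 x, σ y ∈ S.V y) →
    ∀ v : TangentSpace 𝓘(ℝ, EM) x, nabla σ x v ∈ S.V x
  preserves_TM : ∀ (x : M) (σ : ∀ y : M, E y),
    MDifferentiableAt 𝓘(ℝ, EM) (𝓘(ℝ, EM).prod 𝓘(ℝ, F)) (bundleSection F E σ) x →
    (∀ᶠ y in 𝓝 x, σ y ∈ LinearMap.range (S.ι y).toLinearMap) →
    ∀ v : TangentSpace 𝓘(ℝ, EM) x, nabla σ x v ∈ LinearMap.range (S.ι x).toLinearMap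

/-- `D` is a connection on `M`, compatible with `(E, V)`, and `nabla = D^V ⊕ D` is the connection
induced by it on `E`: that is, `nabla` is compatible with `(E, V)` and its restriction to `TM`
is `D`. -/
structure IsInducedBy (nabla : CovariantDerivative 𝓘(ℝ, EM) F E)
    (D : CovariantDerivative 𝓘(ℝ, EM) EM (TangentSpace 𝓘(ℝ, EM) : M → Type _)) : Prop where
  compatible : S.IsCompatible nabla
  restrict_eq : ∀ (x : M) (Y : ∀ y : M, TangentSpace 𝓘(ℝ, EM) y),
    MDifferentiableAt 𝓘(ℝ, EM) 𝓘(ℝ, EM).tangent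
      (fun y ↦ (⟨y, Y y⟩ : TangentBundle 𝓘(ℝ, EM) M)) x →
    ∀ v : TangentSpace 𝓘(ℝ, EM) x, nabla (fun y ↦ S.ι y (Y y)) x v = S.ι x (D Y x v)

end AlmostFQuaternionicStructure

end Bundles

end CoCR

end

/-!
In a chart and a local trivialization of `E`, the structure is given by functions on an open subset
of the model space `EM`: the frame of `Q`, the inclusion `ι` and the projection `ρ`, and the
connection form `Γ`. As `∇` preserves `V`, `TM` and `Q` and is torsion-free on `TM`, the horizontal
part of the bracket of two sections of `𝒞` at `J` again lies in `ρ(E^J)`. What is left is the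
obstruction in the vertical direction, the `(1, 0)` part of `[R(ρe, ρf), J]` for `e, f ∈ E^J`.
It lies in the plane `{A ∈ Q | AJ + JA = 0}` and so is invertible unless it vanishes. By the first
Bianchi identity modulo `V`, applied to `e`, `f` and a third vector of `E^J`, its image is contained
in the sum of `V + JV` and two planes, which has dimension at most `2 rank V + 4 < rank E`.
Hence it vanishes.
-/

open scoped Matrix

noncomputable section

namespace CoCR

section Quaternionic

variable {R : Type*} [Ring R] [Algebra ℝ R]

/-- A representation of the imaginary quaternions `Im ℍ = ℝ³`: the images `I`, `J`, `K` of the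
standard basis satisfy `I² = J² = -1` and `IJ = -JI = K`, since `vw = v × w - ⟨v, w⟩` in `ℍ`. -/
def IsQuaternionic (κ : (Fin 3 → ℝ) →ₗ[ℝ] R) : Prop :=
  ∀ v w, κ v * κ w = κ (v ⨯₃ w) - (v ⬝ᵥ w) • (1 : R)

/-- The elements of `Q` which anticommute with `A`.  If `Q` is the space of imaginary quaternions
and `A² = -1`, this is the tangent space at `A` of the unit sphere of `Q`. -/
def sphereTangent (Q : Submodule ℝ R) (A : R) : Submodule ℝ R :=
  Q ⊓ LinearMap.ker (LinearMap.mulLeft ℝ A + LinearMap.mulRight ℝ A)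

theorem mem_sphereTangent {Q : Submodule ℝ R} {A C : R} :
    C ∈ sphereTangent Q A ↔ C ∈ Q ∧ A * C + C * A = 0 := by
  simp [sphereTangent]

omit [Algebra ℝ R] in
theorem mul_lie_add_lie_mul {A : R} (hA : A * A = -1) (a : R) : A * ⁅a, A⁆ + ⁅a, A⁆ * A = 0 := by
  have : A * ⁅a, A⁆ + ⁅a, A⁆ * A = a * (A * A) - A * A * a := by
    rw [Ring.lie_def]; noncomm_ring
  rw [this, hA]
  simp

theorem lie_mem_sphereTangent {Q : Submodule ℝ R} {A a : R} (hA : A * A = -1) (h : ⁅a, A⁆ ∈ Q) :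
    ⁅a, A⁆ ∈ sphereTangent Q A :=
  mem_sphereTangent.2 ⟨h, mul_lie_add_lie_mul hA a⟩

theorem finrank_sphereTangent_lt [Nontrivial R] {Q : Submodule ℝ R} [FiniteDimensional ℝ Q] {A : R}
    (hA : A ∈ Q) (hAA : A * A = -1) : finrank ℝ (sphereTangent Q A) < finrank ℝ Q := by
  refine Submodule.finrank_lt_finrank_of_lt (lt_of_le_of_ne inf_le_left fun heq ↦ ?_)
  have hAT := (mem_sphereTangent.1 (heq ▸ hA)).2
  rw [hAA, ← two_smul ℝ, smul_eq_zero] at hAT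
  simp at hAT

theorem isQuaternionic_of_mul_eq {I J K : R} (hII : I * I = -1) (hJJ : J * J = -1)
    (hIJ : I * J = K) (hJI : J * I = -K) :
    IsQuaternionic (Fintype.linearCombination ℝ ![I, J, K]) := by
  have hIK : I * K = -J := by rw [← hIJ, ← mul_assoc, hII, neg_one_mul]
  have hKJ : K * J = -I := by rw [← hIJ, mul_assoc, hJJ, mul_neg_one]
  have hKI : K * I = J := by rw [← hIJ, mul_assoc, hJI, mul_neg, hIK, neg_neg]
  have hJK : J * K = I := by rw [← neg_eq_iff_eq_neg.2 hJI, mul_neg, ← mul_assoc, hJJ]; simp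
  have hKK : K * K = -1 := by nth_rw 1 [← hIJ]; rw [mul_assoc, hJK, hII]
  intro v w
  simp only [Fintype.linearCombination_apply, Fin.sum_univ_three, Matrix.cons_val_zero,
    Matrix.cons_val_one, Matrix.cons_val, add_mul, mul_add, smul_mul_smul_comm, hII, hJJ, hKK, hIJ,
    hJI, hIK, hKI, hJK, hKJ, cross_apply, Matrix.vec3_dotProduct]
  module

namespace IsQuaternionic

variable {κ : (Fin 3 → ℝ) →ₗ[ℝ] R} (h : IsQuaternionic κ)
include h

theorem anticomm (v w : Fin 3 → ℝ) : κ v * κ w + κ w * κ v = (-2 * (v ⬝ᵥ w)) • (1 : R) := by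
  rw [h, h, ← cross_anticomm v w, dotProduct_comm w v, map_neg]
  module

theorem mul_self (v : Fin 3 → ℝ) : κ v * κ v = (-(v ⬝ᵥ v)) • (1 : R) := by
  rw [h, cross_self, map_zero, zero_sub, neg_smul]

theorem mul_mem_sphereTangent {A C : R} (hA : A ∈ LinearMap.range κ) (hAA : A * A = -1)
    (hC : C ∈ sphereTangent (LinearMap.range κ) A) :
    A * C ∈ sphereTangent (LinearMap.range κ) A := by
  obtain ⟨hCQ, hAC⟩ := mem_sphereTangent.1 hC
  refine mem_sphereTangent.2 ⟨?_, ?_⟩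
  · obtain ⟨v, rfl⟩ := hA
    obtain ⟨w, rfl⟩ := hCQ
    have hvw : (v ⬝ᵥ w) • (1 : R) = 0 := by
      have := h.anticomm v w
      rw [hAC, mul_smul] at this
      exact (smul_eq_zero.1 this.symm).resolve_left (by norm_num)
    exact ⟨v ⨯₃ w, by rw [h, hvw, sub_zero]⟩
  · rw [mul_assoc, ← mul_add, hAC, mul_zero]

theorem isUnit_of_ne_zero {A : R} (hA : A ∈ LinearMap.range κ) (hA0 : A ≠ 0) : IsUnit A := by
  obtain ⟨v, rfl⟩ := hA
  have hv : -(v ⬝ᵥ v) ≠ 0 := by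
    simpa using fun hv : v = 0 ↦ hA0 (by rw [hv, map_zero])
  have hunit : IsUnit (κ v * κ v) := by
    rw [h.mul_self, ← Algebra.algebraMap_eq_smul_one]
    exact (IsUnit.mk0 _ hv).map _
  exact ((Commute.refl _).isUnit_mul_iff.1 hunit).1

theorem eq_neg_half_dual_anticomm (v : Fin 3 → ℝ) {φ : R →ₗ[ℝ] ℝ} (hφ : φ 1 = 1) :
    v = fun i ↦ -(1 / 2) * φ (κ (Pi.single i 1) * κ v + κ v * κ (Pi.single i 1)) := by
  ext i
  rw [h.anticomm, map_smul, hφ, single_one_dotProduct, smul_eq_mul]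
  ring

variable [Nontrivial R]

theorem dotProduct_eq_zero {v w : Fin 3 → ℝ} (hvw : κ v * κ w + κ w * κ v = 0) : v ⬝ᵥ w = 0 := by
  rw [h.anticomm, smul_eq_zero] at hvw
  simpa using hvw

theorem dotProduct_self_eq_one {v : Fin 3 → ℝ} (hv : κ v * κ v = -1) : v ⬝ᵥ v = 1 := by
  rw [h.mul_self, neg_smul, neg_inj] at hv
  exact smul_left_injective ℝ (one_ne_zero (α := R)) (by simpa using hv)

end IsQuaternionic

end Quaternionic

section Bianchi

variable {F : Type*} [NormedAddCommGroup F] [NormedSpace ℝ F]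

/-- The bracket with `A` of the value of `R` on `(e + iAe, f + iAf)`, up to its component of type
`(0,1)` with respect to `C ↦ AC`: the latter are the elements `C₁ + i C₂` with `C₂ = A C₁`. -/
def typeDefect (R : F → F → F →L[ℝ] F) (A : F →L[ℝ] F) (e f : F) : F →L[ℝ] F :=
  ⁅R e (A f) + R (A e) f, A⁆ - A * ⁅R e f - R (A e) (A f), A⁆

variable {R : F → F → F →L[ℝ] F} {A : F →L[ℝ] F}

theorem typeDefect_mem {κ : (Fin 3 → ℝ) →ₗ[ℝ] (F →L[ℝ] F)} (h : IsQuaternionic κ)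
    (hA : A ∈ LinearMap.range κ) (hAA : A * A = -1)
    (hR : ∀ e f, ⁅R e f, A⁆ ∈ LinearMap.range κ) (e f : F) :
    typeDefect R A e f ∈ sphereTangent (LinearMap.range κ) A := by
  refine sub_mem (lie_mem_sphereTangent hAA ?_)
    (h.mul_mem_sphereTangent hA hAA (lie_mem_sphereTangent hAA ?_))
  · convert! add_mem (hR e (A f)) (hR (A e) f) using 1
    simp only [Ring.lie_def]
    noncomm_ring
  · convert! sub_mem (hR e f) (hR (A e) (A f)) using 1
    simp only [Ring.lie_def]
    noncomm_ring

/-- This is the complexified first Bianchi identity, modulo `V`, for `e + iAe`, `f + iAf` and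
`g + iAg`. -/
theorem typeDefect_cyclic_mem {V : Submodule ℝ F} (hAA : A * A = -1)
    (hR : ∀ e f g, R e f g + R f g e + R g e f ∈ V) (e f g : F) :
    typeDefect R A e f g + typeDefect R A f g e + typeDefect R A g e f ∈
      V ⊔ V.map A.toLinearMap := by
  have hAA' (v : F) : A (A v) = -v := by simpa using DFunLike.congr_fun hAA v
  have hRe : (R e f g + R f g e + R g e f) - (R (A e) (A f) g + R (A f) g (A e) + R g (A e) (A f)) -
      (R e (A f) (A g) + R (A f) (A g) e + R (A g) e (A f)) -
      (R (A e) f (A g) + R f (A g) (A e) + R (A g) (A e) f) ∈ V :=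
    sub_mem (sub_mem (sub_mem (hR _ _ _) (hR _ _ _)) (hR _ _ _)) (hR _ _ _)
  have hIm : (R e f (A g) + R f (A g) e + R (A g) e f) + (R e (A f) g + R (A f) g e + R g e (A f)) +
      (R (A e) f g + R f g (A e) + R g (A e) f) -
      (R (A e) (A f) (A g) + R (A f) (A g) (A e) + R (A g) (A e) (A f)) ∈ V :=
    sub_mem (add_mem (add_mem (hR _ _ _) (hR _ _ _)) (hR _ _ _)) (hR _ _ _)
  convert! neg_mem (Submodule.add_mem_sup hRe (Submodule.mem_map_of_mem hIm)) using 1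
  simp only [typeDefect, Ring.lie_def, ContinuousLinearMap.coe_coe, map_add, map_sub, sub_apply,
    add_apply, mul_apply_eq_comp, hAA']
  abel

/-- If the defect at `(e, f)` were not zero, it would be invertible, and the cyclic identity would
confine its image to a subspace of dimension at most `2 rank V + 4`. -/
theorem typeDefect_eq_zero {κ : (Fin 3 → ℝ) →ₗ[ℝ] (F →L[ℝ] F)}
    (h : IsQuaternionic κ) (hA : A ∈ LinearMap.range κ) (hAA : A * A = -1)
    (hRA : ∀ e f, ⁅R e f, A⁆ ∈ LinearMap.range κ) {V : Submodule ℝ F}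
    (hRV : ∀ e f g, R e f g + R f g e + R g e f ∈ V)
    (hdim : 2 * finrank ℝ V + 4 < finrank ℝ F) (e f : F) : typeDefect R A e f = 0 := by
  have hpos : 0 < finrank ℝ F := by omega
  have := Module.finite_of_finrank_pos hpos
  have := Module.nontrivial_of_finrank_pos hpos
  by_contra hne
  let orbit (v : F) : Submodule ℝ F := (sphereTangent (LinearMap.range κ) A).map
    (ContinuousLinearMap.apply ℝ F v).toLinearMap
  have apply_mem (e f v : F) : typeDefect R A e f v ∈ orbit v :=
    Submodule.mem_map_of_mem (typeDefect_mem h hA hAA hRA e f)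
  have hsurj : Function.Surjective (typeDefect R A e f) :=
    (ContinuousLinearMap.isUnit_iff_bijective.1
      (h.isUnit_of_ne_zero (mem_sphereTangent.1 (typeDefect_mem h hA hAA hRA e f)).1 hne)).2
  let S : Submodule ℝ F := (V ⊔ V.map A.toLinearMap) ⊔ (orbit e ⊔ orbit f)
  have hS : S ≠ ⊤ := by
    have hκ : finrank ℝ (LinearMap.range κ) ≤ 3 := by simpa using LinearMap.finrank_range_le κ
    have horbit (v : F) : finrank ℝ (orbit v) ≤ 2 :=
      (Submodule.finrank_map_le _ _).trans
        (Nat.le_of_lt_succ ((finrank_sphereTangent_lt hA hAA).trans_le hκ))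
    have hS_dim : finrank ℝ S ≤ finrank ℝ V + finrank ℝ V + (2 + 2) := by
      grw [Submodule.finrank_add_le_finrank_add_finrank,
        Submodule.finrank_add_le_finrank_add_finrank,
        Submodule.finrank_add_le_finrank_add_finrank, Submodule.finrank_map_le, horbit, horbit]
    intro htop
    rw [htop, finrank_top] at hS_dim
    omega
  obtain ⟨x, hx⟩ := SetLike.exists_not_mem_of_ne_top S hS rfl
  obtain ⟨g, rfl⟩ := hsurj x
  refine hx ?_
  convert! Submodule.add_mem_sup (typeDefect_cyclic_mem hAA hRV e f g)
    (neg_mem (Submodule.add_mem_sup (apply_mem f g e) (apply_mem g e f))) using 1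
  abel

end Bianchi

section LocalModel

theorem exists_hasDerivAt_dotProduct_self_eq_one {n : Type*} [Fintype n] {v w : n → ℝ}
    (hv : v ⬝ᵥ v = 1) (hvw : v ⬝ᵥ w = 0) :
    ∃ ν : ℝ → n → ℝ, ν 0 = v ∧ HasDerivAt ν w 0 ∧ ∀ t, ν t ⬝ᵥ ν t = 1 := by
  set s := Real.sqrt (w ⬝ᵥ w)
  have hss : w ⬝ᵥ w = s * s :=
    (Real.mul_self_sqrt (Finset.sum_nonneg fun i _ ↦ mul_self_nonneg (w i))).symm
  have hw : (s / s) • w = w := by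
    rcases eq_or_ne s 0 with hs | hs
    · rw [hs, zero_mul, dotProduct_self_eq_zero] at hss
      rw [hss, smul_zero]
    · rw [div_self hs, one_smul]
  have hlin : HasDerivAt (fun t : ℝ ↦ t * s) s 0 := by
    simpa using (hasDerivAt_id (0 : ℝ)).mul_const s
  refine ⟨fun t ↦ Real.cos (t * s) • v + (Real.sin (t * s) / s) • w, by simp, ?_, fun t ↦ ?_⟩
  · convert! (hlin.cos.smul_const v).add ((hlin.sin.div_const s).smul_const w) using 1
    simp [hw]
  · have hsin : Real.sin (t * s) / s * s = Real.sin (t * s) := by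
      rcases eq_or_ne s 0 with hs | hs
      · simp [hs]
      · exact div_mul_cancel₀ _ hs
    simp only [add_dotProduct, dotProduct_add, smul_dotProduct, dotProduct_smul, smul_eq_mul,
      hv, hvw, dotProduct_comm w v, hss]
    linear_combination Real.cos_sq_add_sin_sq (t * s) +
      (Real.sin (t * s) / s * s + Real.sin (t * s)) * hsin

/-- The coordinate expression, over an open set `U`, of a quaternionic vector bundle
`E = V ⊕ TM`, with `J V ⊆ TM` for the admissible complex structures `J`, endowed with a connection
(with connection form `Γ`) which preserves the projection `P = ι ρ` onto `TM` and the bundle of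
imaginary quaternions (spanned by `frame = (I, J, K)`), and whose restriction to `TM` is torsion
free. -/
structure LocalModel (EM F : Type*) [NormedAddCommGroup EM] [NormedSpace ℝ EM]
    [NormedAddCommGroup F] [NormedSpace ℝ F] where
  U : Set EM
  frame : EM → Fin 3 → F →L[ℝ] F
  ι : EM → EM →L[ℝ] F
  ρ : EM → F →L[ℝ] EM
  Γ : EM → EM →L[ℝ] F →L[ℝ] F
  isOpen_U : IsOpen U
  contDiffOn_frame : ∀ i, ContDiffOn ℝ 2 (fun m ↦ frame m i) U
  contDiffOn_ι : ContDiffOn ℝ 2 ι U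
  contDiffOn_ρ : ContDiffOn ℝ 2 ρ U
  contDiffOn_Γ : ContDiffOn ℝ 2 Γ U
  isQuaternionic : ∀ m ∈ U, IsQuaternionic (Fintype.linearCombination ℝ (frame m))
  ρ_ι : ∀ m ∈ U, ∀ u, ρ m (ι m u) = u
  apply_ker : ∀ m ∈ U, ∀ A ∈ LinearMap.range (Fintype.linearCombination ℝ (frame m)), A * A = -1 →
    ∀ v, ρ m v = 0 → ∃ u, A v = ι m u
  torsion : ∀ m ∈ U, ∀ u v, fderiv ℝ ι m u v + Γ m u (ι m v) = fderiv ℝ ι m v u + Γ m v (ι m u)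
  parallel_P : ∀ m ∈ U, ∀ u, fderiv ℝ (fun m ↦ ι m ∘L ρ m) m u + ⁅Γ m u, ι m ∘L ρ m⁆ = 0
  parallel_frame : ∀ m ∈ U, ∀ i u, fderiv ℝ (fun m ↦ frame m i) m u + ⁅Γ m u, frame m i⁆ ∈
    LinearMap.range (Fintype.linearCombination ℝ (frame m))
  lt_finrank : ∀ m ∈ U, 2 * finrank ℝ (LinearMap.ker (ρ m).toLinearMap) + 4 < finrank ℝ F

namespace LocalModel

variable {EM F : Type*} [NormedAddCommGroup EM] [NormedSpace ℝ EM]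
  [NormedAddCommGroup F] [NormedSpace ℝ F] (𝒟 : LocalModel EM F)

/-- The projection onto `TM`. -/
def P (m : EM) : F →L[ℝ] F := 𝒟.ι m ∘L 𝒟.ρ m

/-- The isomorphism from `Im ℍ = ℝ³` onto the imaginary quaternions at `m`. -/
def κ (m : EM) : (Fin 3 → ℝ) →ₗ[ℝ] (F →L[ℝ] F) := Fintype.linearCombination ℝ (𝒟.frame m)

/-- The bundle of imaginary quaternions. -/
def Q (m : EM) : Submodule ℝ (F →L[ℝ] F) := LinearMap.range (𝒟.κ m)

/-- The bundle of admissible complex structures. -/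
def Z : Set (EM × (F →L[ℝ] F)) := {p | p.1 ∈ 𝒟.U ∧ p.2 ∈ 𝒟.Q p.1 ∧ p.2 * p.2 = -1}

/-- The vertical part, with respect to the connection, of a tangent vector to `End(E)`. -/
def vert (p ξ : EM × (F →L[ℝ] F)) : F →L[ℝ] F := ξ.2 + ⁅𝒟.Γ p.1 ξ.1, p.2⁆

/-- The tangent vectors to `Z`: since the horizontal ones are tangent to `Z`, only the vertical
part matters. -/
def IsTangent (p ξ : EM × (F →L[ℝ] F)) : Prop := 𝒟.vert p ξ ∈ sphereTangent (𝒟.Q p.1) p.2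

/-- The covariant derivative at `p`, in the direction `ξ`, of a section of the pull back of `E` to
the total space of `End(E)`. -/
def covF (p ξ : EM × (F →L[ℝ] F)) (s : EM × (F →L[ℝ] F) → F) : F :=
  fderiv ℝ s p ξ + 𝒟.Γ p.1 ξ.1 (s p)

/-- The covariant derivative at `p`, in the direction `ξ`, of a section of the pull back of
`End(E)` to its total space. -/
def covEnd (p ξ : EM × (F →L[ℝ] F)) (s : EM × (F →L[ℝ] F) → F →L[ℝ] F) : F →L[ℝ] F :=
  fderiv ℝ s p ξ + ⁅𝒟.Γ p.1 ξ.1, s p⁆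

variable {𝒟} {m : EM} {p ξ η : EM × (F →L[ℝ] F)}

section

variable {W : Type*} [NormedAddCommGroup W] [NormedSpace ℝ W] {f : EM → W}

theorem differentiableAt_comp_fst (hf : DifferentiableAt ℝ f p.1) :
    DifferentiableAt ℝ (fun q : EM × (F →L[ℝ] F) ↦ f q.1) p :=
  hf.comp p differentiableAt_fst

theorem fderiv_comp_fst (hf : DifferentiableAt ℝ f p.1) :
    fderiv ℝ (fun q : EM × (F →L[ℝ] F) ↦ f q.1) p ξ = fderiv ℝ f p.1 ξ.1 :=
  DFunLike.congr_fun (hf.hasFDerivAt.comp p hasFDerivAt_fst).fderiv ξ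

end

section Differentiability

variable (hm : m ∈ 𝒟.U)
include hm

theorem differentiableAt_frame (i : Fin 3) : DifferentiableAt ℝ (fun m ↦ 𝒟.frame m i) m :=
  ((𝒟.contDiffOn_frame i).differentiableOn two_ne_zero).differentiableAt (𝒟.isOpen_U.mem_nhds hm)

theorem differentiableAt_ι : DifferentiableAt ℝ 𝒟.ι m :=
  (𝒟.contDiffOn_ι.differentiableOn two_ne_zero).differentiableAt (𝒟.isOpen_U.mem_nhds hm)

theorem differentiableAt_P : DifferentiableAt ℝ 𝒟.P m :=
  (differentiableAt_ι hm).clm_comp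
    ((𝒟.contDiffOn_ρ.differentiableOn two_ne_zero).differentiableAt (𝒟.isOpen_U.mem_nhds hm))

theorem differentiableAt_Γ : DifferentiableAt ℝ 𝒟.Γ m :=
  (𝒟.contDiffOn_Γ.differentiableOn two_ne_zero).differentiableAt (𝒟.isOpen_U.mem_nhds hm)

theorem nontrivial : Nontrivial F :=
  Module.nontrivial_of_finrank_pos (R := ℝ) ((Nat.zero_le _).trans_lt (𝒟.lt_finrank m hm))

theorem isQuaternionic_κ : IsQuaternionic (𝒟.κ m) := 𝒟.isQuaternionic m hm

theorem hasFDerivAt_κ (v : Fin 3 → ℝ) :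
    HasFDerivAt (fun m ↦ 𝒟.κ m v) (∑ i, v i • fderiv ℝ (fun m ↦ 𝒟.frame m i) m) m := by
  simp only [κ, Fintype.linearCombination_apply]
  exact HasFDerivAt.fun_sum fun i _ ↦ (differentiableAt_frame hm i).hasFDerivAt.const_smul (v i)

theorem fderiv_κ_add_lie_mem (v : Fin 3 → ℝ) (u : EM) :
    fderiv ℝ (fun m ↦ 𝒟.κ m v) m u + ⁅𝒟.Γ m u, 𝒟.κ m v⁆ ∈ 𝒟.Q m := by
  rw [(hasFDerivAt_κ hm v).fderiv]
  convert! sum_mem fun i (_ : i ∈ Finset.univ) ↦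
    Submodule.smul_mem _ (v i) (𝒟.parallel_frame m hm i u) using 1
  simp only [sum_apply, smul_apply, smul_add, Finset.sum_add_distrib,
    κ, Fintype.linearCombination_apply, Ring.lie_def, smul_sub, Finset.sum_sub_distrib,
    Finset.mul_sum, Finset.sum_mul, mul_smul_comm, smul_mul_assoc]

theorem hasFDerivAt_κ_apply {W : Type*} [NormedAddCommGroup W] [NormedSpace ℝ W] {a : W → EM}
    {c : W → Fin 3 → ℝ} {a' : W →L[ℝ] EM} {c' : W →L[ℝ] Fin 3 → ℝ} {w : W} (haw : a w = m)
    (ha : HasFDerivAt a a' w) (hc : HasFDerivAt c c' w) :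
    HasFDerivAt (fun x ↦ 𝒟.κ (a x) (c x))
      (fderiv ℝ (fun m ↦ 𝒟.κ m (c w)) m ∘L a' +
        LinearMap.toContinuousLinearMap (𝒟.κ m) ∘L c') w := by
  subst haw
  rw [(hasFDerivAt_κ hm (c w)).fderiv]
  simp only [κ, Fintype.linearCombination_apply]
  convert! HasFDerivAt.fun_sum fun i (_ : i ∈ Finset.univ) ↦
    (hasFDerivAt_pi'.1 hc i).smul ((differentiableAt_frame hm i).hasFDerivAt.comp w ha) using 1
  ext ξ : 1
  simp [Fintype.linearCombination_apply, Finset.sum_add_distrib]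

theorem fderiv_κ_add_lie_mem_sphereTangent {v : Fin 3 → ℝ} (hv : v ⬝ᵥ v = 1) (u : EM) :
    fderiv ℝ (fun m ↦ 𝒟.κ m v) m u + ⁅𝒟.Γ m u, 𝒟.κ m v⁆ ∈ sphereTangent (𝒟.Q m) (𝒟.κ m v) := by
  have hsq {m : EM} (hm : m ∈ 𝒟.U) : 𝒟.κ m v * 𝒟.κ m v = -1 := by
    simpa [hv] using (isQuaternionic_κ hm).mul_self v
  have hκ := (hasFDerivAt_κ hm v).differentiableAt.hasFDerivAt
  have hconst : HasFDerivAt (fun m ↦ 𝒟.κ m v * 𝒟.κ m v) (0 : EM →L[ℝ] F →L[ℝ] F) m := by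
    refine (hasFDerivAt_const (-1 : F →L[ℝ] F) m).congr_of_eventuallyEq ?_
    filter_upwards [𝒟.isOpen_U.mem_nhds hm] with m hm using hsq hm
  have hderiv := DFunLike.congr_fun ((hκ.mul' hκ).unique hconst) u
  refine mem_sphereTangent.2 ⟨fderiv_κ_add_lie_mem hm v u, ?_⟩
  rw [mul_add, add_mul, add_add_add_comm, mul_lie_add_lie_mul (hsq hm), add_zero]
  simpa using hderiv

end Differentiability

theorem IsTangent.exists_curve (hp : p ∈ 𝒟.Z) (hξ : 𝒟.IsTangent p ξ) :
    ∃ γ : ℝ → EM × (F →L[ℝ] F), γ 0 = p ∧ HasDerivAt γ ξ 0 ∧ ∀ᶠ t in 𝓝 0, γ t ∈ 𝒟.Z := by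
  obtain ⟨m, A⟩ := p
  obtain ⟨u, D⟩ := ξ
  obtain ⟨hm, ⟨v, hv⟩, hAA⟩ := hp
  obtain rfl : 𝒟.κ m v = A := hv
  dsimp only at hm hAA
  have := nontrivial hm
  have hκ := isQuaternionic_κ hm
  have hv : v ⬝ᵥ v = 1 := hκ.dotProduct_self_eq_one hAA
  have hD : D - fderiv ℝ (fun m ↦ 𝒟.κ m v) m u ∈ sphereTangent (𝒟.Q m) (𝒟.κ m v) := by
    convert! sub_mem hξ (fderiv_κ_add_lie_mem_sphereTangent hm hv u) using 1
    exact (add_sub_add_right_eq_sub _ _ _).symm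
  obtain ⟨⟨w, hw⟩, hvw⟩ := mem_sphereTangent.1 hD
  rw [← hw] at hvw
  obtain ⟨ν, hν0, hν, hνν⟩ :=
    exists_hasDerivAt_dotProduct_self_eq_one hv (hκ.dotProduct_eq_zero hvw)
  have hmt : HasDerivAt (fun t : ℝ ↦ m + t • u) u 0 := by
    simpa using ((hasDerivAt_id (0 : ℝ)).smul_const u).const_add m
  refine ⟨fun t ↦ (m + t • u, 𝒟.κ (m + t • u) (ν t)), by simp [hν0], hmt.prodMk ?_, ?_⟩
  · convert! (hasFDerivAt_κ_apply hm (by simp) hmt.hasFDerivAt hν.hasFDerivAt).hasDerivAt using 1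
    simpa [hν0] using (eq_add_of_sub_eq' hw.symm)
  · have hU : ∀ᶠ t : ℝ in 𝓝 0, m + t • u ∈ 𝒟.U :=
      hmt.continuousAt.eventually_mem (by simpa using 𝒟.isOpen_U.mem_nhds hm)
    filter_upwards [hU] with t ht
    exact ⟨ht, ⟨ν t, rfl⟩, by simpa [hνν] using (isQuaternionic_κ ht).mul_self (ν t)⟩

section

variable {W : Type*} [NormedAddCommGroup W] [NormedSpace ℝ W] {g g' : EM × (F →L[ℝ] F) → W}

theorem IsTangent.fderiv_eq_zero (hp : p ∈ 𝒟.Z) (hξ : 𝒟.IsTangent p ξ)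
    (hg : DifferentiableAt ℝ g p) (hgZ : ∀ᶠ q in 𝓝[𝒟.Z] p, g q = 0) : fderiv ℝ g p ξ = 0 := by
  obtain ⟨γ, rfl, hγ, hZ⟩ := hξ.exists_curve hp
  have hchain : HasDerivAt (g ∘ γ) (fderiv ℝ g (γ 0) ξ) 0 :=
    hg.hasFDerivAt.comp_hasDerivAt 0 hγ
  have hzero : HasDerivAt (g ∘ γ) 0 0 := by
    refine (hasDerivAt_const (0 : ℝ) (0 : W)).congr_of_eventuallyEq ?_
    exact (tendsto_nhdsWithin_iff.2 ⟨hγ.continuousAt, hZ⟩).eventually hgZ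
  exact hchain.unique hzero

theorem IsTangent.fderiv_congr (hp : p ∈ 𝒟.Z) (hξ : 𝒟.IsTangent p ξ)
    (hg : DifferentiableAt ℝ g p) (hg' : DifferentiableAt ℝ g' p)
    (h : ∀ᶠ q in 𝓝[𝒟.Z] p, g q = g' q) : fderiv ℝ g p ξ = fderiv ℝ g' p ξ := by
  have := hξ.fderiv_eq_zero hp (hg.sub hg') (by filter_upwards [h] with q hq; simp [hq])
  rwa [fderiv_sub hg hg', sub_apply, sub_eq_zero] at this

end

theorem covEnd_mem (hp : p ∈ 𝒟.Z) (hξ : 𝒟.IsTangent p ξ)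
    {s : EM × (F →L[ℝ] F) → F →L[ℝ] F} (hs : DifferentiableAt ℝ s p)
    (hsQ : ∀ᶠ q in 𝓝[𝒟.Z] p, s q ∈ 𝒟.Q q.1) : 𝒟.covEnd p ξ s ∈ 𝒟.Q p.1 := by
  have hm := hp.1
  have := nontrivial hm
  obtain ⟨φ, hφ⟩ := SeparatingDual.exists_eq_one (R := ℝ) (one_ne_zero (α := F →L[ℝ] F))
  let c (q : EM × (F →L[ℝ] F)) : Fin 3 → ℝ := fun i ↦
    -(1 / 2) * φ (𝒟.κ q.1 (Pi.single i 1) * s q + s q * 𝒟.κ q.1 (Pi.single i 1))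
  have hc : DifferentiableAt ℝ c p := by
    refine differentiableAt_pi.2 fun i ↦ (φ.differentiableAt.comp p ?_).const_mul _
    have hκi : DifferentiableAt ℝ (fun q ↦ 𝒟.κ q.1 (Pi.single i 1)) p :=
      differentiableAt_comp_fst (hasFDerivAt_κ hm _).differentiableAt
    exact (hκi.mul hs).add (hs.mul hκi)
  have hsc : ∀ᶠ q in 𝓝[𝒟.Z] p, s q = 𝒟.κ q.1 (c q) := by
    filter_upwards [hsQ, self_mem_nhdsWithin] with q ⟨v, hv⟩ hqZ
    have := (isQuaternionic_κ hqZ.1).eq_neg_half_dual_anticomm v (φ := φ.toLinearMap) hφ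
    rw [show c q = v by simpa [c, ← hv] using this.symm]
    exact hv.symm
  have hκc := hasFDerivAt_κ_apply hm rfl (hasFDerivAt_fst (p := p)) hc.hasFDerivAt
  rw [covEnd, hξ.fderiv_congr hp hs hκc.differentiableAt hsc, hκc.fderiv, hsc.self_of_nhdsWithin hp]
  convert! add_mem (fderiv_κ_add_lie_mem hm (c p) ξ.1)
    (LinearMap.mem_range_self (𝒟.κ p.1) (fderiv ℝ c p ξ)) using 1
  exact add_right_comm _ _ _

end LocalModel

end LocalModel

section Curvature

theorem fderiv_fderiv_comm {X W : Type*} [NormedAddCommGroup X] [NormedSpace ℝ X]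
    [NormedAddCommGroup W] [NormedSpace ℝ W] {f : X → W} {s : Set X} {x : X} (hs : IsOpen s)
    (hf : ContDiffOn ℝ 2 f s) (hx : x ∈ s) (u v : X) :
    fderiv ℝ (fderiv ℝ f) x u v = fderiv ℝ (fderiv ℝ f) x v u :=
  ((hf.contDiffAt (hs.mem_nhds hx)).isSymmSndFDerivAt (by simp)) u v

theorem differentiableAt_fderiv {X W : Type*} [NormedAddCommGroup X] [NormedSpace ℝ X]
    [NormedAddCommGroup W] [NormedSpace ℝ W] {f : X → W} {s : Set X} {x : X} (hs : IsOpen s)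
    (hf : ContDiffOn ℝ 2 f s) (hx : x ∈ s) : DifferentiableAt ℝ (fderiv ℝ f) x :=
  ((hf.contDiffAt (hs.mem_nhds hx)).fderiv_right (m := 1) (by norm_num)).differentiableAt
    one_ne_zero

theorem hasFDerivAt_apply_const {X V W : Type*} [NormedAddCommGroup X] [NormedSpace ℝ X]
    [NormedAddCommGroup V] [NormedSpace ℝ V] [NormedAddCommGroup W] [NormedSpace ℝ W]
    {f : X → V →L[ℝ] W} {x : X} (hf : DifferentiableAt ℝ f x) (v : V) :
    HasFDerivAt (fun y ↦ f y v) ((fderiv ℝ f x).flip v) x := by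
  simpa using hf.hasFDerivAt.clm_apply (hasFDerivAt_const v x)

namespace LocalModel

variable {EM F : Type*} [NormedAddCommGroup EM] [NormedSpace ℝ EM]
  [NormedAddCommGroup F] [NormedSpace ℝ F] (𝒟 : LocalModel EM F)

/-- The curvature form of the connection. -/
def curv (m u v : EM) : F →L[ℝ] F :=
  fderiv ℝ 𝒟.Γ m u v - fderiv ℝ 𝒟.Γ m v u + ⁅𝒟.Γ m u, 𝒟.Γ m v⁆

/-- The covariant derivative, in the direction `u`, of a section of `End(E)` over the base. -/
def nablaEnd (f : EM → F →L[ℝ] F) (u m : EM) : F →L[ℝ] F := fderiv ℝ f m u + ⁅𝒟.Γ m u, f m⁆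

/-- The covariant derivative, in the direction `u`, of the section `ι v` of `E`: the torsion of the
connection is the skew-symmetric part of this expression. -/
def solder (u v m : EM) : F := fderiv ℝ 𝒟.ι m u v + 𝒟.Γ m u (𝒟.ι m v)

variable {𝒟} {m : EM} {f : EM → F →L[ℝ] F}

theorem hasFDerivAt_nablaEnd (hf : ContDiffOn ℝ 2 f 𝒟.U) (hm : m ∈ 𝒟.U)
    (u v : EM) : DifferentiableAt ℝ (𝒟.nablaEnd f u) m ∧
      fderiv ℝ (𝒟.nablaEnd f u) m v = fderiv ℝ (fderiv ℝ f) m v u +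
        (⁅fderiv ℝ 𝒟.Γ m v u, f m⁆ + ⁅𝒟.Γ m u, fderiv ℝ f m v⁆) := by
  have hf2 := hasFDerivAt_apply_const (differentiableAt_fderiv 𝒟.isOpen_U hf hm) u
  have hΓ := hasFDerivAt_apply_const (differentiableAt_Γ hm) u
  have hf1 := ((hf.differentiableOn two_ne_zero).differentiableAt
    (𝒟.isOpen_U.mem_nhds hm)).hasFDerivAt
  have hsum : HasFDerivAt (𝒟.nablaEnd f u) _ m := hf2.add ((hΓ.mul' hf1).sub (hf1.mul' hΓ))
  refine ⟨hsum.differentiableAt, ?_⟩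
  rw [hsum.fderiv]
  simp only [add_apply, sub_apply, smul_apply, ContinuousLinearMap.flip_apply, smul_eq_mul,
    op_smul_eq_mul, Ring.lie_def]
  abel

theorem lie_curv (hf : ContDiffOn ℝ 2 f 𝒟.U) (hm : m ∈ 𝒟.U) (u v : EM) :
    ⁅𝒟.curv m v u, f m⁆ = 𝒟.nablaEnd (𝒟.nablaEnd f u) v m - 𝒟.nablaEnd (𝒟.nablaEnd f v) u m := by
  change _ = fderiv ℝ (𝒟.nablaEnd f u) m v + _ - (fderiv ℝ (𝒟.nablaEnd f v) m u + _)
  rw [(hasFDerivAt_nablaEnd hf hm u v).2, (hasFDerivAt_nablaEnd hf hm v u).2,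
    fderiv_fderiv_comm 𝒟.isOpen_U hf hm v u]
  simp only [nablaEnd, curv, Ring.lie_def]
  noncomm_ring

theorem lie_curv_P (hm : m ∈ 𝒟.U) (u v : EM) : ⁅𝒟.curv m u v, 𝒟.P m⁆ = 0 := by
  have hsecond (u v : EM) : 𝒟.nablaEnd (𝒟.nablaEnd 𝒟.P u) v m = 0 := by
    have hparallel : 𝒟.nablaEnd 𝒟.P u =ᶠ[𝓝 m] fun _ ↦ 0 := by
      filter_upwards [𝒟.isOpen_U.mem_nhds hm] with m' hm' using 𝒟.parallel_P m' hm' u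
    rw [nablaEnd, hparallel.fderiv_eq, hparallel.self_of_nhds, Ring.lie_def]
    simp
  have hP : ContDiffOn ℝ 2 𝒟.P 𝒟.U := 𝒟.contDiffOn_ι.clm_comp 𝒟.contDiffOn_ρ
  rw [lie_curv hP hm, hsecond, hsecond, sub_zero]

theorem nablaEnd_mem (hf : DifferentiableAt ℝ f m)
    (hfQ : ∀ m ∈ 𝒟.U, f m ∈ 𝒟.Q m) {A : F →L[ℝ] F} (hA : (m, A) ∈ 𝒟.Z) (u : EM) :
    𝒟.nablaEnd f u m ∈ 𝒟.Q m := by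
  have hhor : 𝒟.IsTangent (m, A) (u, -⁅𝒟.Γ m u, A⁆) := by
    rw [IsTangent, vert, neg_add_cancel]
    exact zero_mem _
  have := covEnd_mem hA hhor (s := fun q ↦ f q.1) (differentiableAt_comp_fst hf)
    (by filter_upwards [self_mem_nhdsWithin] with q hq using hfQ _ hq.1)
  rwa [covEnd, fderiv_comp_fst hf] at this

theorem lie_curv_mem {A : F →L[ℝ] F} (hA : (m, A) ∈ 𝒟.Z) (u v : EM) :
    ⁅𝒟.curv m u v, A⁆ ∈ 𝒟.Q m := by
  have hm : m ∈ 𝒟.U := hA.1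
  obtain ⟨a, ha⟩ := hA.2.1
  obtain rfl : 𝒟.κ m a = A := ha
  have hκ : ContDiffOn ℝ 2 (fun m ↦ 𝒟.κ m a) 𝒟.U := by
    simp only [κ, Fintype.linearCombination_apply]
    exact ContDiffOn.sum fun i _ ↦ (𝒟.contDiffOn_frame i).const_smul (a i)
  have hmem (u v : EM) : 𝒟.nablaEnd (𝒟.nablaEnd (fun m ↦ 𝒟.κ m a) u) v m ∈ 𝒟.Q m :=
    nablaEnd_mem (hasFDerivAt_nablaEnd hκ hm u v).1
      (fun m hm ↦ fderiv_κ_add_lie_mem hm a u) hA v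
  rw [lie_curv (f := fun m ↦ 𝒟.κ m a) hκ hm]
  exact sub_mem (hmem v u) (hmem u v)

theorem fderiv_solder (hm : m ∈ 𝒟.U) (u v w : EM) :
    fderiv ℝ (𝒟.solder u v) m w = fderiv ℝ (fderiv ℝ 𝒟.ι) m w u v +
      (fderiv ℝ 𝒟.Γ m w u (𝒟.ι m v) + 𝒟.Γ m u (fderiv ℝ 𝒟.ι m w v)) := by
  have hι2 := hasFDerivAt_apply_const (hasFDerivAt_apply_const
    (differentiableAt_fderiv 𝒟.isOpen_U 𝒟.contDiffOn_ι hm) u).differentiableAt v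
  have hΓ := hasFDerivAt_apply_const (differentiableAt_Γ hm) u
  have hι := hasFDerivAt_apply_const (differentiableAt_ι hm) v
  have hsum : HasFDerivAt (𝒟.solder u v) _ m := hι2.add (hΓ.clm_apply hι)
  rw [hsum.fderiv]
  simp only [add_apply, ContinuousLinearMap.flip_apply, ContinuousLinearMap.comp_apply,
    (hasFDerivAt_apply_const (differentiableAt_fderiv 𝒟.isOpen_U 𝒟.contDiffOn_ι hm) u).fderiv]
  abel

theorem curv_ι (hm : m ∈ 𝒟.U) (u v w : EM) :
    𝒟.curv m w u (𝒟.ι m v) =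
      (fderiv ℝ (𝒟.solder u v) m w + 𝒟.Γ m w (𝒟.solder u v m)) -
        (fderiv ℝ (𝒟.solder w v) m u + 𝒟.Γ m u (𝒟.solder w v m)) := by
  rw [fderiv_solder hm, fderiv_solder hm, fderiv_fderiv_comm 𝒟.isOpen_U 𝒟.contDiffOn_ι hm w u]
  simp only [solder, curv, map_add, add_apply, sub_apply, Ring.lie_def,
    mul_apply_eq_comp]
  abel

theorem bianchi (hm : m ∈ 𝒟.U) (u v w : EM) :
    𝒟.curv m u v (𝒟.ι m w) + 𝒟.curv m v w (𝒟.ι m u) + 𝒟.curv m w u (𝒟.ι m v) = 0 := by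
  have hsymm (u v : EM) : 𝒟.solder u v =ᶠ[𝓝 m] 𝒟.solder v u := by
    filter_upwards [𝒟.isOpen_U.mem_nhds hm] with m' hm' using 𝒟.torsion m' hm' u v
  rw [curv_ι hm, curv_ι hm, curv_ι hm, (hsymm v w).fderiv_eq, (hsymm v w).self_of_nhds,
    (hsymm u w).fderiv_eq, (hsymm u w).self_of_nhds, (hsymm u v).fderiv_eq,
    (hsymm u v).self_of_nhds]
  abel

theorem curv_cyclic_mem_ker (hm : m ∈ 𝒟.U) (e f g : F) :
    𝒟.curv m (𝒟.ρ m e) (𝒟.ρ m f) g + 𝒟.curv m (𝒟.ρ m f) (𝒟.ρ m g) e +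
      𝒟.curv m (𝒟.ρ m g) (𝒟.ρ m e) f ∈ LinearMap.ker (𝒟.ρ m).toLinearMap := by
  have hcomm (u v : EM) (e : F) : 𝒟.P m (𝒟.curv m u v e) = 𝒟.curv m u v (𝒟.ι m (𝒟.ρ m e)) :=
    (DFunLike.congr_fun (sub_eq_zero.1 (lie_curv_P hm u v)) e).symm
  have hP : 𝒟.P m (𝒟.curv m (𝒟.ρ m e) (𝒟.ρ m f) g + 𝒟.curv m (𝒟.ρ m f) (𝒟.ρ m g) e +
      𝒟.curv m (𝒟.ρ m g) (𝒟.ρ m e) f) = 0 := by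
    rw [map_add, map_add, hcomm, hcomm, hcomm, bianchi hm]
  simpa [P, 𝒟.ρ_ι m hm] using congrArg (𝒟.ρ m) hP

theorem typeDefect_curv_eq_zero {p : EM × (F →L[ℝ] F)} (hp : p ∈ 𝒟.Z) (e f : F) :
    typeDefect (fun e f ↦ 𝒟.curv p.1 (𝒟.ρ p.1 e) (𝒟.ρ p.1 f)) p.2 e f = 0 :=
  typeDefect_eq_zero (isQuaternionic_κ hp.1) hp.2.1 hp.2.2 (fun _ _ ↦ lie_curv_mem hp _ _)
    (curv_cyclic_mem_ker hp.1) (𝒟.lt_finrank _ hp.1) e f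

end LocalModel

end Curvature

section Involutivity

namespace LocalModel

variable {EM F : Type*} [NormedAddCommGroup EM] [NormedSpace ℝ EM]
  [NormedAddCommGroup F] [NormedSpace ℝ F] (𝒟 : LocalModel EM F)
  {p ξ η ξ₁ ξ₂ : EM × (F →L[ℝ] F)}

/-- The pairs `(ξ₁, ξ₂)` such that `ξ₁ + i ξ₂` belongs to the distribution `𝒞`. -/
structure IsTypeC (p ξ₁ ξ₂ : EM × (F →L[ℝ] F)) : Prop where
  tangent : 𝒟.IsTangent p ξ₁
  vert_eq : 𝒟.vert p ξ₂ = p.2 * 𝒟.vert p ξ₁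
  exists_base : ∃ e, ξ₁.1 = 𝒟.ρ p.1 e ∧ ξ₂.1 = 𝒟.ρ p.1 (p.2 e)

/-- The vector `e` of `E` such that `u₁ + i u₂ = ρ (e + i A e)`, where `A` is the complex structure
`p.2`: the condition `A V ⊆ TM` makes it depend smoothly on `u₁` and `u₂`. -/
def base (p : EM × (F →L[ℝ] F)) (u₁ u₂ : EM) : F :=
  𝒟.ι p.1 u₁ - (1 - 𝒟.P p.1) (p.2 (𝒟.ι p.1 u₂))

variable {𝒟}

theorem vert_add : 𝒟.vert p (ξ + η) = 𝒟.vert p ξ + 𝒟.vert p η := by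
  simp only [vert, Prod.fst_add, Prod.snd_add, map_add, Ring.lie_def, add_mul, mul_add]
  abel

theorem vert_sub : 𝒟.vert p (ξ - η) = 𝒟.vert p ξ - 𝒟.vert p η := by
  simp only [vert, Prod.fst_sub, Prod.snd_sub, map_sub, Ring.lie_def, sub_mul, mul_sub]
  abel

theorem IsTangent.sub (hξ : 𝒟.IsTangent p ξ) (hη : 𝒟.IsTangent p η) : 𝒟.IsTangent p (ξ - η) := by
  rw [IsTangent, vert_sub]
  exact sub_mem hξ hη

theorem IsTypeC.tangent_right (hp : p ∈ 𝒟.Z) (h : 𝒟.IsTypeC p ξ₁ ξ₂) : 𝒟.IsTangent p ξ₂ := by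
  rw [IsTangent, h.vert_eq]
  exact (isQuaternionic_κ hp.1).mul_mem_sphereTangent hp.2.1 hp.2.2 h.tangent

theorem IsTypeC.base_spec (hp : p ∈ 𝒟.Z) (h : 𝒟.IsTypeC p ξ₁ ξ₂) :
    ξ₁.1 = 𝒟.ρ p.1 (𝒟.base p ξ₁.1 ξ₂.1) ∧ ξ₂.1 = 𝒟.ρ p.1 (p.2 (𝒟.base p ξ₁.1 ξ₂.1)) := by
  obtain ⟨hm, hAQ, hAA⟩ := hp
  obtain ⟨e, hξ₁, hξ₂⟩ := h.exists_base
  obtain ⟨u, hu⟩ := 𝒟.apply_ker _ hm _ hAQ hAA (p.2 e - 𝒟.P p.1 (p.2 e))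
    (by simp [P, 𝒟.ρ_ι _ hm])
  have hA : p.2 (p.2 e) = -e := by simpa using DFunLike.congr_fun hAA e
  have he : 𝒟.base p ξ₁.1 ξ₂.1 = e := by
    have hPu : 𝒟.P p.1 (𝒟.ι p.1 u) = 𝒟.ι p.1 u := by simp [P, 𝒟.ρ_ι _ hm]
    have hJ : p.2 (𝒟.P p.1 (p.2 e)) = -e - 𝒟.ι p.1 u := by
      rw [← hu, map_sub, hA, sub_sub_cancel]
    rw [base, hξ₁, hξ₂]
    change 𝒟.P p.1 e - (1 - 𝒟.P p.1) (p.2 (𝒟.P p.1 (p.2 e))) = e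
    rw [hJ, sub_apply, one_apply_eq_self, map_sub, map_neg, hPu]
    abel
  exact ⟨he ▸ hξ₁, he ▸ hξ₂⟩

section Calculus

variable {X Y : EM × (F →L[ℝ] F) → EM × (F →L[ℝ] F)}

section

variable {T S : EM × (F →L[ℝ] F) → F →L[ℝ] F} (hT : DifferentiableAt ℝ T p)
include hT

theorem covF_apply {s : EM × (F →L[ℝ] F) → F} (hs : DifferentiableAt ℝ s p) :
    𝒟.covF p ξ (fun q ↦ T q (s q)) = T p (𝒟.covF p ξ s) + 𝒟.covEnd p ξ T (s p) := by
  rw [covF, covF, covEnd, (hT.hasFDerivAt.clm_apply hs.hasFDerivAt).fderiv]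
  simp only [add_apply, sub_apply, ContinuousLinearMap.comp_apply, ContinuousLinearMap.flip_apply,
    map_add, Ring.lie_def, mul_apply_eq_comp]
  abel

theorem covEnd_mul (hS : DifferentiableAt ℝ S p) :
    𝒟.covEnd p ξ (T * S) = T p * 𝒟.covEnd p ξ S + 𝒟.covEnd p ξ T * S p := by
  rw [covEnd, covEnd, covEnd, (hT.hasFDerivAt.mul' hS.hasFDerivAt).fderiv]
  simp only [add_apply, smul_apply, smul_eq_mul, op_smul_eq_mul, Pi.mul_apply, Ring.lie_def]
  noncomm_ring

theorem covEnd_add (hS : DifferentiableAt ℝ S p) :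
    𝒟.covEnd p ξ (T + S) = 𝒟.covEnd p ξ T + 𝒟.covEnd p ξ S := by
  rw [covEnd, covEnd, covEnd, (hT.hasFDerivAt.add hS.hasFDerivAt).fderiv]
  simp only [add_apply, Pi.add_apply, Ring.lie_def]
  noncomm_ring

theorem covEnd_congr (hp : p ∈ 𝒟.Z) (hξ : 𝒟.IsTangent p ξ) (hS : DifferentiableAt ℝ S p)
    (h : ∀ᶠ q in 𝓝[𝒟.Z] p, T q = S q) : 𝒟.covEnd p ξ T = 𝒟.covEnd p ξ S := by
  rw [covEnd, covEnd, hξ.fderiv_congr hp hT hS h, h.self_of_nhdsWithin hp]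

end

theorem covEnd_snd : 𝒟.covEnd p ξ Prod.snd = 𝒟.vert p ξ := by
  rw [covEnd, vert, fderiv_snd]
  rfl

section

variable {W : Type*} [NormedAddCommGroup W] [NormedSpace ℝ W] {f : EM → EM →L[ℝ] W}
  (hf : DifferentiableAt ℝ f p.1) (hX : DifferentiableAt ℝ X p)
include hf hX

theorem differentiableAt_form_apply : DifferentiableAt ℝ (fun q ↦ f q.1 (X q).1) p :=
  (differentiableAt_comp_fst hf).clm_apply hX.fst

theorem fderiv_form_apply : fderiv ℝ (fun q ↦ f q.1 (X q).1) p ξ =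
    f p.1 (fderiv ℝ X p ξ).1 + fderiv ℝ f p.1 ξ.1 (X p).1 := by
  rw [((differentiableAt_comp_fst hf).hasFDerivAt.clm_apply hX.hasFDerivAt.fst).fderiv]
  simp only [add_apply, ContinuousLinearMap.comp_apply, ContinuousLinearMap.flip_apply,
    fderiv_comp_fst hf, ContinuousLinearMap.coe_fst']

end

section

variable (hm : p.1 ∈ 𝒟.U) (hX : DifferentiableAt ℝ X p)
include hm hX

theorem differentiableAt_vert : DifferentiableAt ℝ (fun q ↦ 𝒟.vert q (X q)) p := by
  have hΓX := differentiableAt_form_apply (differentiableAt_Γ hm) hX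
  exact hX.snd.add ((hΓX.mul differentiableAt_snd).sub (differentiableAt_snd.mul hΓX))

theorem covF_ι : 𝒟.covF p ξ (fun q ↦ 𝒟.ι q.1 (X q).1) =
    𝒟.ι p.1 (fderiv ℝ X p ξ).1 + 𝒟.solder ξ.1 (X p).1 p.1 := by
  rw [covF, fderiv_form_apply (differentiableAt_ι hm) hX, solder]
  abel

theorem covEnd_vert : 𝒟.covEnd p ξ (fun q ↦ 𝒟.vert q (X q)) = 𝒟.vert p (fderiv ℝ X p ξ) +
    ⁅fderiv ℝ 𝒟.Γ p.1 ξ.1 (X p).1, p.2⁆ + ⁅𝒟.Γ p.1 (X p).1, ξ.2⁆ +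
      ⁅𝒟.Γ p.1 ξ.1, 𝒟.vert p (X p)⁆ := by
  have hΓX := (differentiableAt_form_apply (differentiableAt_Γ hm) hX).hasFDerivAt
  have hsnd : HasFDerivAt (𝕜 := ℝ) (Prod.snd : EM × (F →L[ℝ] F) → F →L[ℝ] F) _ p :=
    hasFDerivAt_snd
  have hsum : HasFDerivAt (fun q ↦ 𝒟.vert q (X q)) _ p :=
    hX.hasFDerivAt.snd.add ((hΓX.mul' hsnd).sub (hsnd.mul' hΓX))
  rw [covEnd, hsum.fderiv]
  simp only [add_apply, sub_apply, ContinuousLinearMap.comp_apply,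
    fderiv_form_apply (differentiableAt_Γ hm) hX, ContinuousLinearMap.coe_snd', smul_apply,
    smul_eq_mul, op_smul_eq_mul, vert, Ring.lie_def]
  noncomm_ring

theorem vert_lieBracket (hY : DifferentiableAt ℝ Y p) :
    𝒟.vert p (lieBracket ℝ X Y p) = 𝒟.covEnd p (X p) (fun q ↦ 𝒟.vert q (Y q)) -
      𝒟.covEnd p (Y p) (fun q ↦ 𝒟.vert q (X q)) - ⁅𝒟.curv p.1 (X p).1 (Y p).1, p.2⁆ := by
  rw [covEnd_vert hm hX, covEnd_vert hm hY, lieBracket, vert_sub, curv]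
  simp only [vert, Ring.lie_def]
  noncomm_ring

theorem lieBracket_fst (hY : DifferentiableAt ℝ Y p) :
    (lieBracket ℝ X Y p).1 = 𝒟.ρ p.1 (𝒟.covF p (X p) (fun q ↦ 𝒟.ι q.1 (Y q).1) -
      𝒟.covF p (Y p) (fun q ↦ 𝒟.ι q.1 (X q).1)) := by
  have htorsion : 𝒟.solder (X p).1 (Y p).1 p.1 = 𝒟.solder (Y p).1 (X p).1 p.1 :=
    𝒟.torsion _ hm _ _
  rw [covF_ι hm hX, covF_ι hm hY, htorsion, add_sub_add_right_eq_sub, ← map_sub, 𝒟.ρ_ι _ hm]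
  rfl

end

/-- Along `Z`, a lift `s` to `E` of a vector field may replace it in covariant derivatives, because
`P` is parallel. -/
theorem ρ_covF_ι (hp : p ∈ 𝒟.Z) (hξ : 𝒟.IsTangent p ξ) (hX : DifferentiableAt ℝ X p)
    {s : EM × (F →L[ℝ] F) → F} (hs : DifferentiableAt ℝ s p)
    (hXs : ∀ᶠ q in 𝓝[𝒟.Z] p, (X q).1 = 𝒟.ρ q.1 (s q)) :
    𝒟.ρ p.1 (𝒟.covF p ξ (fun q ↦ 𝒟.ι q.1 (X q).1)) = 𝒟.ρ p.1 (𝒟.covF p ξ s) := by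
  have hm := hp.1
  have hP := differentiableAt_comp_fst (p := p) (differentiableAt_P hm)
  have hPs : ∀ᶠ q in 𝓝[𝒟.Z] p, 𝒟.ι q.1 (X q).1 = 𝒟.P q.1 (s q) := by
    filter_upwards [hXs] with q hq using congrArg (𝒟.ι q.1) hq
  have hparallel : 𝒟.covEnd p ξ (fun q ↦ 𝒟.P q.1) = 0 := by
    rw [covEnd, fderiv_comp_fst (differentiableAt_P hm)]
    exact 𝒟.parallel_P _ hm _
  have hcov : 𝒟.covF p ξ (fun q ↦ 𝒟.ι q.1 (X q).1) = 𝒟.P p.1 (𝒟.covF p ξ s) := by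
    rw [covF, hξ.fderiv_congr hp (differentiableAt_form_apply (differentiableAt_ι hm) hX)
      (hP.clm_apply hs) hPs, hPs.self_of_nhdsWithin hp]
    change 𝒟.covF p ξ (fun q ↦ 𝒟.P q.1 (s q)) = _
    rw [covF_apply hP hs, hparallel, zero_apply, add_zero]
  rw [hcov, P, ContinuousLinearMap.comp_apply, 𝒟.ρ_ι _ hm]

theorem lieBracket_fst_eq_of_lift (hp : p ∈ 𝒟.Z) (hXt : 𝒟.IsTangent p (X p))
    (hYt : 𝒟.IsTangent p (Y p)) (hX : DifferentiableAt ℝ X p) (hY : DifferentiableAt ℝ Y p)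
    {s t : EM × (F →L[ℝ] F) → F} (hs : DifferentiableAt ℝ s p) (ht : DifferentiableAt ℝ t p)
    (hXs : ∀ᶠ q in 𝓝[𝒟.Z] p, (X q).1 = 𝒟.ρ q.1 (s q))
    (hYt' : ∀ᶠ q in 𝓝[𝒟.Z] p, (Y q).1 = 𝒟.ρ q.1 (t q)) :
    (lieBracket ℝ X Y p).1 = 𝒟.ρ p.1 (𝒟.covF p (X p) t - 𝒟.covF p (Y p) s) := by
  rw [lieBracket_fst hp.1 hX hY, map_sub, map_sub, ρ_covF_ι hp hXt hY ht hYt',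
    ρ_covF_ι hp hYt hX hs hXs]

theorem covEnd_vert_anticomm (hp : p ∈ 𝒟.Z) (hξ : 𝒟.IsTangent p ξ) (hY : DifferentiableAt ℝ Y p)
    (hYt : ∀ᶠ q in 𝓝[𝒟.Z] p, 𝒟.IsTangent q (Y q)) :
    p.2 * 𝒟.covEnd p ξ (fun q ↦ 𝒟.vert q (Y q)) + 𝒟.covEnd p ξ (fun q ↦ 𝒟.vert q (Y q)) * p.2 =
      -(𝒟.vert p ξ * 𝒟.vert p (Y p) + 𝒟.vert p (Y p) * 𝒟.vert p ξ) := by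
  have hd := differentiableAt_vert hp.1 hY
  have hs : DifferentiableAt ℝ (Prod.snd : EM × (F →L[ℝ] F) → F →L[ℝ] F) p := differentiableAt_snd
  have hderiv := covEnd_congr ((hs.mul hd).add (hd.mul hs)) hp hξ (differentiableAt_const 0)
    (by filter_upwards [hYt] with q hq using (mem_sphereTangent.1 hq).2)
  rw [covEnd_add (hs.mul hd) (hd.mul hs), covEnd_mul hs hd, covEnd_mul hd hs, covEnd_snd,
    show 𝒟.covEnd p ξ (fun _ ↦ 0) = 0 by simp [covEnd, Ring.lie_def]] at hderiv
  rw [eq_neg_iff_add_eq_zero, ← hderiv]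
  abel

theorem isTangent_lieBracket (hp : p ∈ 𝒟.Z)
    (hX : DifferentiableAt ℝ X p) (hY : DifferentiableAt ℝ Y p)
    (hXt : ∀ᶠ q in 𝓝[𝒟.Z] p, 𝒟.IsTangent q (X q))
    (hYt : ∀ᶠ q in 𝓝[𝒟.Z] p, 𝒟.IsTangent q (Y q)) :
    𝒟.IsTangent p (lieBracket ℝ X Y p) := by
  have hm := hp.1
  have hXp := hXt.self_of_nhdsWithin hp
  have hYp := hYt.self_of_nhdsWithin hp
  have hXY := covEnd_mem hp hXp (differentiableAt_vert hm hY)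
    (by filter_upwards [hYt] with q hq using (mem_sphereTangent.1 hq).1)
  have hYX := covEnd_mem hp hYp (differentiableAt_vert hm hX)
    (by filter_upwards [hXt] with q hq using (mem_sphereTangent.1 hq).1)
  rw [IsTangent, vert_lieBracket hm hX hY]
  refine sub_mem (mem_sphereTangent.2 ⟨sub_mem hXY hYX, ?_⟩)
    (lie_mem_sphereTangent hp.2.2 (lie_curv_mem hp _ _))
  rw [mul_sub, sub_mul, sub_add_sub_comm, covEnd_vert_anticomm hp hXp hY hYt,
    covEnd_vert_anticomm hp hYp hX hXt]
  abel

section IsTypeC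

variable {X₁ X₂ Y₁ Y₂ : EM × (F →L[ℝ] F) → EM × (F →L[ℝ] F)}

theorem differentiableAt_base (hm : p.1 ∈ 𝒟.U) (hX₁ : DifferentiableAt ℝ X₁ p)
    (hX₂ : DifferentiableAt ℝ X₂ p) :
    DifferentiableAt ℝ (fun q ↦ 𝒟.base q (X₁ q).1 (X₂ q).1) p := by
  have hι₁ := differentiableAt_form_apply (differentiableAt_ι hm) hX₁
  have hι₂ := differentiableAt_form_apply (differentiableAt_ι hm) hX₂
  have hP := differentiableAt_comp_fst (p := p) (differentiableAt_P hm)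
  exact hι₁.sub (((differentiableAt_const _).sub hP).clm_apply (differentiableAt_snd.clm_apply hι₂))

theorem covEnd_vert_eq (hp : p ∈ 𝒟.Z) (hξ : 𝒟.IsTangent p ξ)
    (hX₁ : DifferentiableAt ℝ X₁ p) (hX₂ : DifferentiableAt ℝ X₂ p)
    (hX : ∀ᶠ q in 𝓝[𝒟.Z] p, 𝒟.IsTypeC q (X₁ q) (X₂ q)) :
    𝒟.covEnd p ξ (fun q ↦ 𝒟.vert q (X₂ q)) =
      p.2 * 𝒟.covEnd p ξ (fun q ↦ 𝒟.vert q (X₁ q)) + 𝒟.vert p ξ * 𝒟.vert p (X₁ p) := by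
  have hd := differentiableAt_vert hp.1 hX₁
  have hs : DifferentiableAt ℝ (Prod.snd : EM × (F →L[ℝ] F) → F →L[ℝ] F) p := differentiableAt_snd
  rw [← covEnd_snd, ← covEnd_mul hs hd]
  exact covEnd_congr (differentiableAt_vert hp.1 hX₂) hp hξ (hs.mul hd)
    (by filter_upwards [hX] with q hq using hq.vert_eq)

variable (hp : p ∈ 𝒟.Z)
  (hX₁ : DifferentiableAt ℝ X₁ p) (hX₂ : DifferentiableAt ℝ X₂ p)
  (hY₁ : DifferentiableAt ℝ Y₁ p) (hY₂ : DifferentiableAt ℝ Y₂ p)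
  (hX : ∀ᶠ q in 𝓝[𝒟.Z] p, 𝒟.IsTypeC q (X₁ q) (X₂ q))
  (hY : ∀ᶠ q in 𝓝[𝒟.Z] p, 𝒟.IsTypeC q (Y₁ q) (Y₂ q))
include hp hX₁ hX₂ hY₁ hY₂ hX hY

theorem exists_base_lieBracket :
    ∃ e, (lieBracket ℝ X₁ Y₁ p - lieBracket ℝ X₂ Y₂ p).1 = 𝒟.ρ p.1 e ∧
      (lieBracket ℝ X₁ Y₂ p + lieBracket ℝ X₂ Y₁ p).1 = 𝒟.ρ p.1 (p.2 e) := by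
  have hXp := hX.self_of_nhdsWithin hp
  have hYp := hY.self_of_nhdsWithin hp
  have hx₁ := hXp.tangent
  have hx₂ := hXp.tangent_right hp
  have hy₁ := hYp.tangent
  have hy₂ := hYp.tangent_right hp
  set s := fun q ↦ 𝒟.base q (X₁ q).1 (X₂ q).1
  set t := fun q ↦ 𝒟.base q (Y₁ q).1 (Y₂ q).1
  have hXs : ∀ᶠ q in 𝓝[𝒟.Z] p, (X₁ q).1 = 𝒟.ρ q.1 (s q) ∧ (X₂ q).1 = 𝒟.ρ q.1 (q.2 (s q)) := by
    filter_upwards [hX, self_mem_nhdsWithin] with q hq hqZ using hq.base_spec hqZ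
  have hYt : ∀ᶠ q in 𝓝[𝒟.Z] p, (Y₁ q).1 = 𝒟.ρ q.1 (t q) ∧ (Y₂ q).1 = 𝒟.ρ q.1 (q.2 (t q)) := by
    filter_upwards [hY, self_mem_nhdsWithin] with q hq hqZ using hq.base_spec hqZ
  obtain ⟨hXs₁, hXs₂⟩ := eventually_and.1 hXs
  obtain ⟨hYt₁, hYt₂⟩ := eventually_and.1 hYt
  have hs : DifferentiableAt ℝ s p := differentiableAt_base hp.1 hX₁ hX₂
  have ht : DifferentiableAt ℝ t p := differentiableAt_base hp.1 hY₁ hY₂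
  have hsnd : DifferentiableAt ℝ (Prod.snd : EM × (F →L[ℝ] F) → F →L[ℝ] F) p :=
    differentiableAt_snd
  have hJs := hsnd.clm_apply hs
  have hJt := hsnd.clm_apply ht
  have hcovJ {s : EM × (F →L[ℝ] F) → F} (hs : DifferentiableAt ℝ s p) (ξ : EM × (F →L[ℝ] F)) :
      𝒟.covF p ξ (fun q ↦ q.2 (s q)) = p.2 (𝒟.covF p ξ s) + 𝒟.vert p ξ (s p) := by
    rw [covF_apply hsnd hs, covEnd_snd]
  have hAA (v : F) : p.2 (p.2 v) = -v := by simpa using DFunLike.congr_fun hp.2.2 v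
  refine ⟨𝒟.covF p (X₁ p) t - 𝒟.covF p (Y₁ p) s -
    (𝒟.covF p (X₂ p) (fun q ↦ q.2 (t q)) - 𝒟.covF p (Y₂ p) (fun q ↦ q.2 (s q))), ?_, ?_⟩
  · rw [Prod.fst_sub, lieBracket_fst_eq_of_lift hp hx₁ hy₁ hX₁ hY₁ hs ht hXs₁ hYt₁,
      lieBracket_fst_eq_of_lift hp hx₂ hy₂ hX₂ hY₂ hJs hJt hXs₂ hYt₂, ← map_sub]
  · rw [Prod.fst_add, lieBracket_fst_eq_of_lift hp hx₁ hy₂ hX₁ hY₂ hs hJt hXs₁ hYt₂,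
      lieBracket_fst_eq_of_lift hp hx₂ hy₁ hX₂ hY₁ hJs ht hXs₂ hYt₁, ← map_add]
    simp only [hcovJ hs, hcovJ ht, map_sub, map_add, hAA, hXp.vert_eq, hYp.vert_eq,
      mul_apply_eq_comp, map_neg]
    abel

theorem vert_lieBracket_eq :
    𝒟.vert p (lieBracket ℝ X₁ Y₂ p + lieBracket ℝ X₂ Y₁ p) =
      p.2 * 𝒟.vert p (lieBracket ℝ X₁ Y₁ p - lieBracket ℝ X₂ Y₂ p) := by
  have hm := hp.1
  have hXp := hX.self_of_nhdsWithin hp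
  have hYp := hY.self_of_nhdsWithin hp
  have hR : typeDefect _ p.2 (𝒟.base p (X₁ p).1 (X₂ p).1) (𝒟.base p (Y₁ p).1 (Y₂ p).1) = 0 :=
    typeDefect_curv_eq_zero hp _ _
  simp only [typeDefect, ← (hXp.base_spec hp).1, ← (hXp.base_spec hp).2, ← (hYp.base_spec hp).1,
    ← (hYp.base_spec hp).2, Ring.lie_def] at hR
  rw [vert_add, vert_sub, vert_lieBracket hm hX₁ hY₁, vert_lieBracket hm hX₂ hY₂,
    vert_lieBracket hm hX₁ hY₂, vert_lieBracket hm hX₂ hY₁,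
    covEnd_vert_eq hp hXp.tangent hY₁ hY₂ hY, covEnd_vert_eq hp (hXp.tangent_right hp) hY₁ hY₂ hY,
    covEnd_vert_eq hp hYp.tangent hX₁ hX₂ hX, covEnd_vert_eq hp (hYp.tangent_right hp) hX₁ hX₂ hX,
    hXp.vert_eq, hYp.vert_eq, ← sub_eq_zero, ← neg_eq_zero, ← hR]
  have hA (x : F →L[ℝ] F) : p.2 * (p.2 * x) = -x := by rw [← mul_assoc, hp.2.2, neg_one_mul]
  simp only [Ring.lie_def, mul_sub, mul_add, sub_mul, add_mul, mul_assoc, hA]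
  abel

theorem isTypeC_lieBracket :
    𝒟.IsTypeC p (lieBracket ℝ X₁ Y₁ p - lieBracket ℝ X₂ Y₂ p)
      (lieBracket ℝ X₁ Y₂ p + lieBracket ℝ X₂ Y₁ p) where
  tangent := by
    refine (isTangent_lieBracket hp hX₁ hY₁ (hX.mono fun _ h ↦ h.tangent)
      (hY.mono fun _ h ↦ h.tangent)).sub (isTangent_lieBracket hp hX₂ hY₂ ?_ ?_)
    · filter_upwards [hX, self_mem_nhdsWithin] with q hq hqZ using hq.tangent_right hqZ
    · filter_upwards [hY, self_mem_nhdsWithin] with q hq hqZ using hq.tangent_right hqZ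
  vert_eq := vert_lieBracket_eq hp hX₁ hX₂ hY₁ hY₂ hX hY
  exists_base := exists_base_lieBracket hp hX₁ hX₂ hY₁ hY₂ hX hY

end IsTypeC

end Calculus

end LocalModel

end Involutivity

section Complexification

variable {W W' R : Type*} [AddCommGroup W] [Module ℝ W] [AddCommGroup W'] [Module ℝ W']

variable (W) in
/-- The real part of an element of the complexification of a real vector space. -/
def cpxRe : ℂ ⊗[ℝ] W →ₗ[ℝ] W :=
  (TensorProduct.lid ℝ W).toLinearMap ∘ₗ LinearMap.rTensor W Complex.reLm

variable (W) in
/-- The imaginary part of an element of the complexification of a real vector space. -/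
def cpxIm : ℂ ⊗[ℝ] W →ₗ[ℝ] W :=
  (TensorProduct.lid ℝ W).toLinearMap ∘ₗ LinearMap.rTensor W Complex.imLm

theorem cpxRe_cpx (a b : W) : cpxRe W (cpx a b) = a := by simp [cpxRe, cpx]

theorem cpxIm_cpx (a b : W) : cpxIm W (cpx a b) = b := by simp [cpxIm, cpx]

theorem cpx_inj {a b a' b' : W} : cpx a b = cpx a' b' ↔ a = a' ∧ b = b' := by
  refine ⟨fun h ↦ ⟨?_, ?_⟩, by rintro ⟨rfl, rfl⟩; rfl⟩
  · simpa only [cpxRe_cpx] using congrArg (cpxRe W) h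
  · simpa only [cpxIm_cpx] using congrArg (cpxIm W) h

theorem cpx_zero : cpx (0 : W) 0 = 0 := by simp [cpx]

theorem cpx_add (a b a' b' : W) : cpx a b + cpx a' b' = cpx (a + a') (b + b') := by
  simp only [cpx, TensorProduct.tmul_add]
  abel

theorem tmul_eq_cpx (z : ℂ) (w : W) : z ⊗ₜ[ℝ] w = cpx (z.re • w) (z.im • w) := by
  rw [cpx, ← TensorProduct.smul_tmul, ← TensorProduct.smul_tmul, ← TensorProduct.add_tmul]
  congr 1
  simp

theorem smul_cpx (z : ℂ) (a b : W) :
    z • cpx a b = cpx (z.re • a - z.im • b) (z.im • a + z.re • b) := by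
  have hz : z • cpx a b = z ⊗ₜ[ℝ] a + (z * Complex.I) ⊗ₜ[ℝ] b := by
    simp [cpx, smul_add, TensorProduct.smul_tmul']
  rw [hz, tmul_eq_cpx, tmul_eq_cpx, cpx_add]
  simp [sub_eq_add_neg]

theorem exists_eq_cpx (ζ : ℂ ⊗[ℝ] W) : ∃ a b, ζ = cpx a b := by
  induction ζ with
  | zero => exact ⟨0, 0, cpx_zero.symm⟩
  | tmul z w => exact ⟨_, _, tmul_eq_cpx z w⟩
  | add ζ ζ' hζ hζ' =>
    obtain ⟨a, b, rfl⟩ := hζ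
    obtain ⟨a', b', rfl⟩ := hζ'
    exact ⟨_, _, cpx_add a b a' b'⟩

theorem baseChange_cpx (f : W →ₗ[ℝ] W') (a b : W) :
    f.baseChange ℂ (cpx a b) = cpx (f a) (f b) := by
  simp [cpx]

theorem cpx_mem_baseChange {S : Submodule ℝ W} {a b : W} :
    cpx a b ∈ S.baseChange ℂ ↔ a ∈ S ∧ b ∈ S := by
  refine ⟨?_, fun h ↦ add_mem (Submodule.tmul_mem_baseChange_of_mem _ h.1)
    (Submodule.tmul_mem_baseChange_of_mem _ h.2)⟩
  rintro ⟨ζ, hζ⟩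
  obtain ⟨c, d, rfl⟩ := exists_eq_cpx ζ
  obtain ⟨rfl, rfl⟩ := cpx_inj.1 ((baseChange_cpx S.subtype c d).symm.trans hζ)
  exact ⟨c.2, d.2⟩

/-- `hS` says that `-i (f A + i g A) = f B + i g B`. -/
theorem cpx_mem_span_iff [AddCommGroup R] [Module ℝ R] {S : Submodule ℝ R} {f g : R →ₗ[ℝ] W}
    (hS : ∀ A ∈ S, ∃ B ∈ S, f B = g A ∧ g B = -f A) {a b : W} :
    cpx a b ∈ Submodule.span ℂ {ζ | ∃ A ∈ S, ζ = cpx (f A) (g A)} ↔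
      ∃ A ∈ S, a = f A ∧ b = g A := by
  refine ⟨fun h ↦ ?_, fun ⟨A, hA, ha, hb⟩ ↦ Submodule.subset_span ⟨A, hA, by rw [ha, hb]⟩⟩
  suffices H : ∀ ζ ∈ Submodule.span ℂ {ζ | ∃ A ∈ S, ζ = cpx (f A) (g A)},
      ∃ A ∈ S, ζ = cpx (f A) (g A) by
    obtain ⟨A, hA, hab⟩ := H _ h
    exact ⟨A, hA, cpx_inj.1 hab⟩
  intro ζ hζ
  induction hζ using Submodule.span_induction with
  | mem _ hζ => exact hζ
  | zero => exact ⟨0, S.zero_mem, by rw [map_zero, map_zero, cpx_zero]⟩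
  | add ζ ζ' _ _ hζ hζ' =>
    obtain ⟨A, hA, rfl⟩ := hζ
    obtain ⟨B, hB, rfl⟩ := hζ'
    exact ⟨A + B, S.add_mem hA hB, by rw [cpx_add, map_add, map_add]⟩
  | smul z ζ _ hζ =>
    obtain ⟨A, hA, rfl⟩ := hζ
    obtain ⟨B, hB, hfB, hgB⟩ := hS A hA
    refine ⟨z.re • A - z.im • B, S.sub_mem (S.smul_mem _ hA) (S.smul_mem _ hB), ?_⟩
    rw [smul_cpx]
    simp only [map_sub, map_smul, hfB, hgB, smul_neg, sub_neg_eq_add]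
    rw [add_comm (z.im • f A)]

theorem cpx_mem_EJ {M : Type*} {E : M → Type*} [∀ x, AddCommGroup (E x)] [∀ x, Module ℝ (E x)]
    [∀ x, TopologicalSpace (E x)] {x : M} {J : E x →L[ℝ] E x} (hJ : ∀ v, J (J v) = -v)
    {a b : E x} : cpx a b ∈ EJ J ↔ b = J a := by
  have h : ((J : E x →ₗ[ℝ] E x).baseChange ℂ + Complex.I • LinearMap.id :
      ℂ ⊗[ℝ] E x →ₗ[ℂ] ℂ ⊗[ℝ] E x) (cpx a b) = cpx (J a - b) (J b + a) := by
    rw [LinearMap.add_apply, baseChange_cpx, LinearMap.smul_apply, LinearMap.id_apply, smul_cpx,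
      cpx_add]
    simp [sub_eq_add_neg]
  rw [EJ, LinearMap.mem_ker, h, ← cpx_zero, cpx_inj]
  refine ⟨fun h ↦ (sub_eq_zero.1 h.1).symm, ?_⟩
  rintro rfl
  simp [hJ]

theorem cpx_mem_rhoEJ {EM M : Type*} [NormedAddCommGroup EM] [NormedSpace ℝ EM]
    [TopologicalSpace M] [ChartedSpace EM M] {E : M → Type*} [∀ x, AddCommGroup (E x)]
    [∀ x, Module ℝ (E x)] [∀ x, TopologicalSpace (E x)] {x : M}
    {ρ : E x →L[ℝ] TangentSpace 𝓘(ℝ, EM) x} {J : E x →L[ℝ] E x}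
    (hJ : ∀ v, J (J v) = -v) {a b : TangentSpace 𝓘(ℝ, EM) x} :
    cpx a b ∈ rhoEJ ρ J ↔ ∃ e, a = ρ e ∧ b = ρ (J e) := by
  rw [rhoEJ, Submodule.mem_map]
  constructor
  · rintro ⟨ζ, hζ, h⟩
    obtain ⟨c, d, rfl⟩ := exists_eq_cpx ζ
    obtain rfl := (cpx_mem_EJ hJ).1 hζ
    rw [baseChange_cpx, cpx_inj] at h
    exact ⟨c, h.1.symm, h.2.symm⟩
  · rintro ⟨e, rfl, rfl⟩
    exact ⟨cpx e (J e), (cpx_mem_EJ hJ).2 rfl, baseChange_cpx _ _ _⟩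

end Complexification

theorem range_linearCombination_triple {W : Type*} [AddCommGroup W] [Module ℝ W] (I J K : W) :
    LinearMap.range (Fintype.linearCombination ℝ ![I, J, K]) = Submodule.span ℝ {I, J, K} := by
  rw [Fintype.range_linearCombination]
  congr 1
  simp only [Matrix.range_cons, Matrix.range_empty, Set.union_empty, Set.singleton_union]

section Distribution

variable {EM : Type*} [NormedAddCommGroup EM] [NormedSpace ℝ EM]
  {M : Type*} [TopologicalSpace M] [ChartedSpace EM M]
  {F : Type*} [NormedAddCommGroup F] [NormedSpace ℝ F]
  {E : M → Type*} [TopologicalSpace (TotalSpace F E)]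
  [∀ x, AddCommGroup (E x)] [∀ x, Module ℝ (E x)] [∀ x, TopologicalSpace (E x)]
  [∀ x, IsTopologicalAddGroup (E x)] [∀ x, ContinuousSMul ℝ (E x)]
  [FiberBundle F E] [VectorBundle ℝ F E] (𝒬 : QuaternionicStructure (EM := EM) F E)
  {ρ : ∀ x : M, E x →L[ℝ] TangentSpace 𝓘(ℝ, EM) x}
  {nabla : CovariantDerivative 𝓘(ℝ, EM) F E} {p : EndTotal F E}
  {a b : TangentSpace (endModel EM F) p}

theorem cpx_mem_distB (hp : ∀ v, p.2 (p.2 v) = -v) :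
    cpx a b ∈ distB ρ nabla p ↔ (a ∈ horizontal nabla p ∧ b ∈ horizontal nabla p) ∧
      ∃ e, dproj p a = ρ p.1 e ∧ dproj p b = ρ p.1 (p.2 e) := by
  rw [distB, Submodule.mem_inf, cpx_mem_baseChange, Submodule.mem_comap, baseChange_cpx,
    cpx_mem_rhoEJ hp]

/-- The sections `A 0`, `A 1`, `A 2` of `End(E)` form, at `y`, a frame `(I, J, K)` of `Q`. -/
structure QuaternionicStructure.IsFrameAt (A : Fin 3 → ∀ y : M, E y →L[ℝ] E y) (y : M) :
    Prop where
  isQuaternionic : IsQuaternionic (Fintype.linearCombination ℝ fun i ↦ A i y)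
  range_eq : LinearMap.range (Fintype.linearCombination ℝ fun i ↦ A i y) = 𝒬.Q y

theorem QuaternionicStructure.exists_isFrameAt (x₀ : M) :
    ∃ A : Fin 3 → ∀ y : M, E y →L[ℝ] E y,
      (∀ i, ContMDiffAt 𝓘(ℝ, EM) (endModel EM F) ∞ (endSection F E (A i)) x₀) ∧
        ∀ᶠ y in 𝓝 x₀, 𝒬.IsFrameAt A y := by
  obtain ⟨U, hU, hx₀, I, J, K, hI, hJ, hK, hIJK⟩ := 𝒬.exists_local_frame x₀
  have hUx₀ := hU.mem_nhds hx₀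
  refine ⟨![I, J, K], ?_, ?_⟩
  · simp only [Fin.forall_fin_succ, IsEmpty.forall_iff, and_true]
    exact ⟨hI.contMDiffAt hUx₀, hJ.contMDiffAt hUx₀, hK.contMDiffAt hUx₀⟩
  · filter_upwards [hUx₀] with y hy
    obtain ⟨hII, hJJ, hIJ, hJI, hQ⟩ := hIJK y hy
    have hA : (fun i ↦ ![I, J, K] i y) = ![I y, J y, K y] := by
      funext i
      fin_cases i <;> rfl
    constructor
    · rw [hA]
      exact isQuaternionic_of_mul_eq hII hJJ hIJ hJI
    · rw [hA, hQ, range_linearCombination_triple]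

variable {𝒬} in
theorem QuaternionicStructure.cpx_mem_vertical01 (hp : p ∈ 𝒬.Z)
    (vl : (E p.1 →L[ℝ] E p.1) →ₗ[ℝ] TangentSpace (endModel EM F) p)
    (hvl : ∀ A, verticalLift (EM := EM) p A = vl A) :
    cpx a b ∈ 𝒬.vertical01 (EM := EM) p ↔
      ∃ A ∈ sphereTangent (𝒬.Q p.1) p.2, a = vl A ∧ b = vl (p.2 * A) := by
  obtain ⟨_, -, hframe⟩ := 𝒬.exists_isFrameAt p.1
  obtain ⟨hκ, hQ⟩ := hframe.self_of_nhds
  have hpp : p.2 * p.2 = -1 := hp.2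
  have hset : {ζ | ∃ A ∈ 𝒬.Q p.1, p.2 ∘L A + A ∘L p.2 = 0 ∧
      ζ = cpx (verticalLift (EM := EM) p A) (verticalLift (EM := EM) p (p.2 ∘L A))} =
      {ζ | ∃ A ∈ sphereTangent (𝒬.Q p.1) p.2,
        ζ = cpx (vl A) ((vl ∘ₗ LinearMap.mulLeft ℝ p.2) A)} := by
    ext ζ
    simp only [Set.mem_ofPred_eq, mem_sphereTangent, hvl, and_assoc]
    rfl
  rw [QuaternionicStructure.vertical01, hset, cpx_mem_span_iff]
  · rfl
  · intro A hA
    refine ⟨p.2 * A, ?_, rfl, ?_⟩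
    · rw [← hQ] at hA ⊢
      exact hκ.mul_mem_sphereTangent (hQ ▸ hp.1) hpp hA
    · rw [LinearMap.comp_apply, LinearMap.mulLeft_apply, ← mul_assoc, hpp, neg_one_mul, map_neg]

variable {𝒬} in
theorem QuaternionicStructure.cpx_mem_distC (hp : p ∈ 𝒬.Z)
    (vl : (E p.1 →L[ℝ] E p.1) →ₗ[ℝ] TangentSpace (endModel EM F) p)
    (hvl : ∀ A, verticalLift (EM := EM) p A = vl A) :
    cpx a b ∈ 𝒬.distC ρ nabla p ↔ ∃ A ∈ sphereTangent (𝒬.Q p.1) p.2, ∃ e,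
      (∃ h ∈ horizontal nabla p, dproj p h = ρ p.1 e ∧ a = vl A + h) ∧
        ∃ h ∈ horizontal nabla p, dproj p h = ρ p.1 (p.2 e) ∧ b = vl (p.2 * A) + h := by
  have hpv (v : E p.1) : p.2 (p.2 v) = -v := by simpa using DFunLike.congr_fun hp.2 v
  rw [QuaternionicStructure.distC, Submodule.mem_sup]
  constructor
  · rintro ⟨ζ, hζ, η, hη, h⟩
    obtain ⟨c, d, rfl⟩ := exists_eq_cpx ζ
    obtain ⟨h₁, h₂, rfl⟩ := exists_eq_cpx η
    obtain ⟨A, hA, rfl, rfl⟩ := (cpx_mem_vertical01 hp vl hvl).1 hζ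
    obtain ⟨⟨hh₁, hh₂⟩, e, he₁, he₂⟩ := (cpx_mem_distB hpv).1 hη
    rw [cpx_add, cpx_inj] at h
    exact ⟨A, hA, e, ⟨h₁, hh₁, he₁, h.1.symm⟩, h₂, hh₂, he₂, h.2.symm⟩
  · rintro ⟨A, hA, e, ⟨h₁, hh₁, he₁, rfl⟩, h₂, hh₂, he₂, rfl⟩
    exact ⟨cpx (vl A) (vl (p.2 * A)), (cpx_mem_vertical01 hp vl hvl).2 ⟨A, hA, rfl, rfl⟩,
      cpx h₁ h₂, (cpx_mem_distB hpv).2 ⟨⟨hh₁, hh₂⟩, e, he₁, he₂⟩, cpx_add _ _ _ _⟩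

end Distribution

section Coordinates

variable {EM : Type*} [NormedAddCommGroup EM] [NormedSpace ℝ EM]
  {M : Type*} [TopologicalSpace M] [ChartedSpace EM M]
  (F : Type*) [NormedAddCommGroup F]
  (E : M → Type*) [TopologicalSpace (TotalSpace F E)] [∀ x, TopologicalSpace (E x)]
  [FiberBundle F E] (x₀ : M)

section Base

/-- The coordinates, in the preferred chart around `x₀`, of the points over which the preferred
trivialization of `E` around `x₀` is defined. -/
def coordDomain : Set EM :=
  (extChartAt 𝓘(ℝ, EM) x₀).target ∩
    (extChartAt 𝓘(ℝ, EM) x₀).symm ⁻¹' (trivializationAt F E x₀).baseSet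

/-- The point with coordinates `m` in the preferred chart around `x₀`. -/
abbrev coordPt (m : EM) : M := (extChartAt 𝓘(ℝ, EM) x₀).symm m

variable (EM) in
/-- The differential of the inverse of the preferred chart around `x₀`. -/
def fromCoordT (m : EM) : EM →L[ℝ] TangentSpace 𝓘(ℝ, EM) (coordPt x₀ m) :=
  mfderiv 𝓘(ℝ, EM) 𝓘(ℝ, EM) (extChartAt 𝓘(ℝ, EM) x₀).symm m

variable {F E x₀} {m : EM}

theorem isOpen_coordDomain : IsOpen (coordDomain (EM := EM) F E x₀) :=
  (continuousOn_extChartAt_symm x₀).isOpen_inter_preimage (isOpen_extChartAt_target x₀)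
    (trivializationAt F E x₀).open_baseSet

theorem extChartAt_mem_coordDomain : extChartAt 𝓘(ℝ, EM) x₀ x₀ ∈ coordDomain F E x₀ := by
  refine ⟨mem_extChartAt_target x₀, ?_⟩
  rw [Set.mem_preimage, extChartAt_to_inv]
  exact mem_baseSet_trivializationAt F E x₀

theorem coordPt_mem_chart_source (hm : m ∈ coordDomain F E x₀) :
    coordPt x₀ m ∈ (chartAt EM x₀).source := by
  rw [← extChartAt_source 𝓘(ℝ, EM)]
  exact (extChartAt 𝓘(ℝ, EM) x₀).map_target hm.1

theorem extChartAt_coordPt (hm : m ∈ coordDomain F E x₀) :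
    extChartAt 𝓘(ℝ, EM) x₀ (coordPt x₀ m) = m :=
  (extChartAt 𝓘(ℝ, EM) x₀).right_inv hm.1

variable [IsManifold 𝓘(ℝ, EM) ∞ M]

theorem contMDiffAt_coordPt (hm : m ∈ coordDomain F E x₀) :
    ContMDiffAt 𝓘(ℝ, EM) 𝓘(ℝ, EM) ∞ (fun m' : EM ↦ coordPt x₀ m') m :=
  (contMDiffOn_extChartAt_symm x₀).contMDiffAt
    ((isOpen_extChartAt_target x₀).mem_nhds hm.1)

theorem mdifferentiableAt_coordPt (hm : m ∈ coordDomain F E x₀) :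
    MDifferentiableAt 𝓘(ℝ, EM) 𝓘(ℝ, EM) (fun m' : EM ↦ coordPt x₀ m') m :=
  (contMDiffAt_coordPt hm).mdifferentiableAt (by simp)

theorem isInvertible_fromCoordT (hm : m ∈ coordDomain F E x₀) :
    (fromCoordT EM x₀ m).IsInvertible := by
  have hinv := isInvertible_mfderivWithin_extChartAt_symm (I := 𝓘(ℝ, EM)) hm.1
  rwa [modelWithCornersSelf_coe, Set.range_id, mfderivWithin_univ] at hinv

theorem fromCoordT_eq_symmL (hm : m ∈ coordDomain F E x₀) :
    (trivializationAt EM (TangentSpace 𝓘(ℝ, EM) : M → Type _) x₀).symmL ℝ (coordPt x₀ m) =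
      fromCoordT EM x₀ m := by
  rw [TangentBundle.symmL_trivializationAt (coordPt_mem_chart_source hm), extChartAt_coordPt hm,
    modelWithCornersSelf_coe, Set.range_id, mfderivWithin_univ]
  rfl

end Base

variable [NormedSpace ℝ F] [∀ x, AddCommGroup (E x)] [∀ x, Module ℝ (E x)] [VectorBundle ℝ F E]

/-- The identification of the model fibre with a fibre of `E` given by the preferred
trivialization around `x₀`. -/
def fromCoord (m : EM) : F →L[ℝ] E (coordPt x₀ m) := (trivializationAt F E x₀).symmL ℝ _

/-- The identification of a fibre of `E` with the model fibre given by the preferred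
trivialization around `x₀`. -/
def toCoord (m : EM) : E (coordPt x₀ m) →L[ℝ] F :=
  (trivializationAt F E x₀).continuousLinearMapAt ℝ _

/-- The inverse of the chart of `End(E)` induced by the preferred chart and trivialization around
`x₀`. -/
def endPt (q : EM × (F →L[ℝ] F)) : EndTotal F E :=
  ⟨coordPt x₀ q.1, fromCoord F E x₀ q.1 ∘L q.2 ∘L toCoord F E x₀ q.1⟩

variable {F E x₀} {m : EM}

theorem fromCoord_toCoord (hm : m ∈ coordDomain F E x₀) (v : E (coordPt x₀ m)) :
    fromCoord F E x₀ m (toCoord F E x₀ m v) = v :=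
  (trivializationAt F E x₀).symmL_continuousLinearMapAt hm.2 v

theorem toCoord_fromCoord (hm : m ∈ coordDomain F E x₀) (v : F) :
    toCoord F E x₀ m (fromCoord F E x₀ m v) = v :=
  (trivializationAt F E x₀).continuousLinearMapAt_symmL hm.2 v

theorem fromCoord_injective (hm : m ∈ coordDomain F E x₀) :
    Function.Injective (fromCoord F E x₀ m) :=
  Function.LeftInverse.injective (toCoord_fromCoord hm)

theorem fromCoord_surjective (hm : m ∈ coordDomain F E x₀) :
    Function.Surjective (fromCoord F E x₀ m) :=
  Function.RightInverse.surjective (fromCoord_toCoord hm)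

section EndBundle

variable [∀ x, IsTopologicalAddGroup (E x)] [∀ x, ContinuousSMul ℝ (E x)]

theorem endPt_eq : (endPt F E x₀ : EM × (F →L[ℝ] F) → EndTotal F E) =
    (extChartAt (endModel EM F) (⟨x₀, 0⟩ : EndTotal F E)).symm := by
  funext q
  rw [FiberBundle.extChartAt]
  rfl

theorem extChartAt_target_endPt :
    (extChartAt (endModel EM F) (⟨x₀, 0⟩ : EndTotal F E)).target =
      coordDomain (EM := EM) F E x₀ ×ˢ Set.univ := by
  rw [FiberBundle.extChartAt_target, hom_trivializationAt_baseSet, Set.inter_self]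
  rfl

variable [IsManifold 𝓘(ℝ, EM) ∞ M] [ContMDiffVectorBundle ∞ F E 𝓘(ℝ, EM)]
  {q : EM × (F →L[ℝ] F)}

theorem contMDiffAt_endPt (hq : q.1 ∈ coordDomain F E x₀) :
    ContMDiffAt 𝓘(ℝ, EM × (F →L[ℝ] F)) (endModel EM F) ∞ (endPt F E x₀) q := by
  rw [endPt_eq]
  refine (contMDiffOn_extChartAt_symm _).contMDiffAt
    ((isOpen_extChartAt_target _).mem_nhds ?_)
  rw [extChartAt_target_endPt]
  exact ⟨hq, trivial⟩

theorem mdifferentiableAt_endPt (hq : q.1 ∈ coordDomain F E x₀) :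
    MDifferentiableAt 𝓘(ℝ, EM × (F →L[ℝ] F)) (endModel EM F) (endPt F E x₀) q :=
  (contMDiffAt_endPt hq).mdifferentiableAt (by simp)

variable (F E x₀ q) in
/-- The differential of the inverse of the chart of `End(E)` around `x₀`. -/
def dEndPt : EM × (F →L[ℝ] F) →L[ℝ] TangentSpace (endModel EM F) (endPt F E x₀ q) :=
  mfderiv 𝓘(ℝ, EM × (F →L[ℝ] F)) (endModel EM F) (endPt F E x₀) q

theorem isInvertible_dEndPt (hq : q.1 ∈ coordDomain F E x₀) :
    (dEndPt F E x₀ q).IsInvertible := by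
  have hq' : q ∈ (extChartAt (endModel EM F) (⟨x₀, 0⟩ : EndTotal F E)).target := by
    rw [extChartAt_target_endPt]
    exact ⟨hq, trivial⟩
  have hinv := isInvertible_mfderivWithin_extChartAt_symm hq'
  rw [ModelWithCorners.range_eq_univ, mfderivWithin_univ] at hinv
  rw [dEndPt, endPt_eq]
  exact hinv

theorem dproj_dEndPt (hq : q.1 ∈ coordDomain F E x₀) (ξ : EM × (F →L[ℝ] F)) :
    dproj (endPt F E x₀ q) (dEndPt F E x₀ q ξ) = fromCoordT EM x₀ q.1 ξ.1 := by
  have hproj : MDifferentiableAt (endModel EM F) 𝓘(ℝ, EM) (TotalSpace.proj : EndTotal F E → M)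
      (endPt F E x₀ q) := mdifferentiableAt_proj _
  have hcomp : (TotalSpace.proj : EndTotal F E → M) ∘ endPt F E x₀ =
      (fun m' : EM ↦ coordPt x₀ m') ∘ (Prod.fst : EM × (F →L[ℝ] F) → EM) := rfl
  have hchain := mfderiv_comp q hproj (mdifferentiableAt_endPt hq)
  rw [hcomp, mfderiv_comp (I := 𝓘(ℝ, EM × (F →L[ℝ] F))) q (mdifferentiableAt_coordPt hq)
    (differentiableAt_fst (𝕜 := ℝ)).mdifferentiableAt, mfderiv_eq_fderiv, fderiv_fst] at hchain
  exact (DFunLike.congr_fun hchain ξ).symm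

theorem verticalLift_endPt (hq : q.1 ∈ coordDomain F E x₀) (A : F →L[ℝ] F) :
    verticalLift (EM := EM) (endPt F E x₀ q)
      (fromCoord F E x₀ q.1 ∘L A ∘L toCoord F E x₀ q.1) = dEndPt F E x₀ q (0, A) := by
  set γ : ℝ → EM × (F →L[ℝ] F) := fun t ↦ (q.1, q.2 + t • A)
  have hγ0 : γ 0 = q := by simp [γ]
  have hline : HasDerivAt (fun t : ℝ ↦ q.2 + t • A) A 0 := by
    simpa using ((hasDerivAt_id (0 : ℝ)).smul_const A).const_add q.2
  have hγ : HasDerivAt γ (0, A) 0 := (hasDerivAt_const _ _).prodMk hline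
  have hcurve : (fun t : ℝ ↦ (⟨coordPt x₀ q.1,
      fromCoord F E x₀ q.1 ∘L q.2 ∘L toCoord F E x₀ q.1 +
        t • (fromCoord F E x₀ q.1 ∘L A ∘L toCoord F E x₀ q.1)⟩ : EndTotal F E)) =
      endPt F E x₀ ∘ γ := by
    funext t
    simp only [γ, endPt, Function.comp, ContinuousLinearMap.add_comp,
      ContinuousLinearMap.comp_add, ContinuousLinearMap.smul_comp, ContinuousLinearMap.comp_smul]
  have hchain := mfderiv_comp (I := 𝓘(ℝ, ℝ)) (0 : ℝ) (mdifferentiableAt_endPt (hγ0 ▸ hq))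
    hγ.differentiableAt.mdifferentiableAt
  rw [← hcurve, mfderiv_eq_fderiv, hγ.hasFDerivAt.fderiv] at hchain
  have hbase : ∀ q', q' = q → (mfderiv 𝓘(ℝ, EM × (F →L[ℝ] F)) (endModel EM F)
      (endPt F E x₀) q' : EM × (F →L[ℝ] F) →L[ℝ] EM × (F →L[ℝ] F)) = dEndPt F E x₀ q := by
    rintro _ rfl
    rfl
  calc verticalLift (EM := EM) (endPt F E x₀ q)
        (fromCoord F E x₀ q.1 ∘L A ∘L toCoord F E x₀ q.1)
      = dEndPt F E x₀ q ((1 : ℝ) • ((0, A) : EM × (F →L[ℝ] F))) :=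
        (DFunLike.congr_fun hchain (1 : ℝ)).trans (DFunLike.congr_fun (hbase (γ 0) hγ0) _)
    _ = dEndPt F E x₀ q (0, A) := by rw [one_smul]

end EndBundle

end Coordinates

section CoordinateSections

variable {EM : Type*} [NormedAddCommGroup EM] [NormedSpace ℝ EM]
  {M : Type*} [TopologicalSpace M] [ChartedSpace EM M]
  {F : Type*} [NormedAddCommGroup F] [NormedSpace ℝ F]
  {E : M → Type*} [TopologicalSpace (TotalSpace F E)]
  [∀ x, AddCommGroup (E x)] [∀ x, Module ℝ (E x)] [∀ x, TopologicalSpace (E x)]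
  [FiberBundle F E] [VectorBundle ℝ F E] {x₀ : M} {m : EM}

section Definitions

variable (F x₀)

/-- A section of `E`, read in the preferred trivialization around `x₀`. -/
def trivSec (σ : ∀ y : M, E y) (y : M) : F :=
  (trivializationAt F E x₀).continuousLinearMapAt ℝ y (σ y)

/-- A section of `E`, read in the preferred chart and trivialization around `x₀`. -/
def coordSec (σ : ∀ y : M, E y) (m : EM) : F := trivSec F x₀ σ (coordPt x₀ m)

/-- A section of `End(E)`, read in the preferred chart and trivialization around `x₀`. -/
def coordEnd (A : ∀ y : M, E y →L[ℝ] E y) (m : EM) : F →L[ℝ] F :=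
  toCoord F E x₀ m ∘L A (coordPt x₀ m) ∘L fromCoord F E x₀ m

variable {F} (E)

/-- The section of `E` with given coordinate expression around `x₀`. -/
def secOf (s : EM → F) (y : M) : E y :=
  (trivializationAt F E x₀).symmL ℝ y (s (extChartAt 𝓘(ℝ, EM) x₀ y))

/-- The section of `End(E)` with given coordinate expression around `x₀`. -/
def endOf (A : EM → F →L[ℝ] F) (y : M) : E y →L[ℝ] E y :=
  (trivializationAt F E x₀).symmL ℝ y ∘L A (extChartAt 𝓘(ℝ, EM) x₀ y) ∘L
    (trivializationAt F E x₀).continuousLinearMapAt ℝ y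

end Definitions

theorem coordSec_apply (σ : ∀ y : M, E y) (m : EM) :
    coordSec F x₀ σ m = toCoord F E x₀ m (σ (coordPt x₀ m)) := rfl

theorem coordEnd_apply (A : ∀ y : M, E y →L[ℝ] E y) (m : EM) (f : F) :
    coordEnd F x₀ A m f = toCoord F E x₀ m (A (coordPt x₀ m) (fromCoord F E x₀ m f)) := rfl

theorem fromCoord_coordSec (hm : m ∈ coordDomain F E x₀) (σ : ∀ y : M, E y) :
    fromCoord F E x₀ m (coordSec F x₀ σ m) = σ (coordPt x₀ m) := fromCoord_toCoord hm _

theorem fromCoord_coordEnd (hm : m ∈ coordDomain F E x₀) (A : ∀ y : M, E y →L[ℝ] E y) (f : F) :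
    fromCoord F E x₀ m (coordEnd F x₀ A m f) = A (coordPt x₀ m) (fromCoord F E x₀ m f) :=
  fromCoord_toCoord hm _

theorem coordSec_secOf (hm : m ∈ coordDomain F E x₀) (s : EM → F) :
    coordSec F x₀ (secOf E x₀ s) m = s m := by
  refine (toCoord_fromCoord hm _).trans ?_
  rw [extChartAt_coordPt hm]

theorem coordSec_secOf_const_eventuallyEq (hm : m ∈ coordDomain F E x₀) (f : F) :
    coordSec F x₀ (secOf E x₀ fun _ : EM ↦ f) =ᶠ[𝓝 m] fun _ ↦ f := by
  filter_upwards [isOpen_coordDomain.mem_nhds hm] with m' hm' using coordSec_secOf hm' _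

theorem differentiableAt_coordSec_secOf_const (hm : m ∈ coordDomain F E x₀) (f : F) :
    DifferentiableAt ℝ (coordSec F x₀ (secOf E x₀ fun _ : EM ↦ f)) m :=
  (differentiableAt_const f).congr_of_eventuallyEq (coordSec_secOf_const_eventuallyEq hm f)

theorem coordEnd_endOf (hm : m ∈ coordDomain F E x₀) (A : EM → F →L[ℝ] F) :
    coordEnd F x₀ (endOf E x₀ A) m = A m := by
  ext f
  refine (toCoord_fromCoord hm _).trans ?_
  rw [extChartAt_coordPt hm]
  exact congrArg _ (toCoord_fromCoord hm f)

theorem endPt_coordEnd (hm : m ∈ coordDomain F E x₀) (A : ∀ y : M, E y →L[ℝ] E y) :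
    endPt F E x₀ (m, coordEnd F x₀ A m) = endSection F E A (coordPt x₀ m) := by
  have hA : fromCoord F E x₀ m ∘L coordEnd F x₀ A m ∘L toCoord F E x₀ m = A (coordPt x₀ m) := by
    refine ContinuousLinearMap.ext fun v ↦ ?_
    simp only [ContinuousLinearMap.comp_apply, fromCoord_coordEnd hm, fromCoord_toCoord hm]
  simp only [endPt, endSection, hA]

theorem coordSec_end_apply (hm : m ∈ coordDomain F E x₀) (A : ∀ y : M, E y →L[ℝ] E y)
    (σ : ∀ y : M, E y) :
    coordSec F x₀ (fun y ↦ A y (σ y)) m = coordEnd F x₀ A m (coordSec F x₀ σ m) := by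
  rw [coordEnd_apply, fromCoord_coordSec hm, coordSec_apply]

theorem mdifferentiableAt_sec_iff_trivSec [ContMDiffVectorBundle ∞ F E 𝓘(ℝ, EM)] {x : M}
    (hx : x ∈ (trivializationAt F E x₀).baseSet) {σ : ∀ y : M, E y} :
    MDifferentiableAt 𝓘(ℝ, EM) (𝓘(ℝ, EM).prod 𝓘(ℝ, F)) (bundleSection F E σ) x ↔
      MDifferentiableAt 𝓘(ℝ, EM) 𝓘(ℝ, F) (trivSec F x₀ σ) x := by
  refine ((trivializationAt F E x₀).mdifferentiableAt_section_iff 𝓘(ℝ, EM) σ hx).trans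
    (EventuallyEq.mdifferentiableAt_iff ?_)
  filter_upwards [(trivializationAt F E x₀).open_baseSet.mem_nhds hx] with y hy
  exact (Trivialization.continuousLinearMapAt_apply_of_mem (R := ℝ) _ hy (σ y)).symm

variable (F x₀) in
/-- The flat connection determined by the preferred trivialization around `x₀`. -/
def flatConnection (σ : ∀ y : M, E y) (x : M) : TangentSpace 𝓘(ℝ, EM) x →L[ℝ] E x :=
  (trivializationAt F E x₀).symmL ℝ x ∘L mvfderiv 𝓘(ℝ, EM) (trivSec F x₀ σ) x

theorem isCovariantDerivativeOn_flatConnection [∀ x, IsTopologicalAddGroup (E x)]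
    [∀ x, ContinuousSMul ℝ (E x)] [ContMDiffVectorBundle ∞ F E 𝓘(ℝ, EM)] :
    IsCovariantDerivativeOn (I := 𝓘(ℝ, EM)) F (flatConnection F x₀ : (∀ y : M, E y) → _)
      (trivializationAt F E x₀).baseSet where
  add {σ σ' x} hσ hσ' hx := by
    rw [mdifferentiableAt_sec_iff_trivSec hx] at hσ hσ'
    have hadd : trivSec F x₀ (σ + σ') = trivSec F x₀ σ + trivSec F x₀ σ' := by
      funext y
      exact map_add _ _ _
    rw [flatConnection, hadd, mvfderiv_add hσ hσ', ContinuousLinearMap.comp_add]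
    rfl
  leibniz {σ g x} hσ hg hx := by
    rw [mdifferentiableAt_sec_iff_trivSec hx] at hσ
    have hsmul : trivSec F x₀ (g • σ) = g • trivSec F x₀ σ := by
      funext y
      exact map_smul _ _ _
    rw [flatConnection, hsmul, mvfderiv_smul hg hσ]
    refine ContinuousLinearMap.ext fun v ↦ ?_
    simp only [ContinuousLinearMap.comp_apply, add_apply, smul_apply, map_add, map_smul,
      ContinuousLinearMap.smulRight_apply, flatConnection]
    congr 2
    exact (trivializationAt F E x₀).symmL_continuousLinearMapAt hx _

section Smooth

variable [IsManifold 𝓘(ℝ, EM) ∞ M]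

omit [NormedSpace ℝ F] [∀ x, AddCommGroup (E x)] [∀ x, Module ℝ (E x)] [VectorBundle ℝ F E] in
theorem differentiableAt_comp_coordPt_iff {G : Type*} [NormedAddCommGroup G] [NormedSpace ℝ G]
    (hm : m ∈ coordDomain F E x₀) {f : M → G} :
    DifferentiableAt ℝ (fun m' ↦ f (coordPt x₀ m')) m ↔
      MDifferentiableAt 𝓘(ℝ, EM) 𝓘(ℝ, G) f (coordPt x₀ m) := by
  rw [← mdifferentiableAt_iff_differentiableAt]
  refine ⟨fun h ↦ ?_, fun h ↦ h.comp m (mdifferentiableAt_coordPt hm)⟩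
  rw [← extChartAt_coordPt hm] at h
  have hchart :=
    mdifferentiableAt_extChartAt (I := 𝓘(ℝ, EM)) (coordPt_mem_chart_source hm)
  refine (h.comp _ hchart).congr_of_eventuallyEq ?_
  filter_upwards [extChartAt_source_mem_nhds' (I := 𝓘(ℝ, EM))
    ((extChartAt 𝓘(ℝ, EM) x₀).map_target hm.1)] with y hy
  simp only [Function.comp, coordPt, (extChartAt 𝓘(ℝ, EM) x₀).left_inv hy]

section EndBundle

variable [∀ x, IsTopologicalAddGroup (E x)] [∀ x, ContinuousSMul ℝ (E x)]
  [ContMDiffVectorBundle ∞ F E 𝓘(ℝ, EM)] {A : ∀ y : M, E y →L[ℝ] E y}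

theorem mdifferentiableAt_end_iff (hm : m ∈ coordDomain F E x₀) :
    MDifferentiableAt 𝓘(ℝ, EM) (endModel EM F) (endSection F E A) (coordPt x₀ m) ↔
      DifferentiableAt ℝ (coordEnd F x₀ A) m :=
  ((trivializationAt (F →L[ℝ] F) (fun x : M ↦ E x →L[ℝ] E x) x₀).mdifferentiableAt_section_iff
    𝓘(ℝ, EM) A ⟨hm.2, hm.2⟩).trans (differentiableAt_comp_coordPt_iff hm).symm

theorem mfderiv_endSection (hm : m ∈ coordDomain F E x₀)
    (hA : DifferentiableAt ℝ (coordEnd F x₀ A) m) (u : EM) :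
    (mfderiv 𝓘(ℝ, EM) (endModel EM F) (endSection F E A) (coordPt x₀ m) :
      EM →L[ℝ] EM × (F →L[ℝ] F)) (fromCoordT EM x₀ m u) =
      dEndPt F E x₀ (m, coordEnd F x₀ A m) (u, fderiv ℝ (coordEnd F x₀ A) m u) := by
  have hlocal : endSection F E A ∘ (fun m' : EM ↦ coordPt x₀ m') =ᶠ[𝓝 m]
      endPt F E x₀ ∘ fun m' ↦ (m', coordEnd F x₀ A m') := by
    filter_upwards [isOpen_coordDomain.mem_nhds hm] with m' hm'
    exact (endPt_coordEnd hm' A).symm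
  have hgraph : HasFDerivAt (fun m' ↦ (m', coordEnd F x₀ A m'))
      ((ContinuousLinearMap.id ℝ EM).prod (fderiv ℝ (coordEnd F x₀ A) m)) m :=
    (hasFDerivAt_id m).prodMk hA.hasFDerivAt
  have hright := mfderiv_comp (I' := 𝓘(ℝ, EM × (F →L[ℝ] F))) m
    (mdifferentiableAt_endPt (q := (m, coordEnd F x₀ A m)) hm)
    hgraph.differentiableAt.mdifferentiableAt
  have hleft :=
    mfderiv_comp m ((mdifferentiableAt_end_iff hm).2 hA) (mdifferentiableAt_coordPt hm)
  rw [mfderiv_eq_fderiv, hgraph.fderiv, ← hlocal.mfderiv_eq] at hright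
  exact DFunLike.congr_fun (hleft.symm.trans hright) u

end EndBundle

theorem flatConnection_apply (hm : m ∈ coordDomain F E x₀) {σ : ∀ y : M, E y}
    (hσ : DifferentiableAt ℝ (coordSec F x₀ σ) m) (u : EM) :
    flatConnection F x₀ σ (coordPt x₀ m) (fromCoordT EM x₀ m u) =
      fromCoord F E x₀ m (fderiv ℝ (coordSec F x₀ σ) m u) := by
  have hchain := mfderiv_comp m ((differentiableAt_comp_coordPt_iff hm).1 hσ)
    (mdifferentiableAt_coordPt hm)
  have hcomp : trivSec F x₀ σ ∘ (fun m' : EM ↦ coordPt x₀ m') = coordSec F x₀ σ := rfl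
  rw [hcomp, mfderiv_eq_fderiv] at hchain
  rw [hchain]
  rfl

theorem mdifferentiableAt_sec_iff [ContMDiffVectorBundle ∞ F E 𝓘(ℝ, EM)]
    (hm : m ∈ coordDomain F E x₀) {σ : ∀ y : M, E y} :
    MDifferentiableAt 𝓘(ℝ, EM) (𝓘(ℝ, EM).prod 𝓘(ℝ, F)) (bundleSection F E σ) (coordPt x₀ m) ↔
      DifferentiableAt ℝ (coordSec F x₀ σ) m :=
  (mdifferentiableAt_sec_iff_trivSec hm.2).trans (differentiableAt_comp_coordPt_iff hm).symm

end Smooth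

end CoordinateSections

section ConnectionForm

variable {EM : Type*} [NormedAddCommGroup EM] [NormedSpace ℝ EM] [FiniteDimensional ℝ EM]
  {M : Type*} [TopologicalSpace M] [ChartedSpace EM M]
  {F : Type*} [NormedAddCommGroup F] [NormedSpace ℝ F] [FiniteDimensional ℝ F]
  {E : M → Type*} [TopologicalSpace (TotalSpace F E)]
  [∀ x, AddCommGroup (E x)] [∀ x, Module ℝ (E x)] [∀ x, TopologicalSpace (E x)]
  [∀ x, IsTopologicalAddGroup (E x)] [∀ x, ContinuousSMul ℝ (E x)]
  [FiberBundle F E] [VectorBundle ℝ F E] {x₀ : M} {m : EM}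
  [ContMDiffVectorBundle ∞ F E 𝓘(ℝ, EM)] (nabla : CovariantDerivative 𝓘(ℝ, EM) F E)

/-- The difference of a connection and of the flat connection determined by the preferred
trivialization around `x₀`. -/
def flatDifference (x₀ x : M) : E x →L[ℝ] TangentSpace 𝓘(ℝ, EM) x →L[ℝ] E x :=
  IsCovariantDerivativeOn.difference (s := (trivializationAt F E x₀).baseSet)
    nabla.isCovariantDerivativeOn isCovariantDerivativeOn_flatConnection x

/-- The connection form, in the preferred chart and trivialization around `x₀`. -/
def connForm (x₀ : M) (m : EM) : EM →L[ℝ] F →L[ℝ] F :=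
  LinearMap.toContinuousLinearMap (LinearMap.toContinuousLinearMap.toLinearMap ∘ₗ
    LinearMap.mk₂ ℝ (fun (u : EM) (f : F) ↦ toCoord F E x₀ m
      (flatDifference nabla x₀ (coordPt x₀ m) (fromCoord F E x₀ m f) (fromCoordT EM x₀ m u)))
      (fun u u' f ↦ by simp only [map_add]) (fun c u f ↦ by simp only [map_smul])
      (fun u f f' ↦ by simp only [map_add, add_apply])
      (fun c u f ↦ by simp only [map_smul, smul_apply]))

variable {nabla}

theorem connForm_apply (u : EM) (f : F) : connForm nabla x₀ m u f = toCoord F E x₀ m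
    (flatDifference nabla x₀ (coordPt x₀ m) (fromCoord F E x₀ m f) (fromCoordT EM x₀ m u)) := rfl

variable [IsManifold 𝓘(ℝ, EM) ∞ M]

theorem nabla_eq (hm : m ∈ coordDomain F E x₀) {σ : ∀ y : M, E y}
    (hσ : DifferentiableAt ℝ (coordSec F x₀ σ) m) (u : EM) :
    nabla σ (coordPt x₀ m) (fromCoordT EM x₀ m u) = fromCoord F E x₀ m
      (fderiv ℝ (coordSec F x₀ σ) m u + connForm nabla x₀ m u (coordSec F x₀ σ m)) := by
  have hdiff := IsCovariantDerivativeOn.difference_apply (s := (trivializationAt F E x₀).baseSet)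
    nabla.isCovariantDerivativeOn isCovariantDerivativeOn_flatConnection hm.2
    ((mdifferentiableAt_sec_iff hm).2 hσ)
  rw [map_add, connForm_apply, fromCoord_toCoord hm, fromCoord_coordSec hm, flatDifference, hdiff,
    ← flatConnection_apply hm hσ, sub_apply, add_sub_cancel]

section Endomorphism

variable {A : ∀ y : M, E y →L[ℝ] E y}

theorem nabla_end_apply (hm : m ∈ coordDomain F E x₀)
    (hA : DifferentiableAt ℝ (coordEnd F x₀ A) m) {σ : ∀ y : M, E y}
    (hσ : DifferentiableAt ℝ (coordSec F x₀ σ) m) (u : EM) :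
    nabla (fun y ↦ A y (σ y)) (coordPt x₀ m) (fromCoordT EM x₀ m u) -
        A (coordPt x₀ m) (nabla σ (coordPt x₀ m) (fromCoordT EM x₀ m u)) =
      fromCoord F E x₀ m ((fderiv ℝ (coordEnd F x₀ A) m u +
        ⁅connForm nabla x₀ m u, coordEnd F x₀ A m⁆) (coordSec F x₀ σ m)) := by
  have hlocal : coordSec F x₀ (fun y ↦ A y (σ y)) =ᶠ[𝓝 m]
      fun m' ↦ coordEnd F x₀ A m' (coordSec F x₀ σ m') := by
    filter_upwards [isOpen_coordDomain.mem_nhds hm] with m' hm' using coordSec_end_apply hm' A σ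
  have hderiv := hA.hasFDerivAt.clm_apply hσ.hasFDerivAt
  rw [nabla_eq hm (hderiv.differentiableAt.congr_of_eventuallyEq hlocal), nabla_eq hm hσ,
    hlocal.fderiv_eq, hderiv.fderiv, coordSec_end_apply hm, ← fromCoord_coordEnd hm, ← map_sub]
  congr 1
  simp only [add_apply, sub_apply, Ring.lie_def, mul_apply_eq_comp,
    ContinuousLinearMap.comp_apply, ContinuousLinearMap.flip_apply, map_add]
  abel

theorem isParallelAt_iff (hm : m ∈ coordDomain F E x₀)
    (hA : DifferentiableAt ℝ (coordEnd F x₀ A) m) (u : EM) :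
    IsParallelAt nabla A (coordPt x₀ m) (fromCoordT EM x₀ m u) ↔
      fderiv ℝ (coordEnd F x₀ A) m u + ⁅connForm nabla x₀ m u, coordEnd F x₀ A m⁆ = 0 := by
  refine ⟨fun hpar ↦ ContinuousLinearMap.ext fun f ↦ ?_, fun hzero σ hσ ↦ ?_⟩
  · have hconst := differentiableAt_coordSec_secOf_const (E := E) hm f
    have hcov := nabla_end_apply (nabla := nabla) hm hA hconst u
    rw [sub_eq_zero.2 (hpar _ ((mdifferentiableAt_sec_iff hm).2 hconst)),
      coordSec_secOf hm] at hcov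
    exact fromCoord_injective hm (hcov.symm.trans (map_zero _).symm)
  · rw [← sub_eq_zero, nabla_end_apply hm hA ((mdifferentiableAt_sec_iff hm).1 hσ), hzero,
      zero_apply, map_zero]

end Endomorphism

section Horizontal

variable {q : EM × (F →L[ℝ] F)}

theorem exists_dEndPt_eq_of_mem_horizontal (hq : q.1 ∈ coordDomain F E x₀)
    {ζ : TangentSpace (endModel EM F) (endPt F E x₀ q)}
    (hζ : ζ ∈ horizontal nabla (endPt F E x₀ q)) :
    ∃ ξ : EM × (F →L[ℝ] F),
      ξ.2 + ⁅connForm nabla x₀ q.1 ξ.1, q.2⁆ = 0 ∧ dEndPt F E x₀ q ξ = ζ := by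
  let vert : EM × (F →L[ℝ] F) →ₗ[ℝ] F →L[ℝ] F := LinearMap.snd ℝ _ _ +
    (LinearMap.mulRight ℝ q.2 - LinearMap.mulLeft ℝ q.2) ∘ₗ
      (connForm nabla x₀ q.1).toLinearMap ∘ₗ LinearMap.fst ℝ _ _
  suffices horizontal nabla (endPt F E x₀ q) ≤
      (LinearMap.ker vert).map (dEndPt F E x₀ q).toLinearMap from this hζ
  refine Submodule.span_le.2 ?_
  rintro _ ⟨A, v, hAq, hA, hpar, rfl⟩
  obtain ⟨u, rfl⟩ := (isInvertible_fromCoordT hq).surjective v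
  replace hA := (mdifferentiableAt_end_iff hq).1 hA
  have hcoord : coordEnd F x₀ A q.1 = q.2 := by
    ext f
    have hAq' : A (coordPt x₀ q.1) = fromCoord F E x₀ q.1 ∘L q.2 ∘L toCoord F E x₀ q.1 := hAq
    rw [coordEnd_apply, hAq', ContinuousLinearMap.comp_apply, ContinuousLinearMap.comp_apply,
      toCoord_fromCoord hq, toCoord_fromCoord hq]
  refine ⟨(u, fderiv ℝ (coordEnd F x₀ A) q.1 u), ?_, ?_⟩
  · have hzero := (isParallelAt_iff hq hA u).1 hpar
    rwa [hcoord] at hzero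
  · have hderiv := mfderiv_endSection hq hA u
    rw [hcoord] at hderiv
    exact hderiv.symm

theorem dEndPt_mem_horizontal (hq : q.1 ∈ coordDomain F E x₀) {ξ : EM × (F →L[ℝ] F)}
    (hξ : ξ.2 + ⁅connForm nabla x₀ q.1 ξ.1, q.2⁆ = 0) :
    dEndPt F E x₀ q ξ ∈ horizontal nabla (endPt F E x₀ q) := by
  let B : EM →L[ℝ] F →L[ℝ] F :=
    ContinuousLinearMap.mul ℝ (F →L[ℝ] F) q.2 ∘L connForm nabla x₀ q.1 -
      (ContinuousLinearMap.mul ℝ (F →L[ℝ] F)).flip q.2 ∘L connForm nabla x₀ q.1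
  have hB (u : EM) : B u = -⁅connForm nabla x₀ q.1 u, q.2⁆ := (neg_sub _ _).symm
  set a : EM → F →L[ℝ] F := fun m' ↦ q.2 + B (m' - q.1)
  have ha : a q.1 = q.2 := by simp [a]
  have hlocal : coordEnd F x₀ (endOf E x₀ a) =ᶠ[𝓝 q.1] a := by
    filter_upwards [isOpen_coordDomain.mem_nhds hq] with m' hm' using coordEnd_endOf hm' _
  have hderiv : HasFDerivAt (coordEnd F x₀ (endOf E x₀ a)) B q.1 :=
    ((B.hasFDerivAt.comp q.1 ((hasFDerivAt_id q.1).sub_const q.1)).const_add q.2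
      ).congr_of_eventuallyEq hlocal
  have hval : coordEnd F x₀ (endOf E x₀ a) q.1 = q.2 := by rw [coordEnd_endOf hq, ha]
  have hmf := mfderiv_endSection hq hderiv.differentiableAt ξ.1
  rw [hderiv.fderiv, hval, hB, ← eq_neg_of_add_eq_zero_left hξ] at hmf
  refine Submodule.subset_span ⟨endOf E x₀ a, fromCoordT EM x₀ q.1 ξ.1, ?_,
    (mdifferentiableAt_end_iff hq).2 hderiv.differentiableAt,
    (isParallelAt_iff hq hderiv.differentiableAt ξ.1).2 ?_, hmf.symm⟩
  · have hcentre : a (extChartAt 𝓘(ℝ, EM) x₀ (coordPt x₀ q.1)) = q.2 := by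
      rw [extChartAt_coordPt hq, ha]
    exact congrArg (fun T : F →L[ℝ] F ↦ fromCoord F E x₀ q.1 ∘L T ∘L toCoord F E x₀ q.1) hcentre
  · rw [hderiv.fderiv, hval, hB, neg_add_cancel]

end Horizontal

end ConnectionForm

section SmoothCoordinates

theorem contDiffAt_clm_of_forall_apply {D V W : Type*} [NormedAddCommGroup D] [NormedSpace ℝ D]
    [NormedAddCommGroup V] [NormedSpace ℝ V] [FiniteDimensional ℝ V] [NormedAddCommGroup W]
    [NormedSpace ℝ W] {n : WithTop ℕ∞} {f : D → V →L[ℝ] W} {x : D}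
    (hf : ∀ v, ContDiffAt ℝ n (fun y ↦ f y v) x) : ContDiffAt ℝ n f x := by
  let e₁ : V ≃L[ℝ] (Fin (finrank ℝ V) → ℝ) :=
    ContinuousLinearEquiv.ofFinrankEq (finrank_fin_fun ℝ).symm
  let e₂ := (e₁.arrowCongr (1 : W ≃L[ℝ] W)).trans
    (ContinuousLinearEquiv.piRing (Fin (finrank ℝ V)))
  rw [← Function.id_comp f, ← e₂.symm_comp_self]
  exact e₂.symm.contDiff.contDiffAt.comp x (contDiffAt_pi.mpr fun i ↦ hf _)

variable {EM : Type*} [NormedAddCommGroup EM] [NormedSpace ℝ EM]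
  {M : Type*} [TopologicalSpace M] [ChartedSpace EM M]
  {F : Type*} [NormedAddCommGroup F]
  {E : M → Type*} [TopologicalSpace (TotalSpace F E)] [∀ x, TopologicalSpace (E x)]
  [FiberBundle F E] {x₀ : M} {m : EM}

theorem eventually_mem_coordDomain :
    ∀ᶠ m in 𝓝 (extChartAt 𝓘(ℝ, EM) x₀ x₀), m ∈ coordDomain F E x₀ :=
  isOpen_coordDomain.mem_nhds extChartAt_mem_coordDomain

variable [NormedSpace ℝ F] [∀ x, AddCommGroup (E x)] [∀ x, Module ℝ (E x)] [VectorBundle ℝ F E]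
  [∀ x, IsTopologicalAddGroup (E x)] [∀ x, ContinuousSMul ℝ (E x)] [IsManifold 𝓘(ℝ, EM) ∞ M]

theorem contDiffAt_hom {F₁ F₂ : Type*} [NormedAddCommGroup F₁] [NormedSpace ℝ F₁]
    [NormedAddCommGroup F₂] [NormedSpace ℝ F₂] {E₁ E₂ : M → Type*}
    [TopologicalSpace (TotalSpace F₁ E₁)] [∀ x, AddCommGroup (E₁ x)] [∀ x, Module ℝ (E₁ x)]
    [∀ x, TopologicalSpace (E₁ x)] [FiberBundle F₁ E₁] [VectorBundle ℝ F₁ E₁]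
    [TopologicalSpace (TotalSpace F₂ E₂)] [∀ x, AddCommGroup (E₂ x)] [∀ x, Module ℝ (E₂ x)]
    [∀ x, TopologicalSpace (E₂ x)] [FiberBundle F₂ E₂] [VectorBundle ℝ F₂ E₂]
    [∀ x, IsTopologicalAddGroup (E₂ x)] [∀ x, ContinuousSMul ℝ (E₂ x)]
    {ψ : ∀ x : M, E₁ x →L[ℝ] E₂ x}
    (hψ : ContMDiffAt 𝓘(ℝ, EM) (𝓘(ℝ, EM).prod 𝓘(ℝ, F₁ →L[ℝ] F₂)) ∞
      (fun x ↦ (⟨x, ψ x⟩ : TotalSpace (F₁ →L[ℝ] F₂) (fun x : M ↦ E₁ x →L[ℝ] E₂ x))) x₀) :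
    ContDiffAt ℝ ∞ (fun m ↦ (trivializationAt F₂ E₂ x₀).continuousLinearMapAt ℝ (coordPt x₀ m) ∘L
      ψ (coordPt x₀ m) ∘L (trivializationAt F₁ E₁ x₀).symmL ℝ (coordPt x₀ m))
      (extChartAt 𝓘(ℝ, EM) x₀ x₀) := by
  rw [← contMDiffAt_iff_contDiffAt]
  refine ContMDiffAt.comp_of_eq ((contMDiffAt_hom_bundle _).1 hψ).2
    ((contMDiffOn_extChartAt_symm x₀).contMDiffAt (extChartAt_target_mem_nhds x₀))
    (extChartAt_to_inv x₀)

theorem contDiffAt_coordEnd {A : ∀ x : M, E x →L[ℝ] E x}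
    (hA : ContMDiffAt 𝓘(ℝ, EM) (endModel EM F) ∞ (endSection F E A) x₀) :
    ContDiffAt ℝ ∞ (coordEnd F x₀ A) (extChartAt 𝓘(ℝ, EM) x₀ x₀) :=
  contDiffAt_hom hA

theorem contDiffAt_homT {ψ : ∀ x : M, TangentSpace 𝓘(ℝ, EM) x →L[ℝ] E x}
    (hψ : ContMDiffAt 𝓘(ℝ, EM) (𝓘(ℝ, EM).prod 𝓘(ℝ, EM →L[ℝ] F)) ∞
      (fun x ↦ (⟨x, ψ x⟩ :
        TotalSpace (EM →L[ℝ] F) (fun x : M ↦ TangentSpace 𝓘(ℝ, EM) x →L[ℝ] E x))) x₀) :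
    ContDiffAt ℝ ∞ (fun m ↦ toCoord F E x₀ m ∘L ψ (coordPt x₀ m) ∘L fromCoordT EM x₀ m :
      EM → EM →L[ℝ] F) (extChartAt 𝓘(ℝ, EM) x₀ x₀) := by
  refine (contDiffAt_hom hψ).congr_of_eventuallyEq ?_
  filter_upwards [eventually_mem_coordDomain (F := F) (E := E)] with m hm
  rw [fromCoordT_eq_symmL hm]
  rfl

variable [FiniteDimensional ℝ EM] [T2Space M] [ContMDiffVectorBundle ∞ F E 𝓘(ℝ, EM)]

omit [∀ x, IsTopologicalAddGroup (E x)] [∀ x, ContinuousSMul ℝ (E x)] in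
theorem exists_section_coordSec_eq (x₀ : M) (f : F) : ∃ σ : ∀ y : M, E y,
    ContMDiff 𝓘(ℝ, EM) (𝓘(ℝ, EM).prod 𝓘(ℝ, F)) ∞ (bundleSection F E σ) ∧
    ∀ᶠ m in 𝓝 (extChartAt 𝓘(ℝ, EM) x₀ x₀), coordSec F x₀ σ m = f := by
  set e := trivializationAt F E x₀
  have he : e.baseSet ∈ 𝓝 x₀ :=
    e.open_baseSet.mem_nhds (mem_baseSet_trivializationAt F E x₀)
  obtain ⟨ψ, -, hψ⟩ :=
    (SmoothBumpFunction.nhds_basis_tsupport (I := 𝓘(ℝ, EM)) x₀).mem_iff.1 he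
  set σ : ∀ y : M, E y := (ψ : M → ℝ) • fun y ↦ e.symmL ℝ y f
  have hconst : ContMDiffOn 𝓘(ℝ, EM) (𝓘(ℝ, EM).prod 𝓘(ℝ, F)) ∞
      (bundleSection F E fun y ↦ e.symmL ℝ y f) e.baseSet := by
    refine (e.contMDiffOn_section_baseSet_iff).2 ((contMDiffOn_const (c := f)).congr fun y hy ↦ ?_)
    refine (Trivialization.continuousLinearMapAt_apply_of_mem (R := ℝ) e hy _).symm.trans ?_
    exact e.continuousLinearMapAt_symmL hy f
  have hσ : ∀ᶠ y in 𝓝 x₀, trivSec F x₀ σ y = f := by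
    filter_upwards [ψ.eventuallyEq_one, he] with y hy hye
    simp only [trivSec, σ, Pi.smul_apply', hy, Pi.one_apply, one_smul]
    exact e.continuousLinearMapAt_symmL hye f
  have hcont := continuousAt_extChartAt_symm (I := 𝓘(ℝ, EM)) x₀
  rw [ContinuousAt, extChartAt_to_inv] at hcont
  exact ⟨σ, ContMDiffOn.smul_section_of_tsupport ψ.contMDiff.contMDiffOn e.open_baseSet hψ hconst,
    hcont hσ⟩

theorem contDiffAt_connForm [FiniteDimensional ℝ F] (nabla : CovariantDerivative 𝓘(ℝ, EM) F E)
    [hnabla : CovariantDerivative.ContMDiffCovariantDerivative nabla ∞] (x₀ : M) :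
    ContDiffAt ℝ ∞ (connForm nabla x₀) (extChartAt 𝓘(ℝ, EM) x₀ x₀) := by
  refine contDiffAt_clm_of_forall_apply fun u ↦ contDiffAt_clm_of_forall_apply fun f ↦ ?_
  obtain ⟨σ, hσ, hσf⟩ := exists_section_coordSec_eq (EM := EM) (E := E) x₀ f
  have hnablaσ := hnabla.contMDiff.contMDiff (σ := σ) (hσ.of_le (by simp)).contMDiffOn
  have hcoord := contDiffAt_homT (hnablaσ.contMDiffAt (x := x₀) univ_mem)
  refine (hcoord.clm_apply (contDiffAt_const (c := u))).congr_of_eventuallyEq ?_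
  filter_upwards [eventually_mem_coordDomain (F := F) (E := E), hσf.eventually_nhds] with m hm hσm
  have hconst : coordSec F x₀ σ =ᶠ[𝓝 m] fun _ ↦ f := hσm
  have hderiv : HasFDerivAt (coordSec F x₀ σ) (0 : EM →L[ℝ] F) m :=
    (hasFDerivAt_const f m).congr_of_eventuallyEq hconst
  have hcov := nabla_eq (nabla := nabla) hm hderiv.differentiableAt u
  rw [hderiv.fderiv, zero_apply, zero_add, hconst.self_of_nhds] at hcov
  rw [ContinuousLinearMap.comp_apply, ContinuousLinearMap.comp_apply, hcov, toCoord_fromCoord hm]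

end SmoothCoordinates

section EndomorphismCoordinates

variable {EM : Type*} [NormedAddCommGroup EM] [NormedSpace ℝ EM]
  {M : Type*} [TopologicalSpace M] [ChartedSpace EM M]
  {F : Type*} [NormedAddCommGroup F] [NormedSpace ℝ F]
  {E : M → Type*} [TopologicalSpace (TotalSpace F E)]
  [∀ x, AddCommGroup (E x)] [∀ x, Module ℝ (E x)] [∀ x, TopologicalSpace (E x)]
  [∀ x, IsTopologicalAddGroup (E x)] [∀ x, ContinuousSMul ℝ (E x)]
  [FiberBundle F E] [VectorBundle ℝ F E] {x₀ : M} {m : EM}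

variable (F E x₀) in
/-- The identification of the endomorphisms of a fibre with those of the model fibre. -/
def coordLin (m : EM) : (E (coordPt x₀ m) →L[ℝ] E (coordPt x₀ m)) →ₗ[ℝ] F →L[ℝ] F where
  toFun T := toCoord F E x₀ m ∘L T ∘L fromCoord F E x₀ m
  map_add' _ _ := ContinuousLinearMap.ext fun _ ↦ map_add (toCoord F E x₀ m) _ _
  map_smul' _ _ := ContinuousLinearMap.ext fun _ ↦ map_smul (toCoord F E x₀ m) _ _

theorem coordEnd_eq_coordLin (A : ∀ y : M, E y →L[ℝ] E y) (m : EM) :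
    coordEnd F x₀ A m = coordLin F E x₀ m (A (coordPt x₀ m)) := rfl

theorem coordLin_apply (T : E (coordPt x₀ m) →L[ℝ] E (coordPt x₀ m)) (f : F) :
    coordLin F E x₀ m T f = toCoord F E x₀ m (T (fromCoord F E x₀ m f)) := rfl

theorem coordLin_comp (hm : m ∈ coordDomain F E x₀)
    (S T : E (coordPt x₀ m) →L[ℝ] E (coordPt x₀ m)) :
    coordLin F E x₀ m (S ∘L T) = coordLin F E x₀ m S * coordLin F E x₀ m T := by
  ext f
  rw [mul_apply_eq_comp, coordLin_apply, coordLin_apply, coordLin_apply, fromCoord_toCoord hm,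
    ContinuousLinearMap.comp_apply]

theorem coordLin_neg_id (hm : m ∈ coordDomain F E x₀) :
    coordLin F E x₀ m (-ContinuousLinearMap.id ℝ (E (coordPt x₀ m))) = -1 := by
  rw [map_neg]
  congr 1
  exact ContinuousLinearMap.ext fun f ↦ toCoord_fromCoord hm f

theorem coordLin_fromCoord_comp (hm : m ∈ coordDomain F E x₀) (A : F →L[ℝ] F) :
    coordLin F E x₀ m (fromCoord F E x₀ m ∘L A ∘L toCoord F E x₀ m) = A := by
  ext f
  rw [coordLin_apply, ContinuousLinearMap.comp_apply, ContinuousLinearMap.comp_apply,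
    toCoord_fromCoord hm, toCoord_fromCoord hm]

theorem fromCoord_comp_coordLin (hm : m ∈ coordDomain F E x₀)
    (T : E (coordPt x₀ m) →L[ℝ] E (coordPt x₀ m)) :
    fromCoord F E x₀ m ∘L coordLin F E x₀ m T ∘L toCoord F E x₀ m = T := by
  refine ContinuousLinearMap.ext fun v ↦ ?_
  rw [ContinuousLinearMap.comp_apply, ContinuousLinearMap.comp_apply, coordLin_apply,
    fromCoord_toCoord hm, fromCoord_toCoord hm]

theorem coordLin_injective (hm : m ∈ coordDomain F E x₀) :
    Function.Injective (coordLin F E x₀ m) :=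
  Function.LeftInverse.injective (g := fun A ↦ fromCoord F E x₀ m ∘L A ∘L toCoord F E x₀ m)
    (fromCoord_comp_coordLin hm)

theorem coordLin_mul_self_eq_neg_one_iff (hm : m ∈ coordDomain F E x₀)
    {T : E (coordPt x₀ m) →L[ℝ] E (coordPt x₀ m)} :
    coordLin F E x₀ m T * coordLin F E x₀ m T = -1 ↔
      T ∘L T = -ContinuousLinearMap.id ℝ (E (coordPt x₀ m)) := by
  rw [← coordLin_comp hm, ← coordLin_neg_id hm, (coordLin_injective hm).eq_iff]

theorem coordLin_mem_map_iff (hm : m ∈ coordDomain F E x₀)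
    {T : E (coordPt x₀ m) →L[ℝ] E (coordPt x₀ m)}
    {W : Submodule ℝ (E (coordPt x₀ m) →L[ℝ] E (coordPt x₀ m))} :
    coordLin F E x₀ m T ∈ W.map (coordLin F E x₀ m) ↔ T ∈ W :=
  Submodule.mem_map.trans
    ⟨fun ⟨_, hT', hT⟩ ↦ coordLin_injective hm hT ▸ hT', fun hT ↦ ⟨T, hT, rfl⟩⟩

variable [IsManifold 𝓘(ℝ, EM) ∞ M] [ContMDiffVectorBundle ∞ F E 𝓘(ℝ, EM)]
  [FiniteDimensional ℝ EM] [FiniteDimensional ℝ F] {nabla : CovariantDerivative 𝓘(ℝ, EM) F E}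
  {𝒬 : QuaternionicStructure (EM := EM) F E}

theorem QuaternionicStructure.IsCompatible.exists_coordLin_eq (h𝒬 : 𝒬.IsCompatible nabla)
    (hm : m ∈ coordDomain F E x₀) {A : ∀ y : M, E y →L[ℝ] E y}
    (hA : DifferentiableAt ℝ (coordEnd F x₀ A) m)
    (hAQ : ∀ᶠ y in 𝓝 (coordPt x₀ m), A y ∈ 𝒬.Q y) (u : EM) :
    ∃ B ∈ 𝒬.Q (coordPt x₀ m), coordLin F E x₀ m B =
      fderiv ℝ (coordEnd F x₀ A) m u + ⁅connForm nabla x₀ m u, coordEnd F x₀ A m⁆ := by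
  obtain ⟨B, hB, hderiv⟩ :=
    h𝒬 _ A ((mdifferentiableAt_end_iff hm).2 hA) hAQ (fromCoordT EM x₀ m u)
  refine ⟨B, hB, ContinuousLinearMap.ext fun f ↦ ?_⟩
  have hconst := differentiableAt_coordSec_secOf_const (E := E) hm f
  have hcov := nabla_end_apply (nabla := nabla) hm hA hconst u
  rw [hderiv _ ((mdifferentiableAt_sec_iff hm).2 hconst), ← fromCoord_coordSec hm (secOf E x₀ _),
    coordSec_secOf hm] at hcov
  rw [coordLin_apply, hcov, toCoord_fromCoord hm]

end EndomorphismCoordinates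

section CoordinateVectorFields

variable {EM : Type*} [NormedAddCommGroup EM] [NormedSpace ℝ EM]
  {M : Type*} [TopologicalSpace M] [ChartedSpace EM M] [IsManifold 𝓘(ℝ, EM) ∞ M]
  {x₀ : M} {m : EM}

theorem mem_coordDomain_tangentSpace {F : Type*} [NormedAddCommGroup F]
    {E : M → Type*} [TopologicalSpace (TotalSpace F E)] [∀ x, TopologicalSpace (E x)]
    [FiberBundle F E] (hm : m ∈ coordDomain F E x₀) :
    m ∈ coordDomain EM (TangentSpace 𝓘(ℝ, EM) : M → Type _) x₀ :=
  ⟨hm.1, coordPt_mem_chart_source hm⟩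

variable (x₀) in
/-- The vector field with constant components `u` in the preferred chart around `x₀`. -/
def coordVectorField (u : EM) : ∀ y : M, TangentSpace 𝓘(ℝ, EM) y :=
  secOf (TangentSpace 𝓘(ℝ, EM) : M → Type _) x₀ fun _ : EM ↦ u

variable (hm : m ∈ coordDomain EM (TangentSpace 𝓘(ℝ, EM) : M → Type _) x₀)
include hm

theorem coordVectorField_coordPt (u : EM) :
    coordVectorField x₀ u (coordPt x₀ m) = fromCoordT EM x₀ m u :=
  DFunLike.congr_fun (fromCoordT_eq_symmL hm) u

theorem mdifferentiableAt_coordVectorField (u : EM) :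
    MDifferentiableAt 𝓘(ℝ, EM) 𝓘(ℝ, EM).tangent
      (bundleSection EM (TangentSpace 𝓘(ℝ, EM) : M → Type _) (coordVectorField x₀ u))
      (coordPt x₀ m) :=
  (mdifferentiableAt_sec_iff hm).2 (differentiableAt_coordSec_secOf_const hm u)

theorem mpullback_coordVectorField (u : EM) :
    mpullback 𝓘(ℝ, EM) 𝓘(ℝ, EM) (fun m' : EM ↦ coordPt x₀ m') (coordVectorField x₀ u) m = u := by
  rw [mpullback_apply, coordVectorField_coordPt hm]
  exact (isInvertible_fromCoordT hm).inverse_apply_eq.2 rfl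

theorem mlieBracket_coordVectorField [FiniteDimensional ℝ EM] (u v : EM) :
    mlieBracket 𝓘(ℝ, EM) (coordVectorField x₀ u) (coordVectorField x₀ v) (coordPt x₀ m) = 0 := by
  have hsmooth : minSmoothness ℝ 2 = 2 := minSmoothness_of_isRCLikeNormedField
  have : IsManifold 𝓘(ℝ, EM) (minSmoothness ℝ 2) M := by
    rw [hsmooth]
    infer_instance
  have hconst (w : EM) : mpullback 𝓘(ℝ, EM) 𝓘(ℝ, EM) (fun m' : EM ↦ coordPt x₀ m')
      (coordVectorField x₀ w) =ᶠ[𝓝 m] fun _ ↦ w := by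
    filter_upwards [isOpen_coordDomain.mem_nhds hm] with m' hm'
    exact mpullback_coordVectorField hm' w
  have hpull := mpullback_mlieBracket (mdifferentiableAt_coordVectorField hm u)
    (mdifferentiableAt_coordVectorField hm v) (contMDiffAt_coordPt hm)
    (hsmooth.trans_le ENat.LEInfty.out)
  have hzero : lieBracket ℝ (fun _ : EM ↦ u) (fun _ ↦ v) m = 0 := by simp [lieBracket_eq]
  rw [← mlieBracketWithin_univ (I := 𝓘(ℝ, EM)) (M := EM),
    mlieBracketWithin_eq_lieBracketWithin] at hpull
  have hbracket := hpull.trans ((congrFun lieBracketWithin_univ m).trans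
    (((hconst u).lieBracket_vectorField_eq (hconst v)).trans hzero))
  rw [mpullback_apply] at hbracket
  exact ((isInvertible_fromCoordT hm).inverse_apply_eq.1 hbracket).trans (map_zero _)

end CoordinateVectorFields

namespace AlmostFQuaternionicStructure

variable {EM : Type*} [NormedAddCommGroup EM] [NormedSpace ℝ EM]
  {M : Type*} [TopologicalSpace M] [ChartedSpace EM M]
  {F : Type*} [NormedAddCommGroup F] [NormedSpace ℝ F]
  {E : M → Type*} [TopologicalSpace (TotalSpace F E)]
  [∀ x, AddCommGroup (E x)] [∀ x, Module ℝ (E x)] [∀ x, TopologicalSpace (E x)]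
  [∀ x, IsTopologicalAddGroup (E x)] [∀ x, ContinuousSMul ℝ (E x)]
  [FiberBundle F E] [VectorBundle ℝ F E] [IsManifold 𝓘(ℝ, EM) ∞ M]
  {S : AlmostFQuaternionicStructure EM F E} {x₀ : M} {m : EM}

section Definitions

variable (S) (x₀)

/-- The inclusion `TM → E`, in coordinates. -/
def coordι (m : EM) : EM →L[ℝ] F :=
  toCoord F E x₀ m ∘L S.ι (coordPt x₀ m) ∘L fromCoordT EM x₀ m

/-- The projection `E → TM`, in coordinates. -/
def coordρ (m : EM) : F →L[ℝ] EM :=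
  toCoord EM (TangentSpace 𝓘(ℝ, EM) : M → Type _) x₀ m ∘L S.ρ (coordPt x₀ m) ∘L
    fromCoord F E x₀ m

end Definitions

theorem contDiffAt_coordι : ContDiffAt ℝ ∞ (S.coordι x₀) (extChartAt 𝓘(ℝ, EM) x₀ x₀) :=
  contDiffAt_homT S.contMDiff_ι.contMDiffAt

theorem contDiffAt_coordρ : ContDiffAt ℝ ∞ (S.coordρ x₀) (extChartAt 𝓘(ℝ, EM) x₀ x₀) :=
  contDiffAt_hom S.contMDiff_ρ.contMDiffAt

section Pointwise

variable (hm : m ∈ coordDomain F E x₀)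
include hm

theorem fromCoord_coordι (u : EM) :
    fromCoord F E x₀ m (S.coordι x₀ m u) = S.ι (coordPt x₀ m) (fromCoordT EM x₀ m u) :=
  fromCoord_toCoord hm _

theorem fromCoordT_coordρ (f : F) :
    fromCoordT EM x₀ m (S.coordρ x₀ m f) = S.ρ (coordPt x₀ m) (fromCoord F E x₀ m f) := by
  rw [← fromCoordT_eq_symmL hm]
  exact fromCoord_toCoord (mem_coordDomain_tangentSpace hm) _

theorem coordρ_coordι (u : EM) : S.coordρ x₀ m (S.coordι x₀ m u) = u := by
  refine (isInvertible_fromCoordT hm).injective ?_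
  rw [fromCoordT_coordρ hm, fromCoord_coordι hm, S.ρ_ι]

theorem coordρ_eq_zero_iff {f : F} :
    S.coordρ x₀ m f = 0 ↔ S.ρ (coordPt x₀ m) (fromCoord F E x₀ m f) = 0 := by
  rw [← fromCoordT_coordρ hm, map_eq_zero_iff _ (isInvertible_fromCoordT hm).injective]

theorem exists_coordLin_apply_eq_coordι {T : E (coordPt x₀ m) →L[ℝ] E (coordPt x₀ m)}
    (hT : S.IsAdmissible T) {f : F} (hf : S.coordρ x₀ m f = 0) :
    ∃ u, coordLin F E x₀ m T f = S.coordι x₀ m u := by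
  obtain ⟨w, hw⟩ := S.map_V_le _ T hT _ ((coordρ_eq_zero_iff hm).1 hf)
  obtain ⟨u, rfl⟩ := (isInvertible_fromCoordT hm).surjective w
  exact ⟨u, by rw [coordLin_apply, hw]; rfl⟩

theorem finrank_ker_coordρ :
    finrank ℝ (LinearMap.ker (S.coordρ x₀ m).toLinearMap) = finrank ℝ (S.V (coordPt x₀ m)) := by
  let L : F ≃ₗ[ℝ] E (coordPt x₀ m) := LinearEquiv.ofBijective (fromCoord F E x₀ m).toLinearMap
    ⟨fromCoord_injective hm, fromCoord_surjective hm⟩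
  have hker : LinearMap.ker (S.coordρ x₀ m).toLinearMap =
      (S.V (coordPt x₀ m)).comap (L : F →ₗ[ℝ] E (coordPt x₀ m)) := by
    ext f
    exact coordρ_eq_zero_iff hm
  rw [hker]
  exact (LinearEquiv.ofSubmodule' L (S.V (coordPt x₀ m))).finrank_eq

end Pointwise

section Connection

variable (S) in
/-- The projection `E → TM`, as an endomorphism of `E`. -/
def proj (x : M) : E x →L[ℝ] E x := S.ι x ∘L S.ρ x

theorem coordEnd_proj (hm : m ∈ coordDomain F E x₀) :
    coordEnd F x₀ S.proj m = S.coordι x₀ m ∘L S.coordρ x₀ m := by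
  ext f
  refine fromCoord_injective hm ?_
  rw [ContinuousLinearMap.comp_apply, fromCoord_coordι hm, fromCoordT_coordρ hm,
    fromCoord_coordEnd hm, proj, ContinuousLinearMap.comp_apply]

variable {nabla : CovariantDerivative 𝓘(ℝ, EM) F E}

-- Differentiating `σ = Pσ + (1 - P)σ`, the first term stays in `TM` and the second one in `V`.
theorem IsCompatible.nabla_proj_apply (h : S.IsCompatible nabla) {σ : ∀ y : M, E y} {x : M}
    (hσ : MDifferentiableAt 𝓘(ℝ, EM) (𝓘(ℝ, EM).prod 𝓘(ℝ, F)) (bundleSection F E σ) x)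
    (hPσ : MDifferentiableAt 𝓘(ℝ, EM) (𝓘(ℝ, EM).prod 𝓘(ℝ, F))
      (bundleSection F E fun y ↦ S.proj y (σ y)) x) (v : TangentSpace 𝓘(ℝ, EM) x) :
    nabla (fun y ↦ S.proj y (σ y)) x v = S.proj x (nabla σ x v) := by
  have hsub := mdifferentiableAt_sub_section hσ hPσ
  obtain ⟨w, hw⟩ := h.preserves_TM _ _ hPσ (.of_forall fun y ↦ ⟨S.ρ y (σ y), rfl⟩) v
  have hV : S.ρ x (nabla (σ - fun y ↦ S.proj y (σ y)) x v) = 0 := by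
    refine h.preserves_V _ _ hsub (.of_forall fun y ↦ ?_) _
    change S.ρ y (σ y - S.ι y (S.ρ y (σ y))) = 0
    rw [map_sub, S.ρ_ι, sub_self]
  have hadd := nabla.isCovariantDerivativeOnUniv.add hsub hPσ
  rw [sub_add_cancel] at hadd
  have hρ : S.ρ x (nabla σ x v) = w := by
    rw [hadd, add_apply, map_add, hV, zero_add, ← S.ρ_ι x w]
    exact congrArg (S.ρ x) hw.symm
  rw [proj, ContinuousLinearMap.comp_apply, hρ]
  exact hw.symm

variable [ContMDiffVectorBundle ∞ F E 𝓘(ℝ, EM)] [FiniteDimensional ℝ EM] [FiniteDimensional ℝ F]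

theorem IsCompatible.parallel_coordι_comp_coordρ (h : S.IsCompatible nabla)
    (hm : m ∈ coordDomain F E x₀) (hι : DifferentiableAt ℝ (S.coordι x₀) m)
    (hρ : DifferentiableAt ℝ (S.coordρ x₀) m) (u : EM) :
    fderiv ℝ (fun m' ↦ S.coordι x₀ m' ∘L S.coordρ x₀ m') m u +
      ⁅connForm nabla x₀ m u, S.coordι x₀ m ∘L S.coordρ x₀ m⁆ = 0 := by
  have hlocal : coordEnd F x₀ S.proj =ᶠ[𝓝 m] fun m' ↦ S.coordι x₀ m' ∘L S.coordρ x₀ m' := by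
    filter_upwards [isOpen_coordDomain.mem_nhds hm] with m' hm' using coordEnd_proj hm'
  have hP : DifferentiableAt ℝ (coordEnd F x₀ S.proj) m :=
    (hι.clm_comp hρ).congr_of_eventuallyEq hlocal
  rw [← hlocal.fderiv_eq, ← coordEnd_proj hm]
  refine (isParallelAt_iff hm hP u).1 fun σ hσ ↦ h.nabla_proj_apply hσ ?_ _
  have hσ' := (mdifferentiableAt_sec_iff hm).1 hσ
  refine (mdifferentiableAt_sec_iff hm).2 ((hP.clm_apply hσ').congr_of_eventuallyEq ?_)
  filter_upwards [isOpen_coordDomain.mem_nhds hm] with m' hm' using coordSec_end_apply hm' _ σ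

variable {D : CovariantDerivative 𝓘(ℝ, EM) EM (TangentSpace 𝓘(ℝ, EM) : M → Type _)}

theorem IsInducedBy.fromCoord_fderiv_coordι (h : S.IsInducedBy nabla D)
    (hm : m ∈ coordDomain F E x₀) (hι : DifferentiableAt ℝ (S.coordι x₀) m) (u v : EM) :
    fromCoord F E x₀ m (fderiv ℝ (S.coordι x₀) m u v + connForm nabla x₀ m u (S.coordι x₀ m v)) =
      S.ι (coordPt x₀ m) (D (coordVectorField x₀ v) (coordPt x₀ m)
        (coordVectorField x₀ u (coordPt x₀ m))) := by
  have hmT := mem_coordDomain_tangentSpace hm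
  have hlocal : coordSec F x₀ (fun y ↦ S.ι y (coordVectorField x₀ v y)) =ᶠ[𝓝 m]
      fun m' ↦ S.coordι x₀ m' v := by
    filter_upwards [isOpen_coordDomain.mem_nhds hm] with m' hm'
    rw [coordSec_apply, coordVectorField_coordPt (mem_coordDomain_tangentSpace hm')]
    rfl
  have hderiv := (hι.hasFDerivAt.clm_apply (hasFDerivAt_const v m)).congr_of_eventuallyEq hlocal
  rw [← h.restrict_eq _ _ (mdifferentiableAt_coordVectorField hmT v),
    coordVectorField_coordPt hmT, nabla_eq hm hderiv.differentiableAt, hderiv.fderiv,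
    hlocal.self_of_nhds]
  simp only [add_apply, ContinuousLinearMap.comp_apply, ContinuousLinearMap.flip_apply,
    zero_apply, map_zero, zero_add]

theorem IsInducedBy.fderiv_coordι_comm (h : S.IsInducedBy nabla D) (hD : D.torsion = 0)
    (hm : m ∈ coordDomain F E x₀) (hι : DifferentiableAt ℝ (S.coordι x₀) m) (u v : EM) :
    fderiv ℝ (S.coordι x₀) m u v + connForm nabla x₀ m u (S.coordι x₀ m v) =
      fderiv ℝ (S.coordι x₀) m v u + connForm nabla x₀ m v (S.coordι x₀ m u) := by
  have hmT := mem_coordDomain_tangentSpace hm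
  refine fromCoord_injective hm ?_
  rw [h.fromCoord_fderiv_coordι hm hι, h.fromCoord_fderiv_coordι hm hι]
  congr 1
  rw [← sub_eq_zero, D.torsion_eq_zero_iff.1 hD (mdifferentiableAt_coordVectorField hmT u)
    (mdifferentiableAt_coordVectorField hmT v)]
  exact mlieBracket_coordVectorField hmT u v

end Connection

end AlmostFQuaternionicStructure

theorem eventually_contDiffAt_two {V W : Type*} [NormedAddCommGroup V] [NormedSpace ℝ V]
    [NormedAddCommGroup W] [NormedSpace ℝ W] {f : V → W} {x : V} (hf : ContDiffAt ℝ ∞ f x) :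
    ∀ᶠ y in 𝓝 x, ContDiffAt ℝ 2 f y :=
  (hf.of_le ENat.LEInfty.out).eventually (by simp)

section LocalExpression

variable {EM : Type*} [NormedAddCommGroup EM] [NormedSpace ℝ EM]
  {M : Type*} [TopologicalSpace M] [ChartedSpace EM M]
  {F : Type*} [NormedAddCommGroup F] [NormedSpace ℝ F]
  {E : M → Type*} [TopologicalSpace (TotalSpace F E)]
  [∀ x, AddCommGroup (E x)] [∀ x, Module ℝ (E x)] [∀ x, TopologicalSpace (E x)]
  [∀ x, IsTopologicalAddGroup (E x)] [∀ x, ContinuousSMul ℝ (E x)]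
  [FiberBundle F E] [VectorBundle ℝ F E] {x₀ : M}

section Frame

variable {𝒬 : QuaternionicStructure (EM := EM) F E} {A : Fin 3 → ∀ y : M, E y →L[ℝ] E y} {m : EM}

theorem linearCombination_coordEnd (A : Fin 3 → ∀ y : M, E y →L[ℝ] E y) (m : EM) :
    Fintype.linearCombination ℝ (fun i ↦ coordEnd F x₀ (A i) m) =
      coordLin F E x₀ m ∘ₗ Fintype.linearCombination ℝ fun i ↦ A i (coordPt x₀ m) := by
  refine LinearMap.ext fun v ↦ ?_
  simp only [LinearMap.comp_apply, Fintype.linearCombination_apply, map_sum, map_smul,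
    coordEnd_eq_coordLin]

theorem QuaternionicStructure.IsFrameAt.isQuaternionic_coordEnd
    (hA : 𝒬.IsFrameAt A (coordPt x₀ m)) (hm : m ∈ coordDomain F E x₀) :
    IsQuaternionic (Fintype.linearCombination ℝ fun i ↦ coordEnd F x₀ (A i) m) := by
  have hone : coordLin F E x₀ m 1 = 1 := by
    rw [← neg_inj, ← map_neg]
    exact coordLin_neg_id hm
  intro v w
  rw [linearCombination_coordEnd, LinearMap.comp_apply, LinearMap.comp_apply, ← coordLin_comp hm]
  refine (congrArg (coordLin F E x₀ m) (hA.isQuaternionic v w)).trans ?_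
  rw [map_sub, map_smul, hone, LinearMap.comp_apply]

theorem QuaternionicStructure.IsFrameAt.range_coordEnd (hA : 𝒬.IsFrameAt A (coordPt x₀ m)) :
    LinearMap.range (Fintype.linearCombination ℝ fun i ↦ coordEnd F x₀ (A i) m) =
      (𝒬.Q (coordPt x₀ m)).map (coordLin F E x₀ m) := by
  rw [linearCombination_coordEnd, LinearMap.range_comp, hA.range_eq]

theorem QuaternionicStructure.IsFrameAt.mem_Q {y : M} (hA : 𝒬.IsFrameAt A y) (i : Fin 3) :
    A i y ∈ 𝒬.Q y := by
  rw [← hA.range_eq, Fintype.range_linearCombination]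
  exact Submodule.subset_span ⟨i, rfl⟩

end Frame

theorem exists_endPt_eq (p : EndTotal F E) : ∃ (x₀ : M) (q : EM × (F →L[ℝ] F)),
    q.1 = extChartAt 𝓘(ℝ, EM) x₀ x₀ ∧ endPt F E x₀ q = p := by
  obtain ⟨x₀, A⟩ := p
  have hchart : extChartAt (endModel EM F) (⟨x₀, 0⟩ : EndTotal F E) =
      extChartAt (endModel EM F) (⟨x₀, A⟩ : EndTotal F E) := by
    rw [FiberBundle.extChartAt, FiberBundle.extChartAt]
  refine ⟨x₀, extChartAt (endModel EM F) (⟨x₀, A⟩ : EndTotal F E) ⟨x₀, A⟩, ?_, ?_⟩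
  · rw [FiberBundle.extChartAt]
    rfl
  · rw [endPt_eq, hchart]
    exact extChartAt_to_inv _

variable [IsManifold 𝓘(ℝ, EM) ∞ M] [ContMDiffVectorBundle ∞ F E 𝓘(ℝ, EM)]

theorem verticalLift_eq_dEndPt {q : EM × (F →L[ℝ] F)} (hq : q.1 ∈ coordDomain F E x₀)
    (T : E (coordPt x₀ q.1) →L[ℝ] E (coordPt x₀ q.1)) :
    verticalLift (EM := EM) (endPt F E x₀ q) T = dEndPt F E x₀ q (0, coordLin F E x₀ q.1 T) := by
  rw [← verticalLift_endPt hq]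
  congr 1
  exact (fromCoord_comp_coordLin hq T).symm

section Pullback

variable {q : EM × (F →L[ℝ] F)} {X Y : ∀ p : EndTotal F E, TangentSpace (endModel EM F) p}

variable (x₀) in
/-- The expression of a vector field on the total space of `End(E)` in the coordinates around
`x₀`. -/
def coordField (X : ∀ p : EndTotal F E, TangentSpace (endModel EM F) p) :
    EM × (F →L[ℝ] F) → EM × (F →L[ℝ] F) :=
  mpullback 𝓘(ℝ, EM × (F →L[ℝ] F)) (endModel EM F) (endPt F E x₀) X

theorem dEndPt_coordField (hq : q.1 ∈ coordDomain F E x₀)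
    (X : ∀ p : EndTotal F E, TangentSpace (endModel EM F) p) :
    dEndPt F E x₀ q (coordField x₀ X q) = X (endPt F E x₀ q) :=
  ((isInvertible_dEndPt hq).inverse_apply_eq.1 rfl).symm

variable [FiniteDimensional ℝ EM] [FiniteDimensional ℝ F]

theorem differentiableAt_coordField (hq : q.1 ∈ coordDomain F E x₀)
    (hX : ContMDiffAt (endModel EM F) (endModel EM F).tangent ∞ (fieldSection X)
      (endPt F E x₀ q)) : DifferentiableAt ℝ (coordField x₀ X) q := by
  have : IsManifold (endModel EM F) (∞ + 1) (EndTotal F E) :=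
    inferInstanceAs (IsManifold (endModel EM F) ∞ (EndTotal F E))
  have hpull := ContMDiffAt.mpullback_vectorField_preimage (m := 1) (hX.of_le ENat.LEInfty.out)
    (contMDiffAt_endPt hq) (isInvertible_dEndPt hq) (by norm_num; exact ENat.LEInfty.out)
  exact (contMDiffAt_vectorSpace_iff_contDiffAt.1 hpull).differentiableAt one_ne_zero

theorem dEndPt_lieBracket_coordField (hq : q.1 ∈ coordDomain F E x₀)
    (hX : ContMDiffAt (endModel EM F) (endModel EM F).tangent ∞ (fieldSection X)
      (endPt F E x₀ q))
    (hY : ContMDiffAt (endModel EM F) (endModel EM F).tangent ∞ (fieldSection Y)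
      (endPt F E x₀ q)) :
    dEndPt F E x₀ q (lieBracket ℝ (coordField x₀ X) (coordField x₀ Y) q) =
      mlieBracket (endModel EM F) X Y (endPt F E x₀ q) := by
  have hsmooth : minSmoothness ℝ 2 = 2 := minSmoothness_of_isRCLikeNormedField
  have : IsManifold (endModel EM F) (minSmoothness ℝ 2) (EndTotal F E) := by
    rw [hsmooth]
    exact IsManifold.of_le (n := ∞) ENat.LEInfty.out
  have hpull := mpullback_mlieBracket (hX.mdifferentiableAt (by simp))
    (hY.mdifferentiableAt (by simp)) (contMDiffAt_endPt hq) (hsmooth.trans_le ENat.LEInfty.out)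
  rw [← mlieBracketWithin_univ (I := 𝓘(ℝ, EM × (F →L[ℝ] F))) (M := EM × (F →L[ℝ] F)),
    mlieBracketWithin_eq_lieBracketWithin] at hpull
  have hbracket := hpull.trans
    (congrFun (lieBracketWithin_univ (𝕜 := ℝ) (V := coordField x₀ X) (W := coordField x₀ Y)) q)
  exact ((isInvertible_dEndPt hq).inverse_apply_eq.1 hbracket).symm

end Pullback

variable [FiniteDimensional ℝ EM] [FiniteDimensional ℝ F]
  {S : AlmostFQuaternionicStructure EM F E}
  {nabla : CovariantDerivative 𝓘(ℝ, EM) F E} {m : EM}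

/-- `𝒟` is the expression of `(S, ∇)` in the preferred chart and trivialization around `x₀`. -/
structure IsCoordExpr (S : AlmostFQuaternionicStructure EM F E)
    (nabla : CovariantDerivative 𝓘(ℝ, EM) F E) (x₀ : M) (𝒟 : LocalModel EM F) : Prop where
  mem_U : extChartAt 𝓘(ℝ, EM) x₀ x₀ ∈ 𝒟.U
  U_subset : 𝒟.U ⊆ coordDomain F E x₀
  ρ_eq : 𝒟.ρ = S.coordρ x₀
  Γ_eq : 𝒟.Γ = connForm nabla x₀
  Q_eq : ∀ m ∈ 𝒟.U, 𝒟.Q m = (S.Q (coordPt x₀ m)).map (coordLin F E x₀ m)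

theorem exists_isOpen_forall_contDiffAt [T2Space M]
    [CovariantDerivative.ContMDiffCovariantDerivative nabla ∞]
    {A : Fin 3 → ∀ y : M, E y →L[ℝ] E y}
    (hA : ∀ i, ContMDiffAt 𝓘(ℝ, EM) (endModel EM F) ∞ (endSection F E (A i)) x₀)
    (hframe : ∀ᶠ y in 𝓝 x₀, S.IsFrameAt A y) :
    ∃ U, IsOpen U ∧ extChartAt 𝓘(ℝ, EM) x₀ x₀ ∈ U ∧ ∀ m ∈ U, m ∈ coordDomain F E x₀ ∧
      (∀ᶠ y in 𝓝 (coordPt x₀ m), S.IsFrameAt A y) ∧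
      (∀ i, ContDiffAt ℝ 2 (coordEnd F x₀ (A i)) m) ∧ ContDiffAt ℝ 2 (S.coordι x₀) m ∧
      ContDiffAt ℝ 2 (S.coordρ x₀) m ∧ ContDiffAt ℝ 2 (connForm nabla x₀) m := by
  have hcont : Tendsto (coordPt x₀) (𝓝 (extChartAt 𝓘(ℝ, EM) x₀ x₀)) (𝓝 x₀) := by
    have := continuousAt_extChartAt_symm (I := 𝓘(ℝ, EM)) x₀
    rwa [ContinuousAt, extChartAt_to_inv] at this
  have hall := (eventually_mem_coordDomain (F := F) (E := E)).and <|
    (hcont.eventually hframe.eventually_nhds).and <|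
    (eventually_all.2 fun i ↦ eventually_contDiffAt_two (contDiffAt_coordEnd (hA i))).and <|
    (eventually_contDiffAt_two S.contDiffAt_coordι).and <|
    (eventually_contDiffAt_two S.contDiffAt_coordρ).and <|
    eventually_contDiffAt_two (contDiffAt_connForm nabla x₀)
  obtain ⟨U, hU, hUo, hxU⟩ := eventually_nhds_iff.1 hall
  exact ⟨U, hUo, hxU, hU⟩

theorem exists_isCoordExpr [T2Space M] [CovariantDerivative.ContMDiffCovariantDerivative nabla ∞]
    {D : CovariantDerivative 𝓘(ℝ, EM) EM (TangentSpace 𝓘(ℝ, EM) : M → Type _)}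
    (hD : D.torsion = 0) (hnabla : S.IsInducedBy nabla D)
    (hrank : ∀ x, 2 * finrank ℝ (S.V x) + 4 < finrank ℝ F) (x₀ : M) :
    ∃ 𝒟, IsCoordExpr S nabla x₀ 𝒟 := by
  obtain ⟨A, hA, hframe⟩ := S.exists_isFrameAt x₀
  obtain ⟨U, hUo, hxU, hU⟩ := exists_isOpen_forall_contDiffAt (nabla := nabla) hA hframe
  choose hdom hAU hAd hιd hρd hΓd using hU
  have hrange m (hm : m ∈ U) := (hAU m hm).self_of_nhds.range_coordEnd
  refine ⟨{
    U := U
    frame := fun m i ↦ coordEnd F x₀ (A i) m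
    ι := S.coordι x₀
    ρ := S.coordρ x₀
    Γ := connForm nabla x₀
    isOpen_U := hUo
    contDiffOn_frame := fun i m hm ↦ (hAd m hm i).contDiffWithinAt
    contDiffOn_ι := fun m hm ↦ (hιd m hm).contDiffWithinAt
    contDiffOn_ρ := fun m hm ↦ (hρd m hm).contDiffWithinAt
    contDiffOn_Γ := fun m hm ↦ (hΓd m hm).contDiffWithinAt
    isQuaternionic := fun m hm ↦ (hAU m hm).self_of_nhds.isQuaternionic_coordEnd (hdom m hm)
    ρ_ι := fun m hm ↦ AlmostFQuaternionicStructure.coordρ_coordι (hdom m hm)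
    apply_ker := fun m hm B hB hBB v hv ↦ by
      rw [hrange m hm] at hB
      obtain ⟨T, hT, rfl⟩ := hB
      exact AlmostFQuaternionicStructure.exists_coordLin_apply_eq_coordι (hdom m hm)
        ⟨hT, (coordLin_mul_self_eq_neg_one_iff (hdom m hm)).1 hBB⟩ hv
    torsion := fun m hm ↦ hnabla.fderiv_coordι_comm hD (hdom m hm)
      ((hιd m hm).differentiableAt two_ne_zero)
    parallel_P := fun m hm ↦ hnabla.compatible.parallel_coordι_comp_coordρ (hdom m hm)
      ((hιd m hm).differentiableAt two_ne_zero) ((hρd m hm).differentiableAt two_ne_zero)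
    parallel_frame := fun m hm i u ↦ by
      obtain ⟨B, hB, hderiv⟩ := hnabla.compatible.quaternionic.exists_coordLin_eq (hdom m hm)
        ((hAd m hm i).differentiableAt two_ne_zero) ((hAU m hm).mono fun y hy ↦ hy.mem_Q i) u
      rw [hrange m hm]
      exact ⟨B, hB, hderiv⟩
    lt_finrank := fun m hm ↦ by
      rw [AlmostFQuaternionicStructure.finrank_ker_coordρ (hdom m hm)]
      exact hrank _ }, hxU, hdom, rfl, rfl, hrange⟩

theorem exists_mem_horizontal_iff {q ξ : EM × (F →L[ℝ] F)} (hq : q.1 ∈ coordDomain F E x₀)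
    {C : F →L[ℝ] F} {w : TangentSpace 𝓘(ℝ, EM) (coordPt x₀ q.1)} :
    (∃ h ∈ horizontal nabla (endPt F E x₀ q), dproj (endPt F E x₀ q) h = w ∧
      dEndPt F E x₀ q ξ = dEndPt F E x₀ q (0, C) + h) ↔
      fromCoordT EM x₀ q.1 ξ.1 = w ∧ ξ.2 + ⁅connForm nabla x₀ q.1 ξ.1, q.2⁆ = C := by
  have hadd (ξ η : EM × (F →L[ℝ] F)) : dEndPt F E x₀ q ξ + dEndPt F E x₀ q η =
      dEndPt F E x₀ q (ξ + η) := (ContinuousLinearMap.map_add _ _ _).symm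
  constructor
  · rintro ⟨h, hh, hw, hξ⟩
    obtain ⟨η, hη, rfl⟩ := exists_dEndPt_eq_of_mem_horizontal hq hh
    rw [dproj_dEndPt hq] at hw
    obtain rfl := (isInvertible_dEndPt hq).injective (hξ.trans (hadd _ _))
    simp only [Prod.fst_add, Prod.snd_add, zero_add, add_assoc, hη, add_zero]
    exact ⟨hw, trivial⟩
  · rintro ⟨hw, hC⟩
    refine ⟨dEndPt F E x₀ q (ξ.1, ξ.2 - C), dEndPt_mem_horizontal hq ?_, ?_, ?_⟩
    · rw [sub_add_eq_add_sub, hC, sub_self]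
    · rwa [dproj_dEndPt hq]
    · rw [hadd, Prod.mk_add_mk, zero_add, add_sub_cancel]

namespace IsCoordExpr

variable {𝒟 : LocalModel EM F} (h : IsCoordExpr S nabla x₀ 𝒟)
  {q : EM × (F →L[ℝ] F)}
include h

theorem endPt_mem_Z_iff (hq : q.1 ∈ 𝒟.U) : endPt F E x₀ q ∈ S.Z ↔ q ∈ 𝒟.Z := by
  have hdom := h.U_subset hq
  have hsnd : coordLin F E x₀ q.1 (endPt F E x₀ q).2 = q.2 := coordLin_fromCoord_comp hdom q.2
  have hQ := coordLin_mem_map_iff hdom (T := (endPt F E x₀ q).2) (W := S.Q (coordPt x₀ q.1))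
  have hsq := coordLin_mul_self_eq_neg_one_iff hdom (T := (endPt F E x₀ q).2)
  rw [hsnd, ← h.Q_eq _ hq] at hQ
  rw [hsnd] at hsq
  exact (and_congr hQ hsq).symm.trans (and_iff_right hq).symm

theorem coordLin_mem_sphereTangent_iff {m : EM} (hm : m ∈ 𝒟.U)
    {J T : E (coordPt x₀ m) →L[ℝ] E (coordPt x₀ m)} :
    coordLin F E x₀ m T ∈ sphereTangent (𝒟.Q m) (coordLin F E x₀ m J) ↔
      T ∈ sphereTangent (S.Q (coordPt x₀ m)) J := by
  have hdom := h.U_subset hm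
  rw [mem_sphereTangent, mem_sphereTangent, h.Q_eq m hm, coordLin_mem_map_iff hdom,
    ← coordLin_comp hdom, ← coordLin_comp hdom, ← map_add,
    map_eq_zero_iff _ (coordLin_injective hdom)]
  rfl

theorem exists_horizontal_iff_vert_eq (hq : q.1 ∈ 𝒟.U) (ξ : EM × (F →L[ℝ] F)) (C : F →L[ℝ] F)
    (e : E (coordPt x₀ q.1)) :
    (∃ k ∈ horizontal nabla (endPt F E x₀ q), dproj (endPt F E x₀ q) k = S.ρ _ e ∧
      dEndPt F E x₀ q ξ = dEndPt F E x₀ q (0, C) + k) ↔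
      ξ.1 = 𝒟.ρ q.1 (toCoord F E x₀ q.1 e) ∧ 𝒟.vert q ξ = C := by
  have hdom := h.U_subset hq
  have hbase : fromCoordT EM x₀ q.1 ξ.1 = S.ρ _ e ↔ ξ.1 = 𝒟.ρ q.1 (toCoord F E x₀ q.1 e) := by
    rw [h.ρ_eq, ← (isInvertible_fromCoordT hdom).injective.eq_iff,
      AlmostFQuaternionicStructure.fromCoordT_coordρ hdom, fromCoord_toCoord hdom]
  rw [exists_mem_horizontal_iff hdom, hbase, LocalModel.vert, h.Γ_eq]

theorem cpx_mem_distC_iff (hq : q ∈ 𝒟.Z) (ξ₁ ξ₂ : EM × (F →L[ℝ] F)) :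
    cpx (dEndPt F E x₀ q ξ₁) (dEndPt F E x₀ q ξ₂) ∈
      S.distC S.ρ nabla (endPt F E x₀ q) ↔ 𝒟.IsTypeC q ξ₁ ξ₂ := by
  have hdom := h.U_subset hq.1
  let J : E (coordPt x₀ q.1) →L[ℝ] E (coordPt x₀ q.1) := (endPt F E x₀ q).2
  have hsnd : coordLin F E x₀ q.1 J = q.2 := coordLin_fromCoord_comp hdom q.2
  have hsnd_apply (e : E (coordPt x₀ q.1)) : toCoord F E x₀ q.1 (J e) =
      q.2 (toCoord F E x₀ q.1 e) := toCoord_fromCoord hdom _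
  have hmul (A : E (coordPt x₀ q.1) →L[ℝ] E (coordPt x₀ q.1)) :
      coordLin F E x₀ q.1 (J * A) = q.2 * coordLin F E x₀ q.1 A := by
    rw [← hsnd]
    exact coordLin_comp hdom _ _
  have htangent (A : E (coordPt x₀ q.1) →L[ℝ] E (coordPt x₀ q.1)) :
      coordLin F E x₀ q.1 A ∈ sphereTangent (𝒟.Q q.1) q.2 ↔
        A ∈ sphereTangent (S.Q (coordPt x₀ q.1)) J := by
    rw [← hsnd]
    exact h.coordLin_mem_sphereTangent_iff hq.1
  refine (QuaternionicStructure.cpx_mem_distC ((h.endPt_mem_Z_iff hq.1).2 hq)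
    ((dEndPt F E x₀ q).toLinearMap ∘ₗ LinearMap.inr ℝ EM (F →L[ℝ] F) ∘ₗ coordLin F E x₀ q.1)
    (verticalLift_eq_dEndPt hdom)).trans ⟨?_, fun hC ↦ ?_⟩
  · rintro ⟨(A : E (coordPt x₀ q.1) →L[ℝ] E (coordPt x₀ q.1)), hA, e, h₁, h₂⟩
    obtain ⟨hξ₁, hA₁⟩ := (h.exists_horizontal_iff_vert_eq hq.1 ξ₁ _ e).1 h₁
    obtain ⟨hξ₂, hA₂⟩ := (h.exists_horizontal_iff_vert_eq hq.1 ξ₂ _ (J e)).1 h₂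
    refine ⟨?_, by rw [hA₂, hA₁]; exact hmul A, _, hξ₁, hsnd_apply e ▸ hξ₂⟩
    rw [LocalModel.IsTangent, hA₁]
    exact (htangent A).2 hA
  · obtain ⟨f, hf₁, hf₂⟩ := hC.exists_base
    obtain ⟨A, hA⟩ : ∃ A, coordLin F E x₀ q.1 A = 𝒟.vert q ξ₁ :=
      ⟨_, coordLin_fromCoord_comp hdom _⟩
    refine ⟨A, (htangent A).1 (hA ▸ hC.tangent), fromCoord F E x₀ q.1 f,
      (h.exists_horizontal_iff_vert_eq hq.1 ξ₁ _ _).2 ⟨?_, hA.symm⟩,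
      (h.exists_horizontal_iff_vert_eq hq.1 ξ₂ _ (J _)).2 ⟨?_, (hmul A).symm ▸ ?_⟩⟩
    · rwa [toCoord_fromCoord hdom]
    · rwa [hsnd_apply, toCoord_fromCoord hdom]
    · rw [hA, hC.vert_eq]

end IsCoordExpr

theorem IsCoordExpr.lieBracket_mem_distC {𝒟 : LocalModel EM F} (h : IsCoordExpr S nabla x₀ 𝒟)
    {q : EM × (F →L[ℝ] F)} (hq : q ∈ 𝒟.Z) {O : Set (EndTotal F E)} (hO : IsOpen O)
    (hqO : endPt F E x₀ q ∈ O)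
    {X₁ X₂ Y₁ Y₂ : ∀ p : EndTotal F E, TangentSpace (endModel EM F) p}
    (hX₁ : ContMDiffOn (endModel EM F) (endModel EM F).tangent ∞ (fieldSection X₁) O)
    (hX₂ : ContMDiffOn (endModel EM F) (endModel EM F).tangent ∞ (fieldSection X₂) O)
    (hY₁ : ContMDiffOn (endModel EM F) (endModel EM F).tangent ∞ (fieldSection Y₁) O)
    (hY₂ : ContMDiffOn (endModel EM F) (endModel EM F).tangent ∞ (fieldSection Y₂) O)
    (hX : ∀ p ∈ O ∩ S.Z, cpx (X₁ p) (X₂ p) ∈ S.distC S.ρ nabla p)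
    (hY : ∀ p ∈ O ∩ S.Z, cpx (Y₁ p) (Y₂ p) ∈ S.distC S.ρ nabla p) :
    cpx (mlieBracket (endModel EM F) X₁ Y₁ (endPt F E x₀ q) -
          mlieBracket (endModel EM F) X₂ Y₂ (endPt F E x₀ q))
        (mlieBracket (endModel EM F) X₁ Y₂ (endPt F E x₀ q) +
          mlieBracket (endModel EM F) X₂ Y₁ (endPt F E x₀ q))
      ∈ S.distC S.ρ nabla (endPt F E x₀ q) := by
  have hdom := h.U_subset hq.1
  have hnhds := hO.mem_nhds hqO
  have htype {A B : ∀ p : EndTotal F E, TangentSpace (endModel EM F) p}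
      (hAB : ∀ p ∈ O ∩ S.Z, cpx (A p) (B p) ∈ S.distC S.ρ nabla p) :
      ∀ᶠ q' in 𝓝[𝒟.Z] q, 𝒟.IsTypeC q' (coordField x₀ A q') (coordField x₀ B q') := by
    filter_upwards [self_mem_nhdsWithin,
      mem_nhdsWithin_of_mem_nhds ((contMDiffAt_endPt hdom).continuousAt hnhds)] with q' hq' hq'O
    have hdom' := h.U_subset hq'.1
    rw [← h.cpx_mem_distC_iff hq', dEndPt_coordField hdom', dEndPt_coordField hdom']
    exact hAB _ ⟨hq'O, (h.endPt_mem_Z_iff hq'.1).2 hq'⟩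
  replace hX₁ := hX₁.contMDiffAt hnhds
  replace hX₂ := hX₂.contMDiffAt hnhds
  replace hY₁ := hY₁.contMDiffAt hnhds
  replace hY₂ := hY₂.contMDiffAt hnhds
  have hbracket := 𝒟.isTypeC_lieBracket hq (differentiableAt_coordField hdom hX₁)
    (differentiableAt_coordField hdom hX₂) (differentiableAt_coordField hdom hY₁)
    (differentiableAt_coordField hdom hY₂) (htype hX) (htype hY)
  rw [← h.cpx_mem_distC_iff hq, ContinuousLinearMap.map_sub, ContinuousLinearMap.map_add,
    dEndPt_lieBracket_coordField hdom hX₁ hY₁, dEndPt_lieBracket_coordField hdom hX₂ hY₂,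
    dEndPt_lieBracket_coordField hdom hX₁ hY₂, dEndPt_lieBracket_coordField hdom hX₂ hY₁]
    at hbracket
  exact hbracket

end LocalExpression

end CoCR

end

theorem proposition3p3_general
    {EM : Type*} [NormedAddCommGroup EM] [NormedSpace ℝ EM] [FiniteDimensional ℝ EM]
    {M : Type*} [TopologicalSpace M] [T2Space M]
    [ChartedSpace EM M] [IsManifold 𝓘(ℝ, EM) ∞ M]
    {F : Type*} [NormedAddCommGroup F] [NormedSpace ℝ F] [FiniteDimensional ℝ F]
    {E : M → Type*} [TopologicalSpace (TotalSpace F E)]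
    [∀ x, AddCommGroup (E x)] [∀ x, Module ℝ (E x)] [∀ x, TopologicalSpace (E x)]
    [∀ x, IsTopologicalAddGroup (E x)] [∀ x, ContinuousSMul ℝ (E x)]
    [FiberBundle F E] [VectorBundle ℝ F E] [ContMDiffVectorBundle ∞ F E 𝓘(ℝ, EM)]
    (S : CoCR.AlmostFQuaternionicStructure EM F E)
    (D : CovariantDerivative 𝓘(ℝ, EM) EM (TangentSpace 𝓘(ℝ, EM) : M → Type _))
    (hD : D.torsion = 0)
    (nabla : CovariantDerivative 𝓘(ℝ, EM) F E)
    [CovariantDerivative.ContMDiffCovariantDerivative nabla ∞]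
    (hnabla : S.IsInducedBy nabla D)
    (hrank : ∀ x, 2 * Module.finrank ℝ (S.V x) + 4 < Module.finrank ℝ F) :
    S.toAlmostCoCR.IsIntegrable nabla := by
  intro O hO X₁ X₂ Y₁ Y₂ hX₁ hX₂ hY₁ hY₂ hX hY p hp
  obtain ⟨x₀, q, hq, rfl⟩ := CoCR.exists_endPt_eq (EM := EM) p
  obtain ⟨𝒟, h⟩ := CoCR.exists_isCoordExpr hD hnabla hrank x₀
  have hqZ : q ∈ 𝒟.Z := (h.endPt_mem_Z_iff (hq ▸ h.mem_U)).1 hp.2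
  exact h.lieBracket_mem_distC hqZ hO hp.1 hX₁ hX₂ hY₁ hY₂ hX hY

theorem proposition3p3
    {EM : Type*} [NormedAddCommGroup EM] [NormedSpace ℝ EM] [FiniteDimensional ℝ EM]
    {M : Type*} [TopologicalSpace M] [T2Space M] [SecondCountableTopology M]
    [ChartedSpace EM M] [IsManifold 𝓘(ℝ, EM) ∞ M]
    {F : Type*} [NormedAddCommGroup F] [NormedSpace ℝ F] [FiniteDimensional ℝ F]
    {E : M → Type*} [TopologicalSpace (TotalSpace F E)]
    [∀ x, AddCommGroup (E x)] [∀ x, Module ℝ (E x)] [∀ x, TopologicalSpace (E x)]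
    [∀ x, IsTopologicalAddGroup (E x)] [∀ x, ContinuousSMul ℝ (E x)]
    [FiberBundle F E] [VectorBundle ℝ F E] [ContMDiffVectorBundle ∞ F E 𝓘(ℝ, EM)]
    (S : CoCR.AlmostFQuaternionicStructure EM F E)
    (D : CovariantDerivative 𝓘(ℝ, EM) EM (TangentSpace 𝓘(ℝ, EM) : M → Type _))
    (hD : D.torsion = 0)
    (nabla : CovariantDerivative 𝓘(ℝ, EM) F E)
    [CovariantDerivative.ContMDiffCovariantDerivative nabla ∞]
    (hnabla : S.IsInducedBy nabla D)
    (hrank : ∀ x, Module.finrank ℝ F = 4 * Module.finrank ℝ (S.V x))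
    (hrank12 : 12 ≤ Module.finrank ℝ F) :
    S.toAlmostCoCR.IsIntegrable nabla :=
  proposition3p3_general S D hD nabla hnabla fun x ↦ by have := hrank x; omega
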